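/- Fix $\alpha\in(0,1)$ and put $q=\frac{2(2-\alpha)}{1-\alpha}$ (so $q>4$). For each $n$ let $p_n\in[0,1]$ and let $A_n=(\delta_{ij}\xi_{ij})_{i,j=1}^n$ be the random $n\times n$ real matrix in which the $\delta_{ij}$ are Bernoulli random variables with $\mathbb P(\delta_{ij}=1)=p_n$, the $\xi_{ij}$ are identically distributed real random variables with $\mathbb E\,\xi_{ij}=0$, $\operatorname{Var}(\xi_{ij})\ge 1$ and $\mathbb E|\xi_{ij}|^q\le M<\infty$, and all the variables $\delta_{ij},\xi_{ij}$, $1\le i,j\le n$, are independent. Assume $p_n=\Omega(n^{-\alpha})$, that is, there is $\kappa>0$ with $p_n\ge\kappa n^{-\alpha}$ for all large $n$. Write $s_{\max}(A)=\sup_{\|x\|_2=1}\|Ax\|_2$, $s_{\min}(A)=\inf_{\|x\|_2=1}\|Ax\|_2$, and $\sigma(A)=s_{\max}(A)/s_{\min}(A)$ for the condition number (with $\sigma(A)=\infty$ if $s_{\min}(A)=0$); $\|\cdot\|$ is the operator norm on Euclidean space. Then for every $\delta>0$: (i) for every $R<\infty$ there are $\varepsilon>0$ and $n_0$, depending only on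 $R,\alpha,\delta,M,\kappa$, such that for all $n\ge n_0$ with $p_n\ge\kappa n^{-\alpha}$ and every deterministic real diagonal $n\times n$ matrix $D_n$ with $\|D_n\|\le R\sqrt{np_n}$, $$\mathbb P\Big(s_{\min}(A_n+D_n)\le\varepsilon\sqrt{p_n/n}\Big)\le\delta;$$ (ii) there are $K_0<\infty$ and $n_0$, depending only on $\alpha,\delta,M,\kappa$, such that for all $n\ge n_0$ with $p_n\ge\kappa n^{-\alpha}$, $$\mathbb P\big(\sigma(A_n)\le K_0\,n\big)\ge 1-\delta.$$ -/

import Mathlib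

open MeasureTheory ProbabilityTheory
open scoped unitInterval ENNReal

universe u

/-- The largest singular value `sup_{‖x‖₂ = 1} ‖A x‖₂`. -/
noncomputable def sMax {n : ℕ} (A : Matrix (Fin n) (Fin n) ℝ) : ℝ :=
  ⨆ x : Metric.sphere (0 : EuclideanSpace ℝ (Fin n)) 1,
    ‖Matrix.toEuclideanCLM (n := Fin n) (𝕜 := ℝ) A (x : EuclideanSpace ℝ (Fin n))‖

/-- The smallest singular value `inf_{‖x‖₂ = 1} ‖A x‖₂`. -/
noncomputable def sMin {n : ℕ} (A : Matrix (Fin n) (Fin n) ℝ) : ℝ :=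
  ⨅ x : Metric.sphere (0 : EuclideanSpace ℝ (Fin n)) 1,
    ‖Matrix.toEuclideanCLM (n := Fin n) (𝕜 := ℝ) A (x : EuclideanSpace ℝ (Fin n))‖

open Classical in
/-- The condition number `s_max(A) / s_min(A)`, equal to `∞` when `s_min(A) = 0`. -/
noncomputable def condNumber {n : ℕ} (A : Matrix (Fin n) (Fin n) ℝ) : ℝ≥0∞ :=
  if sMin A = 0 then ⊤ else ENNReal.ofReal (sMax A / sMin A)

/-- The moment exponent `q = 2 (2 - α) / (1 - α)`. -/
noncomputable def momentExponent (α : ℝ) : ℝ := 2 * (2 - α) / (1 - α)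

/-- `χ i j` are Bernoulli variables with `P(χ i j = 1) = p`, `ξ i j` are identically distributed
centered variables of variance at least one whose absolute `q`-th moment is finite and at most `M`,
and all the variables `χ i j`, `ξ i j` are jointly independent. -/
structure IsSparseEnsemble (q M : ℝ) {n : ℕ} (p : I) {Ω : Type u} [MeasurableSpace Ω]
    (μ : Measure Ω) (χ ξ : Fin n → Fin n → Ω → ℝ) : Prop where
  measurable_bernoulli : ∀ i j, Measurable (χ i j)
  measurable_entry : ∀ i j, Measurable (ξ i j)
  indep : iIndepFun
    (Sum.elim (fun e : Fin n × Fin n => χ e.1 e.2) (fun e : Fin n × Fin n => ξ e.1 e.2)) μ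
  law_bernoulli : ∀ i j, μ.map (χ i j) = bernoulliMeasure (1 : ℝ) 0 p
  identDistrib : ∀ i j k l, IdentDistrib (ξ i j) (ξ k l) μ μ
  integrable_moment : ∀ i j, Integrable (fun ω => |ξ i j ω| ^ q) μ
  moment_le : ∀ i j, ∫ ω, |ξ i j ω| ^ q ∂μ ≤ M
  centered : ∀ i j, ∫ ω, ξ i j ω ∂μ = 0
  one_le_variance : ∀ i j, 1 ≤ variance (ξ i j) μ

/-- The random matrix with entries `χ i j * ξ i j`, at the outcome `ω`. -/
def sparseMatrix {n : ℕ} {Ω : Type u} (χ ξ : Fin n → Fin n → Ω → ℝ) (ω : Ω) :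
    Matrix (Fin n) (Fin n) ℝ :=
  Matrix.of fun i j => χ i j ω * ξ i j ω

/-! Both parts follow from one event of small probability: either the operator norm of the sparse
matrix exceeds `K √(np)`, or some unit vector has an image under `A + D` of norm at most `ε √(p/n)`.
Since `√(np) = n √(p/n)`, its complement gives the condition number bound, and allowing a shift `D`
gives (i).

Lower bound. Unit vectors are sorted by `flatMass`, the squared mass on coordinates below a
threshold, because the characteristic function of an entry is controlled only near zero. Flat mass
on coordinates of size at most `h` makes the image of a fixed vector short with probability at most
`exp (-c n min (p / h², 1))` (`CenteredLaw.measureReal_l2_mv_le`). For sparse `p` this does not beat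
the entropy of all non-spread vectors at once, so the threshold is lowered by polynomial steps. At
each step, flat mass at the old threshold gives the probability estimate, and lack of it at the new
one gives a small net (`compBound_step`, `compBound_pow`). Once `p / h²` is bounded below, a last
step reaches `h = 1 / √(θn)` (`exists_compBound_linear`).

For spread vectors a union bound is replaced by geometry. A short combination of columns with a
large `k`-th coefficient puts column `k` near the span of the others. A unit normal to that span is
annihilated by `n - 1` independent rows, hence is itself spread by the previous step, and is
independent of column `k`; a one-dimensional small ball estimate then applies
(`CenteredLaw.measureReal_colEvent_le`). A spread vector has a number of large coefficients
proportional to `n`, so averaging over `k` loses only a constant.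

Norm. Entries are truncated slightly below `√(np)` and recentered. The trace moments of the
truncated matrix are compared, kernel by kernel over closed walks, with those of a small matrix of
bounded entries, which a net controls (`sum_walkWeight_le`, `integral_trace_refLaw_le`); no walks
need to be counted. The removed large entries are, with high probability, at most one per row and
column, so their matrix has the norm of its largest entry. The exponent `q` is exactly the one that
keeps the expected number of entries above `√(np)` bounded (`sq_mul_rpow_neg_momentExponent_le`). -/

/-! ### The Euclidean norm of a finite family -/

section EuclideanNorm

variable {J : Type*} [Fintype J]

/-- The Euclidean norm of a finite family of reals. -/
noncomputable def l2 (x : J → ℝ) : ℝ := ‖WithLp.toLp 2 x‖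

lemma l2_nonneg (x : J → ℝ) : 0 ≤ l2 x := norm_nonneg _

lemma l2_sq (x : J → ℝ) : l2 x ^ 2 = ∑ j, x j ^ 2 := by
  simp [l2, EuclideanSpace.norm_sq_eq]

lemma l2_eq_sqrt (x : J → ℝ) : l2 x = √(∑ j, x j ^ 2) := by
  rw [← l2_sq, Real.sqrt_sq (l2_nonneg x)]

@[simp] lemma l2_zero : l2 (0 : J → ℝ) = 0 := by simp [l2]

lemma l2_add_le (x y : J → ℝ) : l2 (x + y) ≤ l2 x + l2 y := by
  simpa [l2] using norm_add_le (WithLp.toLp 2 x) (WithLp.toLp 2 y)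

lemma l2_smul (c : ℝ) (x : J → ℝ) : l2 (c • x) = |c| * l2 x := by
  simp [l2, norm_smul]

lemma l2_sub_le (x y : J → ℝ) : l2 (x - y) ≤ l2 x + l2 y := by
  simpa [l2] using norm_sub_le (WithLp.toLp 2 x) (WithLp.toLp 2 y)

lemma l2_eq_zero {x : J → ℝ} : l2 x = 0 ↔ x = 0 := by simp [l2]

lemma l2_le_of_sq_le {x : J → ℝ} {t : ℝ} (ht : 0 ≤ t) (h : ∑ j, x j ^ 2 ≤ t ^ 2) : l2 x ≤ t := by
  rw [← l2_sq] at h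
  exact abs_le_of_sq_le_sq' h ht |>.2

lemma l2_mono {x y : J → ℝ} (h : ∀ j, x j ^ 2 ≤ y j ^ 2) : l2 x ≤ l2 y := by
  refine l2_le_of_sq_le (l2_nonneg y) ?_
  rw [l2_sq]
  exact Finset.sum_le_sum fun j _ => h j

lemma continuous_l2 : Continuous (l2 : (J → ℝ) → ℝ) := by
  have : (l2 : (J → ℝ) → ℝ) = fun x => √(∑ j, x j ^ 2) := funext l2_eq_sqrt
  rw [this]; fun_prop

lemma abs_dotProduct_le (x y : J → ℝ) : |x ⬝ᵥ y| ≤ l2 x * l2 y := by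
  rw [← abs_of_nonneg (mul_nonneg (l2_nonneg x) (l2_nonneg y))]
  apply sq_le_sq.1
  rw [mul_pow, l2_sq, l2_sq]
  exact Finset.sum_mul_sq_le_sq_mul_sq _ _ _

lemma abs_apply_le_l2 (x : J → ℝ) (j : J) : |x j| ≤ l2 x := by
  rw [← abs_of_nonneg (l2_nonneg x)]
  apply sq_le_sq.1
  rw [l2_sq]
  exact Finset.single_le_sum (f := fun j => x j ^ 2) (fun i _ => sq_nonneg _) (Finset.mem_univ j)

end EuclideanNorm

/-! ### Nets -/

section Nets

open Module Metric

/-- Volume comparison: disjoint balls of radius `ε / 2` fit into a ball of radius `1 + ε / 2`, and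
the ratio of the radii is at most `3 / ε` because `ε ≤ 1`. -/
lemma card_le_of_separated_unitBall {E : Type*} [NormedAddCommGroup E] [NormedSpace ℝ E]
    [FiniteDimensional ℝ E] {ε : ℝ} (hε : 0 < ε) (hε1 : ε ≤ 1) (s : Finset E)
    (hs : ∀ c ∈ s, ‖c‖ ≤ 1) (h : ∀ c ∈ s, ∀ d ∈ s, c ≠ d → ε ≤ ‖c - d‖) :
    (s.card : ℝ) ≤ (3 / ε) ^ finrank ℝ E := by
  borelize E
  let μ : Measure E := Measure.addHaar
  have hδ : 0 < ε / 2 := by positivity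
  have hρ : 0 < 1 + ε / 2 := by positivity
  have D : Set.Pairwise (s : Set E) (Function.onFun Disjoint fun c => ball (c : E) (ε / 2)) := by
    rintro c hc d hd hcd
    apply ball_disjoint_ball
    rw [dist_eq_norm]
    linarith [h c hc d hd hcd]
  have hsub : (⋃ c ∈ s, ball (c : E) (ε / 2)) ⊆ ball (0 : E) (1 + ε / 2) := by
    refine Set.iUnion₂_subset fun x hx => ball_subset_ball' ?_
    rw [dist_zero_right]; linarith [hs x hx]
  have hvol : (s.card : ℝ≥0∞) * ENNReal.ofReal ((ε / 2) ^ finrank ℝ E) * μ (ball 0 1) ≤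
      ENNReal.ofReal ((1 + ε / 2) ^ finrank ℝ E) * μ (ball 0 1) :=
    calc
      (s.card : ℝ≥0∞) * ENNReal.ofReal ((ε / 2) ^ finrank ℝ E) * μ (ball 0 1)
          = μ (⋃ c ∈ s, ball (c : E) (ε / 2)) := by
        rw [measure_biUnion_finset D fun c _ => measurableSet_ball]
        simp only [μ.addHaar_ball_of_pos _ hδ, Finset.sum_const, nsmul_eq_mul, mul_assoc]
      _ ≤ μ (ball (0 : E) (1 + ε / 2)) := measure_mono hsub
      _ = _ := by simp only [μ.addHaar_ball_of_pos _ hρ]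
  have J : (s.card : ℝ≥0∞) * ENNReal.ofReal ((ε / 2) ^ finrank ℝ E)
      ≤ ENNReal.ofReal ((1 + ε / 2) ^ finrank ℝ E) :=
    (ENNReal.mul_le_mul_iff_left (measure_ball_pos _ _ zero_lt_one).ne' measure_ball_lt_top.ne).1 hvol
  have K := ENNReal.toReal_le_of_le_ofReal (pow_nonneg hρ.le _) J
  rw [ENNReal.toReal_mul, ENNReal.toReal_natCast, ENNReal.toReal_ofReal (by positivity)] at K
  calc (s.card : ℝ) ≤ (1 + ε / 2) ^ finrank ℝ E / (ε / 2) ^ finrank ℝ E := by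
        rwa [le_div_iff₀ (by positivity)]
    _ = ((1 + ε / 2) / (ε / 2)) ^ finrank ℝ E := (div_pow _ _ _).symm
    _ ≤ _ := by
        refine pow_le_pow_left₀ (by positivity) ?_ _
        rw [div_le_div_iff₀ (by positivity) hε]
        nlinarith

/-- A separated set of maximal cardinality is a net: a point far from all its members could be
added. The volume bound makes the maximum exist. -/
lemma exists_net_unitBall (E : Type*) [NormedAddCommGroup E] [NormedSpace ℝ E]
    [FiniteDimensional ℝ E] {ε : ℝ} (hε : 0 < ε) (hε1 : ε ≤ 1) :
    ∃ s : Finset E, (s.card : ℝ) ≤ (3 / ε) ^ finrank ℝ E ∧ (∀ c ∈ s, ‖c‖ ≤ 1) ∧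
      ∀ x : E, ‖x‖ ≤ 1 → ∃ c ∈ s, ‖x - c‖ ≤ ε := by
  classical
  let P : ℕ → Prop := fun N => ∃ s : Finset E, s.card = N ∧ (∀ c ∈ s, ‖c‖ ≤ 1) ∧
    ∀ c ∈ s, ∀ d ∈ s, c ≠ d → ε ≤ ‖c - d‖
  have hbdd : ∀ N, P N → N ≤ ⌊(3 / ε) ^ finrank ℝ E⌋₊ := by
    rintro N ⟨s, rfl, h1, h2⟩
    exact Nat.le_floor (card_le_of_separated_unitBall hε hε1 s h1 h2)
  obtain ⟨s, hcard, h1, h2⟩ : P (Nat.findGreatest P ⌊(3 / ε) ^ finrank ℝ E⌋₊) :=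
    Nat.findGreatest_spec (m := 0) (Nat.zero_le _) ⟨∅, by simp⟩
  refine ⟨s, card_le_of_separated_unitBall hε hε1 s h1 h2, h1, fun x hx => ?_⟩
  by_contra! hcon
  have hxs : x ∉ s := fun hmem => by
    have := hcon x hmem
    simp at this; linarith
  have hP : P (s.card + 1) := by
    refine ⟨insert x s, Finset.card_insert_of_notMem hxs, ?_, ?_⟩
    · intro c hc
      rcases Finset.mem_insert.1 hc with rfl | hc
      · exact hx
      · exact h1 c hc
    · intro c hc d hd hcd
      rcases Finset.mem_insert.1 hc with hc' | hc' <;>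
        rcases Finset.mem_insert.1 hd with hd' | hd'
      · exact absurd (hc'.trans hd'.symm) hcd
      · rw [hc']; exact (hcon d hd').le
      · rw [hd', norm_sub_rev]; exact (hcon c hc').le
      · exact h2 c hc' d hd' hcd
  have := Nat.le_findGreatest (hbdd _ hP) hP
  omega

/-- A net for the vectors of the unit ball supported on a given set of coordinates. -/
lemma exists_net_supported {J : Type*} [Fintype J] [DecidableEq J] (L : Finset J) {ε : ℝ}
    (hε : 0 < ε) (hε1 : ε ≤ 1) :
    ∃ s : Finset (J → ℝ), (s.card : ℝ) ≤ (3 / ε) ^ L.card ∧ (∀ z ∈ s, l2 z ≤ 1) ∧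
      ∀ x : J → ℝ, l2 x ≤ 1 → (∀ j ∉ L, x j = 0) → ∃ z ∈ s, l2 (x - z) ≤ ε := by
  classical
  obtain ⟨s, hs, h1, h2⟩ := exists_net_unitBall (EuclideanSpace ℝ L) hε hε1
  let ext : EuclideanSpace ℝ L → (J → ℝ) := fun z j => if h : j ∈ L then z ⟨j, h⟩ else 0
  have hext : ∀ z, l2 (ext z) = ‖z‖ := by
    intro z
    rw [l2_eq_sqrt, EuclideanSpace.norm_eq]
    congr 1
    rw [← Finset.sum_subset (Finset.subset_univ L)]
    · rw [← Finset.sum_coe_sort L]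
      refine Finset.sum_congr rfl fun j _ => ?_
      simp [ext]
    · intro j _ hj; simp [ext, hj]
  refine ⟨s.image ext, ?_, ?_, ?_⟩
  · refine le_trans (by exact_mod_cast Finset.card_image_le) (hs.trans_eq ?_)
    simp
  · intro z hz
    obtain ⟨w, hw, rfl⟩ := Finset.mem_image.1 hz
    rw [hext]; exact h1 w hw
  · intro x hx hxL
    let w : EuclideanSpace ℝ L := WithLp.toLp 2 fun j => x j
    have hw : ext w = x := by
      funext j
      by_cases hj : j ∈ L
      · simp [ext, w, hj]
      · simp [ext, hj, hxL j hj]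
    obtain ⟨c, hc, hcw⟩ := h2 w (by rw [← hext, hw]; exact hx)
    refine ⟨ext c, Finset.mem_image_of_mem _ hc, ?_⟩
    have : x - ext c = ext (w - c) := by
      rw [← hw]; funext j
      by_cases hj : j ∈ L <;> simp [ext, hj]
    rw [this, hext]; exact hcw

/-- A net for the sparse vectors of the unit ball. -/
lemma exists_net_sparse (J : Type*) [Fintype J] [DecidableEq J] {ε m t : ℝ}
    (hε : 0 < ε) (hε1 : ε ≤ 1) (ht : 0 < t) (ht1 : t ≤ 1) :
    ∃ s : Finset (J → ℝ),
      (s.card : ℝ) ≤ Real.exp (t * Fintype.card J + m * Real.log (1 / t) + m * Real.log (3 / ε)) ∧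
      (∀ z ∈ s, l2 z ≤ 1) ∧
      ∀ (x : J → ℝ) (L : Finset J), l2 x ≤ 1 → (L.card : ℝ) ≤ m → (∀ j ∉ L, x j = 0) →
        ∃ z ∈ s, l2 (x - z) ≤ ε := by
  classical
  choose s hs h1 h2 using fun L : Finset J => exists_net_supported L hε hε1
  refine ⟨(Finset.univ.filter fun L : Finset J => (L.card : ℝ) ≤ m).biUnion s, ?_, ?_, ?_⟩
  · have h3 : 1 ≤ 3 / ε := by rw [le_div_iff₀ hε]; linarith
    have h4 : 1 ≤ 1 / t := by rw [le_div_iff₀ ht]; linarith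
    calc (((Finset.univ.filter fun L : Finset J => (L.card : ℝ) ≤ m).biUnion s).card : ℝ)
        ≤ ∑ L ∈ Finset.univ.filter (fun L : Finset J => (L.card : ℝ) ≤ m), ((s L).card : ℝ) := by
          exact_mod_cast Finset.card_biUnion_le
      -- Supports are counted without binomial coefficients: `1 ≤ t ^ |L| * (1 / t) ^ m` when `|L| ≤
      -- m`, and the weights `t ^ |L|` sum over all subsets to `(1 + t) ^ |J| ≤ exp (t |J|)`. The
      -- useful choice is `t = m / |J|`.
      _ ≤ ∑ L ∈ Finset.univ.filter (fun L : Finset J => (L.card : ℝ) ≤ m),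
            t ^ L.card * Real.exp (m * Real.log (1 / t) + m * Real.log (3 / ε)) := by
          refine Finset.sum_le_sum fun L hL => (hs L).trans ?_
          have hL : (L.card : ℝ) ≤ m := (Finset.mem_filter.1 hL).2
          rw [Real.exp_add]
          have e1 : (3 / ε) ^ L.card ≤ Real.exp (m * Real.log (3 / ε)) := by
            rw [← Real.rpow_natCast, Real.rpow_def_of_pos (by positivity), mul_comm]
            exact Real.exp_le_exp.2 (mul_le_mul_of_nonneg_right hL (Real.log_nonneg h3))
          have e2 : (1 / t) ^ L.card ≤ Real.exp (m * Real.log (1 / t)) := by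
            rw [← Real.rpow_natCast, Real.rpow_def_of_pos (by positivity), mul_comm]
            exact Real.exp_le_exp.2 (mul_le_mul_of_nonneg_right hL (Real.log_nonneg h4))
          have e3 : 1 ≤ t ^ L.card * Real.exp (m * Real.log (1 / t)) := by
            calc (1 : ℝ) = t ^ L.card * (1 / t) ^ L.card := by
                  rw [← mul_pow, mul_one_div_cancel ht.ne', one_pow]
              _ ≤ _ := by gcongr
          rw [← mul_assoc]
          calc (3 / ε) ^ L.card ≤ 1 * Real.exp (m * Real.log (3 / ε)) := by rw [one_mul]; exact e1
            _ ≤ _ := by gcongr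
      _ ≤ ∑ L : Finset J, t ^ L.card * Real.exp (m * Real.log (1 / t) + m * Real.log (3 / ε)) :=
          Finset.sum_le_sum_of_subset_of_nonneg (Finset.subset_univ _)
            fun _ _ _ => by positivity
      _ = (1 + t) ^ Fintype.card J * Real.exp (m * Real.log (1 / t) + m * Real.log (3 / ε)) := by
          rw [← Finset.sum_mul]
          congr 1
          have := Finset.sum_pow_mul_eq_add_pow t 1 (Finset.univ : Finset J)
          simp only [one_pow, mul_one, Finset.powerset_univ, Finset.card_univ] at this
          rw [this, add_comm]
      _ ≤ Real.exp (t * Fintype.card J) *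
            Real.exp (m * Real.log (1 / t) + m * Real.log (3 / ε)) := by
          gcongr
          calc (1 + t) ^ Fintype.card J ≤ (Real.exp t) ^ Fintype.card J := by
                gcongr; linarith [Real.add_one_le_exp t]
            _ = _ := by rw [← Real.exp_nat_mul, mul_comm]
      _ = _ := by rw [← Real.exp_add, add_assoc]
  · intro z hz
    obtain ⟨L, -, hz⟩ := Finset.mem_biUnion.1 hz
    exact h1 L z hz
  · intro x L hx hL hxL
    obtain ⟨z, hz, hxz⟩ := h2 L x hx hxL
    exact ⟨z, Finset.mem_biUnion.2 ⟨L, by simpa using hL, hz⟩, hxz⟩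

end Nets

/-! ### Entry laws and their characteristic functions -/

/-- A centered law on `ℝ` which charges `{0}ᶜ` by at most `p`, has variance at least `p` and
absolute moments of order two and three at most `p * s`. -/
structure CenteredLaw (s p : ℝ) (ν : Measure ℝ) : Prop where
  isProb : IsProbabilityMeasure ν
  p_pos : 0 < p
  p_le_one : p ≤ 1
  one_le : 1 ≤ s
  integrable_id : Integrable (fun x => x) ν
  integrable_sq : Integrable (fun x => x ^ 2) ν
  integrable_cube : Integrable (fun x => |x| ^ 3) ν
  centered : ∫ x, x ∂ν = 0
  le_sq : p ≤ ∫ x, x ^ 2 ∂ν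
  sq_le : ∫ x, x ^ 2 ∂ν ≤ p * s
  cube_le : ∫ x, |x| ^ 3 ∂ν ≤ p * s

lemma norm_exp_I_sub_taylor_le (x : ℝ) :
    ‖Complex.exp (x * Complex.I) - (1 + x * Complex.I - x ^ 2 / 2)‖ ≤ 4 * |x| ^ 3 := by
  have hn : ‖(x : ℂ) * Complex.I‖ = |x| := by simp
  rcases le_or_gt |x| 1 with h | h
  · have := Complex.exp_bound (x := (x : ℂ) * Complex.I) (by rw [hn]; exact h) (n := 3) (by norm_num)
    rw [hn] at this
    have e : ∑ m ∈ Finset.range 3, ((x : ℂ) * Complex.I) ^ m / (m.factorial : ℂ)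
        = 1 + x * Complex.I - x ^ 2 / 2 := by
      simp [Finset.sum_range_succ, mul_pow]; ring
    rw [e] at this
    refine this.trans ?_
    norm_num [Nat.factorial]
    have : 0 ≤ |x| ^ 3 := by positivity
    linarith
  · have h1 : ‖Complex.exp (x * Complex.I)‖ = 1 := Complex.norm_exp_ofReal_mul_I x
    have h2 : ‖(1 : ℂ) + x * Complex.I - x ^ 2 / 2‖ ≤ 1 + |x| + |x| ^ 2 / 2 := by
      refine (norm_sub_le _ _).trans (add_le_add ((norm_add_le _ _).trans ?_) ?_)
      · simp
      · simp
    refine (norm_sub_le _ _).trans ?_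
    rw [h1]
    nlinarith [mul_pos (sub_pos.2 h) (sub_pos.2 h), abs_nonneg x, pow_pos (lt_trans one_pos h) 2,
      pow_pos (lt_trans one_pos h) 3]

namespace CenteredLaw

variable {s p : ℝ} {ν : Measure ℝ}

/-- Second order Taylor expansion: centering leaves `1 - t² v / 2` with `v ≥ p`, and the range of
`t` is chosen so that the cubic error `4 |t|³ p s` is at most `t² p / 4`, half of the gain. -/
lemma norm_charFun_le (hν : CenteredLaw s p ν) {t : ℝ} (ht : |t| ≤ 1 / (16 * s)) :
    ‖charFun ν t‖ ≤ Real.exp (-(t ^ 2 * p / 4)) := by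
  have := hν.isProb
  have hs := hν.one_le
  have hp := hν.p_pos
  set v : ℝ := ∫ x, x ^ 2 ∂ν with hv
  have hts : |t| * (16 * s) ≤ 1 := by rwa [le_div_iff₀ (by positivity)] at ht
  have ht1 : |t| ≤ 1 := by nlinarith [abs_nonneg t]
  have hi1 : Integrable (fun x : ℝ => ((t * x : ℝ) : ℂ) * Complex.I) ν :=
    ((hν.integrable_id.const_mul t).ofReal).mul_const _
  have hi2 : Integrable (fun x : ℝ => ((t * x : ℝ) : ℂ) ^ 2 / 2) ν := by
    have : Integrable (fun x : ℝ => ((t ^ 2 / 2 * x ^ 2 : ℝ) : ℂ)) ν :=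
      (hν.integrable_sq.const_mul _).ofReal
    refine this.congr (Filter.Eventually.of_forall fun x => ?_)
    push_cast; ring
  have hi0 : Integrable (fun x : ℝ => Complex.exp (((t * x : ℝ) : ℂ) * Complex.I)) ν := by
    refine Integrable.of_bound (C := 1) (by fun_prop) (Filter.Eventually.of_forall fun x => ?_)
    exact (Complex.norm_exp_ofReal_mul_I _).le
  have hi3 : Integrable (fun x : ℝ => 1 + ((t * x : ℝ) : ℂ) * Complex.I) ν :=
    (integrable_const _).add hi1
  have hi4 : Integrable
      (fun x : ℝ => 1 + ((t * x : ℝ) : ℂ) * Complex.I - ((t * x : ℝ) : ℂ) ^ 2 / 2) ν := hi3.sub hi2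
  have hE : ∫ x : ℝ, (1 + ((t * x : ℝ) : ℂ) * Complex.I - ((t * x : ℝ) : ℂ) ^ 2 / 2) ∂ν
      = ((1 - t ^ 2 * v / 2 : ℝ) : ℂ) := by
    rw [integral_sub hi3 hi2, integral_add (integrable_const _) hi1]
    have e1 : ∫ x : ℝ, ((t * x : ℝ) : ℂ) * Complex.I ∂ν = 0 := by
      rw [integral_mul_const, integral_complex_ofReal, integral_const_mul, hν.centered]; simp
    have e2 : ∫ x : ℝ, ((t * x : ℝ) : ℂ) ^ 2 / 2 ∂ν = ((t ^ 2 * v / 2 : ℝ) : ℂ) := by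
      have : (fun x : ℝ => ((t * x : ℝ) : ℂ) ^ 2 / 2) = fun x : ℝ => ((t ^ 2 / 2 * x ^ 2 : ℝ) : ℂ) := by
        funext x; push_cast; ring
      rw [this, integral_complex_ofReal, integral_const_mul, ← hv]; push_cast; ring
    rw [e1, e2]; simp
  have hdiff : ‖charFun ν t - ((1 - t ^ 2 * v / 2 : ℝ) : ℂ)‖ ≤ 4 * |t| ^ 3 * (p * s) := by
    rw [charFun_apply_real, ← hE]
    have : ∀ x : ℝ, Complex.exp ((t : ℂ) * x * Complex.I)
        = Complex.exp (((t * x : ℝ) : ℂ) * Complex.I) := fun x => by push_cast; rfl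
    simp_rw [this]
    rw [← integral_sub hi0 hi4]
    refine (norm_integral_le_integral_norm _).trans ?_
    calc _ ≤ ∫ x, 4 * |t| ^ 3 * |x| ^ 3 ∂ν := by
          refine integral_mono ?_ (hν.integrable_cube.const_mul _) fun x => ?_
          · exact (hi0.sub hi4).norm
          · refine (norm_exp_I_sub_taylor_le (t * x)).trans_eq ?_
            rw [abs_mul]; ring
      _ = 4 * |t| ^ 3 * ∫ x, |x| ^ 3 ∂ν := integral_const_mul _ _
      _ ≤ _ := by gcongr; exact hν.cube_le
  have hmain : ‖charFun ν t‖ ≤ |1 - t ^ 2 * v / 2| + 4 * |t| ^ 3 * (p * s) := by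
    calc ‖charFun ν t‖ = ‖(charFun ν t - ((1 - t ^ 2 * v / 2 : ℝ) : ℂ))
          + ((1 - t ^ 2 * v / 2 : ℝ) : ℂ)‖ := by rw [sub_add_cancel]
      _ ≤ _ := by
        refine (norm_add_le _ _).trans ?_
        rw [Complex.norm_real, Real.norm_eq_abs]; linarith
  have hv1 := hν.le_sq
  have hv2 := hν.sq_le
  have hsq : t ^ 2 = |t| ^ 2 := (sq_abs t).symm
  have hvs : t ^ 2 * v ≤ 1 := by
    have : t ^ 2 * v ≤ |t| ^ 2 * (1 * s) := by
      rw [hsq]; gcongr; exact hv2.trans (by gcongr; exact hν.p_le_one)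
    nlinarith [abs_nonneg t]
  rw [abs_of_nonneg (by linarith)] at hmain
  have h4 : 4 * |t| ^ 3 * (p * s) ≤ t ^ 2 * p / 4 := by
    rw [hsq]
    have : 0 ≤ |t| ^ 2 * p := by positivity
    nlinarith [mul_le_mul_of_nonneg_left hts this]
  have h5 : t ^ 2 * p ≤ t ^ 2 * v := by gcongr
  have := Real.add_one_le_exp (-(t ^ 2 * p / 4))
  linarith

/-- Decay of the characteristic function of a linear form in independent entries, in terms of
the small coefficients of the form. -/
lemma norm_integral_exp_dotProduct_le (hν : CenteredLaw s p ν) {J : Type*} [Fintype J] (y : J → ℝ)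
    {t h : ℝ} (hth : |t| * h ≤ 1 / (16 * s)) :
    ‖∫ x : J → ℝ, Complex.exp (((t * (x ⬝ᵥ y) : ℝ) : ℂ) * Complex.I) ∂(Measure.pi fun _ => ν)‖
      ≤ Real.exp (-(t ^ 2 * p / 4 * ∑ j with |y j| ≤ h, y j ^ 2)) := by
  have := hν.isProb
  have e : ∀ x : J → ℝ, Complex.exp (((t * (x ⬝ᵥ y) : ℝ) : ℂ) * Complex.I)
      = ∏ j, Complex.exp (((t * y j : ℝ) : ℂ) * x j * Complex.I) := by
    intro x
    rw [← Complex.exp_sum]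
    congr 1
    simp only [dotProduct, Finset.mul_sum, Complex.ofReal_sum, Finset.sum_mul]
    refine Finset.sum_congr rfl fun j _ => ?_
    push_cast; ring
  simp_rw [e]
  rw [integral_fintype_prod_eq_prod
    (f := fun j (x : ℝ) => Complex.exp (((t * y j : ℝ) : ℂ) * x * Complex.I)), norm_prod]
  simp_rw [← charFun_apply_real]
  calc ∏ j, ‖charFun ν (t * y j)‖
      -- Only small coefficients keep `t * y j` in the range where decay is known; the other factors
      -- are bounded by one.
      ≤ ∏ j, (if |y j| ≤ h then Real.exp (-(t ^ 2 * p / 4 * y j ^ 2)) else 1) := by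
        refine Finset.prod_le_prod (fun _ _ => norm_nonneg _) fun j _ => ?_
        split_ifs with hj
        · refine (hν.norm_charFun_le ?_).trans_eq ?_
          · rw [abs_mul]
            exact (mul_le_mul_of_nonneg_left hj (abs_nonneg t)).trans hth
          · congr 1; ring
        · exact norm_charFun_le_one (μ := ν) _
    _ = _ := by
        rw [← Finset.prod_filter, ← Real.exp_sum]
        congr 1
        rw [Finset.mul_sum, Finset.sum_neg_distrib]

end CenteredLaw

/-! ### Gaussian smoothing -/

lemma charFun_stdGaussian_re (x : ℝ) :
    charFun (gaussianReal 0 1) x = ((Real.exp (-(x ^ 2 / 2)) : ℝ) : ℂ) := by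
  rw [charFun_gaussianReal]; push_cast; congr 1; simp

/-- Esseen's inequality in Gaussian form: the bump `exp (-x² / 2)` is itself the characteristic
function of a standard Gaussian `g`, so by Fubini its expectation at `w (S - u)` is an average over
`g` of the characteristic function of `S`; the shift `u` only contributes a phase. -/
lemma integral_exp_neg_sq_le {Ω : Type*} [MeasurableSpace Ω] (P : Measure Ω)
    [IsProbabilityMeasure P] {S : Ω → ℝ} (hS : Measurable S) (u w : ℝ) :
    ∫ ω, Real.exp (-((w * (S ω - u)) ^ 2 / 2)) ∂P
      ≤ ∫ g, ‖∫ ω, Complex.exp (((g * w * S ω : ℝ) : ℂ) * Complex.I) ∂P‖ ∂(gaussianReal 0 1) := by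
  have h1 : ((∫ ω, Real.exp (-((w * (S ω - u)) ^ 2 / 2)) ∂P : ℝ) : ℂ)
      = ∫ ω, ∫ g, Complex.exp (((w * (S ω - u) : ℝ) : ℂ) * g * Complex.I) ∂(gaussianReal 0 1) ∂P := by
    rw [← integral_complex_ofReal]
    congr 1; funext ω
    rw [← charFun_stdGaussian_re, charFun_apply_real]
  have hInt : Integrable (Function.uncurry fun (ω : Ω) (g : ℝ) =>
      Complex.exp (((w * (S ω - u) : ℝ) : ℂ) * g * Complex.I)) (P.prod (gaussianReal 0 1)) := by
    refine Integrable.of_bound (C := 1) (by fun_prop) (Filter.Eventually.of_forall fun z => ?_)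
    have : Function.uncurry (fun (ω : Ω) (g : ℝ) =>
      Complex.exp (((w * (S ω - u) : ℝ) : ℂ) * g * Complex.I)) z =
        Complex.exp (((w * (S z.1 - u) * z.2 : ℝ) : ℂ) * Complex.I) := by
      simp [Function.uncurry]
    rw [this, Complex.norm_exp_ofReal_mul_I]
  rw [integral_integral_swap hInt] at h1
  have h2 : ∫ ω, Real.exp (-((w * (S ω - u)) ^ 2 / 2)) ∂P
      ≤ ‖((∫ ω, Real.exp (-((w * (S ω - u)) ^ 2 / 2)) ∂P : ℝ) : ℂ)‖ := by
    rw [Complex.norm_real]; exact le_abs_self _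
  refine h2.trans ?_
  rw [h1]
  refine (norm_integral_le_integral_norm _).trans (le_of_eq ?_)
  congr 1; funext g
  have e : ∀ ω, Complex.exp (((w * (S ω - u) : ℝ) : ℂ) * g * Complex.I)
      = Complex.exp (((g * w * S ω : ℝ) : ℂ) * Complex.I)
        * Complex.exp (((-(g * w * u) : ℝ) : ℂ) * Complex.I) := by
    intro ω
    rw [← Complex.exp_add]; congr 1; push_cast; ring
  simp_rw [e]
  rw [integral_mul_const, norm_mul, Complex.norm_exp_ofReal_mul_I, mul_one]

/-- The constant `∫_{|g| ≤ 1} g² / 2` for a standard Gaussian `g`. -/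
noncomputable def gaussConst : ℝ := ∫ g in Set.Icc (-1 : ℝ) 1, g ^ 2 / 2 ∂(gaussianReal 0 1)

lemma gaussConst_pos : 0 < gaussConst := by
  unfold gaussConst
  rw [setIntegral_pos_iff_support_of_nonneg_ae]
  · have hsub : Set.Ioc (0 : ℝ) 1 ⊆ Function.support (fun g : ℝ => g ^ 2 / 2) ∩ Set.Icc (-1) 1 := by
      intro x hx
      refine ⟨?_, by linarith [hx.1], hx.2⟩
      have := hx.1
      simp [this.ne']
    refine lt_of_lt_of_le ?_ (measure_mono hsub)
    rw [pos_iff_ne_zero]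
    intro h0
    have := gaussianReal_absolutelyContinuous' 0 (one_ne_zero) h0
    simp at this
  · exact Filter.Eventually.of_forall fun x => by positivity
  · refine Integrable.of_bound (C := 1) (by fun_prop) ?_
    filter_upwards [ae_restrict_mem measurableSet_Icc] with x hx
    rw [Real.norm_eq_abs, abs_of_nonneg (by positivity)]
    nlinarith [hx.1, hx.2]

/-- The weak decay regime, meant for multiplication over many rows: even a small `a` gives a
definite gain below one. On `|g| ≤ 1` it uses `exp (-x) ≤ 1 / (1 + x) ≤ 1 - x / 2` for `x` in `[0,
1]`. -/
lemma integral_gaussian_le_one_sub {F : ℝ → ℝ} (hF : Measurable F) (hF0 : ∀ g, 0 ≤ F g)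
    (hF1 : ∀ g, F g ≤ 1) {a : ℝ} (ha : 0 ≤ a) (hFa : ∀ g, |g| ≤ 1 → F g ≤ Real.exp (-(a * g ^ 2))) :
    ∫ g, F g ∂(gaussianReal 0 1) ≤ 1 - gaussConst * min a 1 := by
  have hInt : Integrable F (gaussianReal 0 1) := by
    refine Integrable.of_bound (C := 1) hF.aestronglyMeasurable (Filter.Eventually.of_forall fun x => ?_)
    rw [Real.norm_eq_abs, abs_of_nonneg (hF0 x)]; exact hF1 x
  have hind : Integrable (Set.indicator (Set.Icc (-1 : ℝ) 1) fun g => g ^ 2 / 2 * min a 1)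
      (gaussianReal 0 1) := by
    refine Integrable.of_bound (C := 1 ) ?_ (Filter.Eventually.of_forall fun x => ?_)
    · exact (Measurable.indicator (by fun_prop) measurableSet_Icc).aestronglyMeasurable
    · by_cases hx : x ∈ Set.Icc (-1 : ℝ) 1
      · rw [Set.indicator_of_mem hx, Real.norm_eq_abs, abs_of_nonneg (by positivity)]
        have h1 : x ^ 2 / 2 ≤ 1 := by nlinarith [hx.1, hx.2]
        have h2 : min a 1 ≤ 1 := min_le_right _ _
        have h3 : 0 ≤ min a 1 := by positivity
        nlinarith
      · rw [Set.indicator_of_notMem hx]; simp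
  have e : gaussConst * min a 1
      = ∫ g, Set.indicator (Set.Icc (-1 : ℝ) 1) (fun g => g ^ 2 / 2 * min a 1) g
        ∂(gaussianReal 0 1) := by
    rw [integral_indicator measurableSet_Icc, integral_mul_const, gaussConst]
  calc ∫ g, F g ∂(gaussianReal 0 1)
      ≤ ∫ g, (1 - Set.indicator (Set.Icc (-1 : ℝ) 1) (fun g => g ^ 2 / 2 * min a 1) g)
        ∂(gaussianReal 0 1) := by
        refine integral_mono hInt ((integrable_const _).sub hind) fun g => ?_
        by_cases hg : g ∈ Set.Icc (-1 : ℝ) 1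
        · simp only [Set.indicator_of_mem hg]
          refine (hFa g (abs_le.2 hg)).trans ?_
          set b := min a 1 with hb
          have hb0 : 0 ≤ b := by positivity
          have hb1 : b ≤ 1 := min_le_right _ _
          have hg1 : g ^ 2 ≤ 1 := by nlinarith [hg.1, hg.2]
          have hx0 : 0 ≤ b * g ^ 2 := by positivity
          have hx1 : b * g ^ 2 ≤ 1 := by nlinarith
          calc Real.exp (-(a * g ^ 2)) ≤ Real.exp (-(b * g ^ 2)) := by
                apply Real.exp_le_exp.2
                have : b * g ^ 2 ≤ a * g ^ 2 := by gcongr; exact min_le_left _ _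
                linarith
            _ ≤ 1 / (1 + b * g ^ 2) := by
                rw [Real.exp_neg, ← one_div]
                apply one_div_le_one_div_of_le (by positivity)
                linarith [Real.add_one_le_exp (b * g ^ 2)]
            _ ≤ 1 - g ^ 2 / 2 * b := by
                rw [div_le_iff₀ (by positivity)]
                nlinarith
        · simp only [Set.indicator_of_notMem hg]; simpa using hF1 g
    _ = _ := by
        rw [integral_sub (integrable_const _) hind, ← e]; simp

/-- The strong decay regime, meant for a single linear form: the Gaussian density is at most one,
which leaves the integral of `exp (-a g²)`, and Chebyshev's inequality handles `|g| > G`. -/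
lemma integral_gaussian_le_add {F : ℝ → ℝ} (hF : Measurable F) (hF0 : ∀ g, 0 ≤ F g)
    (hF1 : ∀ g, F g ≤ 1) {a G : ℝ} (ha : 0 < a) (hG : 0 < G)
    (hFa : ∀ g, |g| ≤ G → F g ≤ Real.exp (-(a * g ^ 2))) :
    ∫ g, F g ∂(gaussianReal 0 1) ≤ √(Real.pi / a) + 1 / G ^ 2 := by
  have hInt : Integrable F (gaussianReal 0 1) := by
    refine Integrable.of_bound (C := 1) hF.aestronglyMeasurable (Filter.Eventually.of_forall fun x => ?_)
    rw [Real.norm_eq_abs, abs_of_nonneg (hF0 x)]; exact hF1 x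
  have hInt1 : Integrable (fun g => Real.exp (-(a * g ^ 2))) (gaussianReal 0 1) := by
    refine Integrable.of_bound (C := 1) (by fun_prop) (Filter.Eventually.of_forall fun x => ?_)
    rw [Real.norm_eq_abs, abs_of_nonneg (by positivity)]
    apply Real.exp_le_one_iff.2
    have : 0 ≤ a * x ^ 2 := by positivity
    linarith
  have hInt2 : Integrable (fun g : ℝ => g ^ 2 / G ^ 2) (gaussianReal 0 1) :=
    ((memLp_id_gaussianReal 2).integrable_sq).div_const _
  calc ∫ g, F g ∂(gaussianReal 0 1)
      ≤ ∫ g, (Real.exp (-(a * g ^ 2)) + g ^ 2 / G ^ 2) ∂(gaussianReal 0 1) := by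
        refine integral_mono hInt (hInt1.add hInt2) fun g => ?_
        rcases le_or_gt |g| G with h | h
        · have := hFa g h
          have h2 : 0 ≤ g ^ 2 / G ^ 2 := by positivity
          simp only; linarith
        · have h2 : 1 ≤ g ^ 2 / G ^ 2 := by
            rw [le_div_iff₀ (by positivity), one_mul, ← sq_abs g]
            gcongr
          have h3 := Real.exp_pos (-(a * g ^ 2))
          have := hF1 g
          simp only; linarith
    _ = ∫ g, Real.exp (-(a * g ^ 2)) ∂(gaussianReal 0 1)
        + ∫ g, g ^ 2 / G ^ 2 ∂(gaussianReal 0 1) := integral_add hInt1 hInt2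
    _ ≤ _ := by
        gcongr
        · rw [integral_gaussianReal_eq_integral_smul one_ne_zero]
          simp_rw [← neg_mul]
          rw [← integral_gaussian a]
          refine integral_mono_of_nonneg (Filter.Eventually.of_forall fun x => ?_)
            (integrable_exp_neg_mul_sq ha) (Filter.Eventually.of_forall fun x => ?_)
          · exact mul_nonneg (gaussianPDFReal_nonneg _ _ _) (Real.exp_pos _).le
          · simp only [smul_eq_mul]
            refine mul_le_of_le_one_left (Real.exp_pos _).le ?_
            rw [gaussianPDFReal_def]
            refine mul_le_one₀ ?_ (Real.exp_pos _).le ?_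
            · apply inv_le_one_of_one_le₀
              rw [Real.one_le_sqrt]
              have := Real.pi_gt_three
              simp; linarith
            · apply Real.exp_le_one_iff.2
              simp only [neg_div, Left.neg_nonpos_iff]
              positivity
        · rw [integral_div]
          have : ∫ g : ℝ, g ^ 2 ∂(gaussianReal 0 1) = 1 := by
            have := variance_fun_id_gaussianReal (μ := 0) (v := 1)
            rw [variance_eq_integral (by fun_prop)] at this
            simpa using this
          rw [this]

/-! ### Small ball estimates -/

/-- The law of a matrix with independent entries of law `ν`. -/
noncomputable def matLaw (ν : Measure ℝ) (ι J : Type*) [Fintype ι] [Fintype J] :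
    Measure (ι → J → ℝ) :=
  Measure.pi fun _ : ι => Measure.pi fun _ : J => ν

instance isProbabilityMeasure_matLaw (ν : Measure ℝ) [IsProbabilityMeasure ν] (ι J : Type*)
    [Fintype ι] [Fintype J] : IsProbabilityMeasure (matLaw ν ι J) := by
  unfold matLaw; infer_instance

/-- The product of the matrix with rows `B i` and the vector `z`. -/
def mv {ι J : Type*} [Fintype J] (B : ι → J → ℝ) (z : J → ℝ) : ι → ℝ := fun i => B i ⬝ᵥ z

/-- The part of the squared norm of `z` carried by the coordinates of size at most `h`. -/
noncomputable def flatMass {J : Type*} [Fintype J] (h : ℝ) (z : J → ℝ) : ℝ :=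
  ∑ j with |z j| ≤ h, z j ^ 2

section SmallBall

variable {s p : ℝ} {ν : Measure ℝ} {J : Type*} [Fintype J]

lemma measurable_norm_integral_exp {Ω : Type*} [MeasurableSpace Ω] (P : Measure Ω) [SFinite P]
    {S : Ω → ℝ} (hS : Measurable S) (w : ℝ) :
    Measurable fun g : ℝ => ‖∫ ω, Complex.exp (((g * w * S ω : ℝ) : ℂ) * Complex.I) ∂P‖ := by
  have : StronglyMeasurable (Function.uncurry fun (g : ℝ) (ω : Ω) =>
      Complex.exp (((g * w * S ω : ℝ) : ℂ) * Complex.I)) :=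
    Measurable.stronglyMeasurable (by fun_prop)
  exact this.integral_prod_right.norm.measurable

lemma norm_integral_exp_le_one {Ω : Type*} [MeasurableSpace Ω] (P : Measure Ω)
    [IsProbabilityMeasure P] (S : Ω → ℝ) :
    ‖∫ ω, Complex.exp ((S ω : ℂ) * Complex.I) ∂P‖ ≤ 1 := by
  refine (norm_integral_le_of_norm_le_const (C := 1)
    (Filter.Eventually.of_forall fun ω => (Complex.norm_exp_ofReal_mul_I _).le)).trans ?_
  simp

lemma measurable_dotProduct_right (y : J → ℝ) : Measurable fun x : J → ℝ => x ⬝ᵥ y := by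
  unfold dotProduct; fun_prop

lemma CenteredLaw.integral_exp_neg_row_le (hν : CenteredLaw s p ν) (y : J → ℝ) (u : ℝ)
    {w h : ℝ} (hw : 0 ≤ w) (h0 : 0 ≤ h) (hwh : w * h ≤ 1 / (16 * s)) :
    ∫ x : J → ℝ, Real.exp (-((w * (x ⬝ᵥ y - u)) ^ 2 / 2)) ∂(Measure.pi fun _ => ν)
      ≤ 1 - gaussConst * min (w ^ 2 * p / 4 * flatMass h y) 1 := by
  have := hν.isProb
  have hp := hν.p_pos
  refine (integral_exp_neg_sq_le _ (measurable_dotProduct_right y) u w).trans ?_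
  refine integral_gaussian_le_one_sub
    (measurable_norm_integral_exp _ (measurable_dotProduct_right y) w) (fun _ => norm_nonneg _)
    (fun g => norm_integral_exp_le_one _ _) ?_ fun g hg => ?_
  · have : 0 ≤ flatMass h y := Finset.sum_nonneg fun _ _ => sq_nonneg _
    positivity
  · refine (hν.norm_integral_exp_dotProduct_le y (t := g * w) (h := h) ?_).trans_eq ?_
    · rw [abs_mul, abs_of_nonneg hw]
      calc |g| * w * h ≤ 1 * w * h := by gcongr
        _ ≤ _ := by rw [one_mul]; exact hwh
    · unfold flatMass; congr 1; ring

/-- Markov's inequality for the Gaussian bump at scale `t`; the factor two comes from `exp (-1 / 2)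
≥ 1 / 2`. The second term is the price of knowing decay only for `|g| ≤ t / (16 s h)`. -/
lemma CenteredLaw.measureReal_abs_dotProduct_sub_le (hν : CenteredLaw s p ν) (y : J → ℝ) (u : ℝ)
    {t h ρ : ℝ} (ht : 0 < t) (h0 : 0 < h) (hρ : 0 < ρ) (hflat : ρ ^ 2 ≤ flatMass h y) :
    (Measure.pi fun _ : J => ν).real {x | |x ⬝ᵥ y - u| ≤ t}
      ≤ 2 * (√(4 * Real.pi * t ^ 2 / (p * ρ ^ 2)) + (16 * s * h / t) ^ 2) := by
  have := hν.isProb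
  have hp := hν.p_pos
  have hs := hν.one_le
  set P := Measure.pi fun _ : J => ν
  have hm := measurable_dotProduct_right y
  have hInt : Integrable (fun x : J → ℝ => Real.exp (-((t⁻¹ * (x ⬝ᵥ y - u)) ^ 2 / 2))) P := by
    refine Integrable.of_bound (C := 1) (by fun_prop) (Filter.Eventually.of_forall fun x => ?_)
    rw [Real.norm_eq_abs, abs_of_nonneg (by positivity)]
    apply Real.exp_le_one_iff.2
    simp only [Left.neg_nonpos_iff]; positivity
  have h1 := mul_meas_ge_le_integral_of_nonneg
    (Filter.Eventually.of_forall fun x => (Real.exp_pos _).le) hInt (Real.exp (-(1 / 2)))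
  have hsub : {x : J → ℝ | |x ⬝ᵥ y - u| ≤ t} ⊆
      {x | Real.exp (-(1 / 2)) ≤ Real.exp (-((t⁻¹ * (x ⬝ᵥ y - u)) ^ 2 / 2))} := by
    intro x hx
    apply Real.exp_le_exp.2
    have hx' : |t⁻¹ * (x ⬝ᵥ y - u)| ≤ 1 := by
      rw [abs_mul, abs_of_pos (by positivity), inv_mul_le_iff₀ ht]; simpa using hx
    have : (t⁻¹ * (x ⬝ᵥ y - u)) ^ 2 ≤ 1 := (sq_le_one_iff_abs_le_one _).2 hx'
    linarith
  have h2 : ∫ x : J → ℝ, Real.exp (-((t⁻¹ * (x ⬝ᵥ y - u)) ^ 2 / 2)) ∂P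
      ≤ √(4 * Real.pi * t ^ 2 / (p * ρ ^ 2)) + (16 * s * h / t) ^ 2 := by
    refine (integral_exp_neg_sq_le _ hm u t⁻¹).trans ?_
    refine (integral_gaussian_le_add (a := p * ρ ^ 2 / (4 * t ^ 2)) (G := t / (16 * s * h))
      (measurable_norm_integral_exp _ hm t⁻¹) (fun _ => norm_nonneg _)
      (fun g => norm_integral_exp_le_one _ _) (by positivity) (by positivity) fun g hg => ?_).trans_eq
        ?_
    · refine (hν.norm_integral_exp_dotProduct_le y (t := g * t⁻¹) (h := h) ?_).trans ?_
      · rw [abs_mul, abs_of_pos (inv_pos.2 ht)]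
        calc |g| * t⁻¹ * h ≤ t / (16 * s * h) * t⁻¹ * h := by gcongr
          _ = _ := by field_simp
      · apply Real.exp_le_exp.2
        have : p * ρ ^ 2 / (4 * t ^ 2) * g ^ 2 ≤ (g * t⁻¹) ^ 2 * p / 4 * flatMass h y := by
          calc _ = (g * t⁻¹) ^ 2 * p / 4 * ρ ^ 2 := by field_simp
            _ ≤ _ := by gcongr
        unfold flatMass at this
        linarith
    · congr 1
      · congr 1; field_simp
      · field_simp
  have h3 : P.real {x | |x ⬝ᵥ y - u| ≤ t} ≤
      P.real {x | Real.exp (-(1 / 2)) ≤ Real.exp (-((t⁻¹ * (x ⬝ᵥ y - u)) ^ 2 / 2))} :=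
    measureReal_mono hsub
  have h4 : 1 / 2 ≤ Real.exp (-(1 / 2)) := by
    have := Real.add_one_le_exp (-(1 / 2 : ℝ)); linarith
  have h5 : 1 / 2 * P.real {x | |x ⬝ᵥ y - u| ≤ t} ≤ Real.exp (-(1 / 2)) *
      P.real {x | Real.exp (-(1 / 2)) ≤ Real.exp (-((t⁻¹ * (x ⬝ᵥ y - u)) ^ 2 / 2))} := by
    gcongr
  linarith

variable {ι : Type*} [Fintype ι]

/-- For a fixed vector with enough mass on small coordinates, the image under a random matrix is
unlikely to be short. -/
lemma CenteredLaw.measureReal_l2_mv_le (hν : CenteredLaw s p ν) (W : ι → J → ℝ) (z : J → ℝ)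
    {h ρ : ℝ} (h0 : 0 < h) (hρ : 0 < ρ) (hflat : ρ ^ 2 ≤ flatMass h z) :
    (matLaw ν ι J).real
        {X | l2 (mv (X + W) z) ^ 2 ≤ gaussConst * Fintype.card ι * p * ρ ^ 2 / 4}
      ≤ Real.exp (-(Fintype.card ι * gaussConst / 2
          * min (p * ρ ^ 2 / (1024 * s ^ 2 * h ^ 2)) 1)) := by
  have := hν.isProb
  have hp := hν.p_pos
  have hs := hν.one_le
  have hc := gaussConst_pos
  set c := gaussConst
  set N : ℝ := (Fintype.card ι : ℝ)
  have hN : 0 ≤ N := Nat.cast_nonneg _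
  set r : ℝ := min (p * ρ ^ 2 / (1024 * s ^ 2 * h ^ 2)) 1 with hr
  have hr0 : 0 < r := by positivity
  -- `w` is chosen so that `w² p ρ² / 4 = r`
  set w : ℝ := √(4 * r / (p * ρ ^ 2)) with hw
  have hw2 : w ^ 2 = 4 * r / (p * ρ ^ 2) := Real.sq_sqrt (by positivity)
  have hw0 : 0 ≤ w := Real.sqrt_nonneg _
  have hwh : w * h ≤ 1 / (16 * s) := by
    refine abs_le_of_sq_le_sq' ?_ (by positivity) |>.2
    rw [mul_pow, hw2]
    calc 4 * r / (p * ρ ^ 2) * h ^ 2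
        ≤ 4 * (p * ρ ^ 2 / (1024 * s ^ 2 * h ^ 2)) / (p * ρ ^ 2) * h ^ 2 := by
          gcongr; exact min_le_left _ _
      _ = (1 / (16 * s)) ^ 2 := by field_simp; norm_num
  set E : (ι → J → ℝ) → ℝ := fun X => ∏ i, Real.exp (-((w * (X i ⬝ᵥ z - (-(W i ⬝ᵥ z)))) ^ 2 / 2))
  have hE : ∀ X, E X = Real.exp (-(w ^ 2 / 2 * l2 (mv (X + W) z) ^ 2)) := by
    intro X
    simp only [E]
    rw [← Real.exp_sum, l2_sq, Finset.mul_sum, ← Finset.sum_neg_distrib]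
    congr 1
    refine Finset.sum_congr rfl fun i _ => ?_
    simp only [mv, Pi.add_apply, add_dotProduct]; ring
  have hInt : Integrable E (matLaw ν ι J) := by
    refine Integrable.of_bound (C := 1) ?_ (Filter.Eventually.of_forall fun X => ?_)
    · refine (Finset.measurable_prod _ fun i _ => ?_).aestronglyMeasurable
      have : Measurable fun X : ι → J → ℝ => X i ⬝ᵥ z :=
        (measurable_dotProduct_right z).comp (measurable_pi_apply i)
      fun_prop
    · rw [hE, Real.norm_eq_abs, abs_of_nonneg (by positivity)]
      apply Real.exp_le_one_iff.2
      simp only [Left.neg_nonpos_iff]; positivity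
  have hEint : ∫ X, E X ∂(matLaw ν ι J) ≤ Real.exp (-(N * (c * r))) := by
    unfold matLaw
    simp only [E]
    rw [integral_fintype_prod_eq_prod
      (f := fun i (x : J → ℝ) => Real.exp (-((w * (x ⬝ᵥ z - (-(W i ⬝ᵥ z)))) ^ 2 / 2)))]
    calc _ ≤ ∏ _i : ι, Real.exp (-(c * r)) := by
          refine Finset.prod_le_prod (fun i _ => integral_nonneg fun x => (Real.exp_pos _).le)
            fun i _ => ?_
          refine (hν.integral_exp_neg_row_le z _ hw0 h0.le hwh).trans ?_
          have : r ≤ min (w ^ 2 * p / 4 * flatMass h z) 1 := by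
            refine le_min ?_ (min_le_right _ _)
            calc r = w ^ 2 * p / 4 * ρ ^ 2 := by rw [hw2]; field_simp
              _ ≤ _ := by gcongr
          have h1 : c * r ≤ c * min (w ^ 2 * p / 4 * flatMass h z) 1 := by gcongr
          linarith [Real.add_one_le_exp (-(c * r))]
      _ = _ := by
          rw [Finset.prod_const, ← Real.exp_nat_mul, Finset.card_univ]
          congr 1; simp only [N]; ring
  -- Markov's inequality at the level `exp (-N c r / 2)` gives up half of the exponent.
  have h1 := mul_meas_ge_le_integral_of_nonneg
    (Filter.Eventually.of_forall fun X => by rw [hE]; exact (Real.exp_pos _).le) hInt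
      (Real.exp (-(N * (c * r) / 2)))
  have hsub : {X : ι → J → ℝ | l2 (mv (X + W) z) ^ 2 ≤ c * N * p * ρ ^ 2 / 4} ⊆
      {X | Real.exp (-(N * (c * r) / 2)) ≤ E X} := by
    intro X hX
    simp only [Set.mem_ofPred_eq] at hX ⊢
    rw [hE]
    apply Real.exp_le_exp.2
    have : w ^ 2 / 2 * l2 (mv (X + W) z) ^ 2 ≤ w ^ 2 / 2 * (c * N * p * ρ ^ 2 / 4) := by gcongr
    have e : w ^ 2 / 2 * (c * N * p * ρ ^ 2 / 4) = N * (c * r) / 2 := by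
      rw [hw2]; field_simp
    linarith
  have h2 : (matLaw ν ι J).real
      {X : ι → J → ℝ | l2 (mv (X + W) z) ^ 2 ≤ c * N * p * ρ ^ 2 / 4} ≤
      (matLaw ν ι J).real {X | Real.exp (-(N * (c * r) / 2)) ≤ E X} := measureReal_mono hsub
  refine h2.trans ?_
  have h3 := h1.trans hEint
  rw [← le_div_iff₀' (Real.exp_pos _), ← Real.exp_sub] at h3
  refine h3.trans_eq ?_
  congr 1; ring

end SmallBall

/-! ### Compressible vectors -/

section Compressible

variable {ι J : Type*} [Fintype ι] [Fintype J]

lemma mv_sub {ι J : Type*} [Fintype J] (B : ι → J → ℝ) (x y : J → ℝ) :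
    mv B (x - y) = mv B x - mv B y := by
  funext i; simp [mv, dotProduct_sub]

lemma mv_smul {ι J : Type*} [Fintype J] (B : ι → J → ℝ) (c : ℝ) (x : J → ℝ) :
    mv B (c • x) = c • mv B x := by
  funext i; simp [mv, dotProduct_smul]

lemma mv_add_left {ι J : Type*} [Fintype J] (B C : ι → J → ℝ) (x : J → ℝ) :
    mv (B + C) x = mv B x + mv C x := by
  funext i; simp [mv, add_dotProduct]

/-- `K` bounds the operator norm of `B`. -/
def OpBound (B : ι → J → ℝ) (K : ℝ) : Prop := ∀ x, l2 (mv B x) ≤ K * l2 x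

/-- Chebyshev's inequality for counting measure; it converts a threshold `1 / √m` into a sparsity
`m`. -/
lemma card_filter_lt_abs_le {x : J → ℝ} (hx : l2 x = 1) {h m : ℝ} (hm : 0 < m)
    (hh : h ^ 2 = 1 / m) (h0 : 0 ≤ h) : ((Finset.univ.filter fun j => h < |x j|).card : ℝ) ≤ m := by
  have h1 : ((Finset.univ.filter fun j => h < |x j|).card : ℝ) * (1 / m) ≤ 1 := by
    calc ((Finset.univ.filter fun j => h < |x j|).card : ℝ) * (1 / m)
        = ∑ j with h < |x j|, 1 / m := by rw [Finset.sum_const, nsmul_eq_mul]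
      _ ≤ ∑ j with h < |x j|, x j ^ 2 := by
          refine Finset.sum_le_sum fun j hj => ?_
          have hj : h < |x j| := (Finset.mem_filter.1 hj).2
          rw [← hh, ← sq_abs (x j)]
          gcongr
      _ ≤ ∑ j, x j ^ 2 := Finset.sum_le_sum_of_subset_of_nonneg (Finset.filter_subset _ _)
          fun _ _ _ => sq_nonneg _
      _ = 1 := by rw [← l2_sq, hx, one_pow]
  rw [mul_one_div, div_le_one hm] at h1
  exact h1

/-- Doubling the threshold makes flat mass stable under approximation: if `|x j| ≤ h` but `|z j| > 2
h`, then `|x j| ≤ |x j - z j|`, so the lost coordinate is paid for by the distance. -/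
lemma sqrt_flatMass_le_add {x z : J → ℝ} {h : ℝ} :
    √(flatMass h x) ≤ √(flatMass (2 * h) z) + l2 (x - z) := by
  let y : J → ℝ := fun j => if |z j| ≤ 2 * h then |z j| else 0
  let d : J → ℝ := fun j => |x j - z j|
  let a : J → ℝ := fun j => if |x j| ≤ h then x j else 0
  have ha : √(flatMass h x) = l2 a := by
    rw [l2_eq_sqrt, flatMass, Finset.sum_filter]
    congr 1
    refine Finset.sum_congr rfl fun j _ => ?_
    simp only [a]; split_ifs <;> simp
  have hy : √(flatMass (2 * h) z) = l2 y := by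
    rw [l2_eq_sqrt, flatMass, Finset.sum_filter]
    congr 1
    refine Finset.sum_congr rfl fun j _ => ?_
    simp only [y]; split_ifs <;> simp
  have hd : l2 (x - z) = l2 d := by
    rw [l2_eq_sqrt, l2_eq_sqrt]
    simp [d]
  rw [ha, hy, hd]
  refine (l2_mono fun j => ?_).trans (l2_add_le y d)
  apply sq_le_sq.2
  have h1 : |x j| ≤ |z j| + |x j - z j| := by
    calc |x j| = |z j + (x j - z j)| := by congr 1; ring
      _ ≤ _ := abs_add_le _ _
  have h3 : |z j| ≤ |x j| + |x j - z j| := by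
    calc |z j| = |x j - (x j - z j)| := by congr 1; ring
      _ ≤ _ := abs_sub _ _
  have h2 : 0 ≤ (y + d) j := by simp only [y, d, Pi.add_apply]; positivity
  rw [abs_of_nonneg h2]
  simp only [a, y, d, Pi.add_apply]
  split_ifs with p1 p2 p2
  · exact h1
  · rw [zero_add]; linarith
  · rw [abs_zero]; positivity
  · rw [abs_zero]; positivity

lemma l2_sub_restrict_sq (x : J → ℝ) (h : ℝ) :
    l2 (x - fun j => if h < |x j| then x j else 0) ^ 2 = flatMass h x := by
  rw [l2_sq, flatMass, Finset.sum_filter]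
  refine Finset.sum_congr rfl fun j _ => ?_
  simp only [Pi.sub_apply]
  split_ifs with h1 h2 h2 <;> first | (exfalso; linarith) | simp

/-- The event that some unit vector with squared mass at least `ρ ^ 2` on the coordinates of size at
most `h`, but less than `ρ' ^ 2` on those of size at most `h'`, has an image of norm at most `τ`,
while the operator norm is at most `K`. -/
def shortEvent (W : ι → J → ℝ) (K h ρ h' ρ' τ : ℝ) : Set (ι → J → ℝ) :=
  {X | OpBound (X + W) K ∧ ∃ x, l2 x = 1 ∧ ρ ^ 2 ≤ flatMass h x ∧ flatMass h' x < ρ' ^ 2 ∧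
    l2 (mv (X + W) x) ≤ τ}

/-- Discarding the coordinates below `h'` moves `x` by at most `ρ'` and leaves at most `m` of them,
so a net of sparse vectors comes within `2 ρ'` of `x`. The net point keeps flat mass `(ρ / 2)²` at
threshold `2 h`, and the operator norm bound keeps its image short; a union bound over such net
points finishes. -/
lemma CenteredLaw.measureReal_shortEvent_le [DecidableEq J] {s p : ℝ} {ν : Measure ℝ}
    (hν : CenteredLaw s p ν) (W : ι → J → ℝ) {K h ρ h' ρ' τ m t : ℝ} (hK : 0 ≤ K) (h0 : 0 < h)
    (hρ : 0 < ρ) (hρ1 : ρ ≤ 1) (hρ' : 0 < ρ') (hρρ' : ρ' ≤ ρ / 4) (hm : 0 < m) (h'0 : 0 ≤ h')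
    (hh' : h' ^ 2 = 1 / m) (ht : 0 < t) (ht1 : t ≤ 1)
    (hτ : (τ + 2 * K * ρ') ^ 2 ≤ gaussConst * Fintype.card ι * p * (ρ / 2) ^ 2 / 4) :
    (matLaw ν ι J).real (shortEvent W K h ρ h' ρ' τ) ≤
      Real.exp (t * Fintype.card J + m * Real.log (1 / t) + m * Real.log (3 / ρ')
        - Fintype.card ι * gaussConst / 2
          * min (p * (ρ / 2) ^ 2 / (1024 * s ^ 2 * (2 * h) ^ 2)) 1) := by
  classical
  have := hν.isProb
  obtain ⟨S, hScard, hS1, hS⟩ := exists_net_sparse J (m := m) hρ' (by linarith) ht ht1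
  set A : (J → ℝ) → Set (ι → J → ℝ) := fun z =>
    {X | l2 (mv (X + W) z) ^ 2 ≤ gaussConst * Fintype.card ι * p * (ρ / 2) ^ 2 / 4} with hA
  have hsub : shortEvent W K h ρ h' ρ' τ ⊆
      ⋃ z ∈ S.filter (fun z => (ρ / 2) ^ 2 ≤ flatMass (2 * h) z), A z := by
    rintro X ⟨hop, x, hx, hxρ, hxρ', hxτ⟩
    set xL : J → ℝ := fun j => if h' < |x j| then x j else 0 with hxL
    obtain ⟨z, hzS, hz⟩ := hS xL (Finset.univ.filter fun j => h' < |x j|) (by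
        rw [← hx]
        refine l2_mono fun j => ?_
        simp only [hxL]; split_ifs
        · exact le_rfl
        · simpa using sq_nonneg (x j)) (card_filter_lt_abs_le hx hm hh' h'0) (by
        intro j hj
        simp only [Finset.mem_filter, Finset.mem_univ, true_and] at hj
        simp [hxL, hj])
    have hxxL : l2 (x - xL) ≤ ρ' := by
      have := l2_sub_restrict_sq x h'
      refine (abs_le_of_sq_le_sq' (a := l2 (x - xL)) ?_ hρ'.le).2
      rw [this]; exact hxρ'.le
    have hxz : l2 (x - z) ≤ 2 * ρ' := by
      calc l2 (x - z) = l2 ((x - xL) + (xL - z)) := by congr 1; abel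
        _ ≤ _ := l2_add_le _ _
        _ ≤ _ := by linarith
    have hflat : (ρ / 2) ^ 2 ≤ flatMass (2 * h) z := by
      have h1 := sqrt_flatMass_le_add (x := x) (z := z) (h := h)
      have h2 : ρ ≤ √(flatMass h x) := Real.le_sqrt_of_sq_le hxρ
      have h3 : ρ / 2 ≤ √(flatMass (2 * h) z) := by linarith
      exact (Real.le_sqrt' (by positivity)).1 h3
    refine Set.mem_iUnion₂.2 ⟨z, Finset.mem_filter.2 ⟨hzS, hflat⟩, ?_⟩
    refine le_trans ?_ hτ
    have : l2 (mv (X + W) z) ≤ τ + 2 * K * ρ' := by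
      calc l2 (mv (X + W) z) = l2 (mv (X + W) x - mv (X + W) (x - z)) := by
            rw [← mv_sub]; congr 2; abel
        _ ≤ l2 (mv (X + W) x) + l2 (mv (X + W) (x - z)) := l2_sub_le _ _
        _ ≤ τ + K * (2 * ρ') := by
            refine add_le_add hxτ ((hop _).trans (by gcongr))
        _ = _ := by ring
    exact pow_le_pow_left₀ (l2_nonneg _) this 2
  calc (matLaw ν ι J).real (shortEvent W K h ρ h' ρ' τ)
      ≤ (matLaw ν ι J).real
        (⋃ z ∈ S.filter (fun z => (ρ / 2) ^ 2 ≤ flatMass (2 * h) z), A z) :=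
        measureReal_mono hsub (measure_ne_top _ _)
    _ ≤ ∑ z ∈ S.filter (fun z => (ρ / 2) ^ 2 ≤ flatMass (2 * h) z), (matLaw ν ι J).real (A z) :=
        measureReal_biUnion_finset_le _ _
    _ ≤ ∑ z ∈ S.filter (fun z => (ρ / 2) ^ 2 ≤ flatMass (2 * h) z),
        Real.exp (-(Fintype.card ι * gaussConst / 2
          * min (p * (ρ / 2) ^ 2 / (1024 * s ^ 2 * (2 * h) ^ 2)) 1)) := by
        refine Finset.sum_le_sum fun z hz => ?_
        exact hν.measureReal_l2_mv_le W z (by positivity) (by positivity) (Finset.mem_filter.1 hz).2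
    _ ≤ (S.card : ℝ) * Real.exp (-(Fintype.card ι * gaussConst / 2
          * min (p * (ρ / 2) ^ 2 / (1024 * s ^ 2 * (2 * h) ^ 2)) 1)) := by
        rw [Finset.sum_const, nsmul_eq_mul]
        gcongr
        exact Finset.filter_subset _ _
    _ ≤ _ := by
        rw [sub_eq_add_neg, Real.exp_add]
        gcongr

end Compressible

/-! ### The chain of compressibility levels -/

/-- The event that some unit vector with squared mass less than `ρ ^ 2` on the coordinates of size
at most `h` has an image of norm at most `τ`, while the operator norm is at most `K`. -/
def compEvent {ι J : Type*} [Fintype ι] [Fintype J] (W : ι → J → ℝ) (K h ρ τ : ℝ) :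
    Set (ι → J → ℝ) :=
  {X | OpBound (X + W) K ∧ ∃ x, l2 x = 1 ∧ flatMass h x < ρ ^ 2 ∧ l2 (mv (X + W) x) ≤ τ}

/-- With high probability, unit vectors which have small mass on the coordinates of size at most
`h n` have images of norm comparable to `√(n p)`. -/
def CompBound (α κ s K : ℝ) (h : ℕ → ℝ) : Prop :=
  ∃ ρ, 0 < ρ ∧ ρ ≤ 1 ∧ ∃ c, 0 < c ∧ ∀ η > 0, ∀ᶠ n : ℕ in Filter.atTop,
    ∀ p : ℝ, κ * (n : ℝ) ^ (-α) ≤ p → ∀ ν : Measure ℝ, CenteredLaw s p ν → ∀ N : ℕ, n ≤ 2 * N →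
      ∀ W : Fin N → Fin n → ℝ, (matLaw ν (Fin N) (Fin n)).real
        (compEvent W (K * √(n * p)) (h n) ρ (c * √(n * p))) ≤ η

section Chain

variable {α κ s K : ℝ}

/-- Start of the chain: coordinates of a unit vector never exceed one, so at threshold one all the
mass is flat and the event is empty. -/
lemma compBound_one : CompBound α κ s K fun _ => 1 := by
  refine ⟨1, one_pos, le_rfl, 1, one_pos, fun η hη => Filter.Eventually.of_forall ?_⟩
  intro n p _ ν _ N _ W
  have : compEvent W (K * √(n * p)) 1 1 (1 * √(n * p)) = ∅ := by
    rw [Set.eq_empty_iff_forall_notMem]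
    rintro X ⟨-, x, hx, hlt, -⟩
    have : flatMass 1 x = 1 := by
      rw [flatMass, Finset.filter_true_of_mem, ← l2_sq, hx, one_pow]
      intro j _
      rw [← hx]; exact abs_apply_le_l2 x j
    rw [this] at hlt; norm_num at hlt
  rw [this]; simpa using hη.le

/-- A vector with little flat mass at the new threshold `1 / √m` either had little at the old one,
or lies in `shortEvent`. The hypothesis on `m` and `t` says that the entropy of `m`-sparse vectors
is beaten by the small ball exponent available at the old threshold, with `n / 2` rows. -/
lemma compBound_step (hK : 0 < K) {h : ℕ → ℝ} (hh : ∀ᶠ n in Filter.atTop, 0 < h n)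
    (hC : CompBound α κ s K h) :
    ∃ ρ ρ' : ℝ, 0 < ρ ∧ 0 < ρ' ∧ ρ' ≤ 1 ∧ ∀ m t : ℕ → ℝ,
      (∀ᶠ n in Filter.atTop, 0 < m n ∧ 0 < t n ∧ t n ≤ 1) →
      (∀ A : ℝ, ∀ᶠ n : ℕ in Filter.atTop, ∀ p : ℝ, κ * (n : ℝ) ^ (-α) ≤ p → 0 < p →
        t n * n + m n * Real.log (1 / t n) + m n * Real.log (3 / ρ')
        - n / 2 * gaussConst / 2 * min (p * (ρ / 2) ^ 2 / (1024 * s ^ 2 * (2 * h n) ^ 2)) 1 ≤ -A) →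
      CompBound α κ s K fun n => 1 / √(m n) := by
  obtain ⟨ρ, hρ, hρ1, c, hc, H⟩ := hC
  have hg := gaussConst_pos
  -- `a² n p` is the bound `gaussConst * N * p * (ρ / 2)² / 4` of the small ball estimate at `N = n
  -- / 2`. Half of `a` is spent on the net error `2 K ρ'`, the other half is the new lower bound.
  set a : ℝ := √(gaussConst / 32) * ρ with ha
  have ha0 : 0 < a := by positivity
  have ha2 : a ^ 2 = gaussConst / 32 * ρ ^ 2 := by rw [ha, mul_pow, Real.sq_sqrt (by positivity)]
  set ρ' : ℝ := min (ρ / 4) (a / (4 * K)) with hρ'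
  have hρ'0 : 0 < ρ' := by positivity
  have hρ'1 : ρ' ≤ ρ / 4 := min_le_left _ _
  have hρ'2 : 2 * K * ρ' ≤ a / 2 := by
    calc 2 * K * ρ' ≤ 2 * K * (a / (4 * K)) := by gcongr; exact min_le_right _ _
      _ = a / 2 := by field_simp; norm_num
  refine ⟨ρ, ρ', hρ, hρ'0, by linarith, fun m t hmt hexp => ?_⟩
  refine ⟨ρ', hρ'0, by linarith, min c (a / 2), by positivity, fun η hη => ?_⟩
  filter_upwards [hh, hmt, H (η / 2) (by positivity), hexp (-Real.log (η / 2))]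
    with n hn0 hmtn hHn hexpn p hp ν hν N hN W
  obtain ⟨hm, ht, ht1⟩ := hmtn
  have hp0 := hν.p_pos
  have := hν.isProb
  have hNn : (n : ℝ) / 2 ≤ N := by
    rw [div_le_iff₀ (by norm_num)]; exact_mod_cast (by omega : n ≤ N * 2)
  have hsub : compEvent W (K * √(n * p)) (1 / √(m n)) ρ' (min c (a / 2) * √(n * p)) ⊆
      compEvent W (K * √(n * p)) (h n) ρ (c * √(n * p)) ∪
      shortEvent W (K * √(n * p)) (h n) ρ (1 / √(m n)) ρ' (a / 2 * √(n * p)) := by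
    rintro X ⟨hop, x, hx, hfl, hl⟩
    rcases lt_or_ge (flatMass (h n) x) (ρ ^ 2) with h1 | h1
    · refine Or.inl ⟨hop, x, hx, h1, hl.trans ?_⟩
      gcongr; exact min_le_left _ _
    · refine Or.inr ⟨hop, x, hx, h1, hfl, hl.trans ?_⟩
      gcongr; exact min_le_right _ _
  refine (measureReal_mono hsub (measure_ne_top _ _)).trans ((measureReal_union_le _ _).trans ?_)
  have h1 := hHn p hp ν hν N hN W
  have h2 : (matLaw ν (Fin N) (Fin n)).real
      (shortEvent W (K * √(n * p)) (h n) ρ (1 / √(m n)) ρ' (a / 2 * √(n * p))) ≤ η / 2 := by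
    refine (hν.measureReal_shortEvent_le W (m := m n) (t := t n) (by positivity) hn0 hρ hρ1 hρ'0
      hρ'1 hm (by positivity) ?_ ht ht1 ?_).trans ?_
    · rw [div_pow, Real.sq_sqrt hm.le, one_pow]
    · rw [Fintype.card_fin]
      calc (a / 2 * √(n * p) + 2 * (K * √(n * p)) * ρ') ^ 2
          = ((a / 2 + 2 * K * ρ') * √(n * p)) ^ 2 := by ring
        _ ≤ (a * √(n * p)) ^ 2 := by gcongr; linarith
        _ = gaussConst * (n / 2) * p * (ρ / 2) ^ 2 / 4 := by
            rw [mul_pow, ha2, Real.sq_sqrt (by positivity)]; ring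
        _ ≤ _ := by gcongr
    · rw [Fintype.card_fin, Fintype.card_fin, ← Real.exp_log (show 0 < η / 2 by positivity)]
      apply Real.exp_le_exp.2
      have := hexpn p hp hp0
      have h3 : (n : ℝ) / 2 * gaussConst / 2
            * min (p * (ρ / 2) ^ 2 / (1024 * s ^ 2 * (2 * h n) ^ 2)) 1 ≤
          N * gaussConst / 2 * min (p * (ρ / 2) ^ 2 / (1024 * s ^ 2 * (2 * h n) ^ 2)) 1 := by
        gcongr
      linarith
  linarith

lemma div_mul_inv_sqrt_sq {a b x : ℝ} (hx : 0 < x) :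
    a / (b * (2 * (1 / √x)) ^ 2) = a / (b * 4) * x := by
  have : (2 * (1 / √x)) ^ 2 = 4 / x := by
    rw [mul_pow, one_div, inv_pow, Real.sq_sqrt hx.le]; ring
  rw [this]; field_simp

lemma eventually_rpow_mul_log_le {γ β C c A : ℝ} (hγ : 0 ≤ γ) (hβ : 0 < β) (hc : 0 < c) :
    ∀ᶠ n : ℕ in Filter.atTop,
      (n : ℝ) ^ γ * (C + Real.log n) - c * (n : ℝ) ^ (γ + β) ≤ -A := by
  have h1 : ∀ᶠ x : ℝ in Filter.atTop, ‖Real.log x‖ ≤ c / 2 * ‖x ^ β‖ :=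
    (isLittleO_log_rpow_atTop hβ).bound (by positivity)
  have h2 : ∀ᶠ x : ℝ in Filter.atTop, (|C| + |A|) * (2 / c) ≤ x ^ β :=
    (tendsto_rpow_atTop hβ).eventually_ge_atTop _
  filter_upwards [tendsto_natCast_atTop_atTop.eventually h1, tendsto_natCast_atTop_atTop.eventually h2,
    Filter.eventually_ge_atTop 1] with n hn1 hn2 hn
  have hn1' : (1 : ℝ) ≤ n := by exact_mod_cast hn
  have hpos : 0 < (n : ℝ) ^ β := by positivity
  rw [Real.norm_eq_abs, Real.norm_eq_abs, abs_of_pos hpos] at hn1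
  rw [Real.rpow_add (by positivity)]
  have h3 : (|C| + |A|) ≤ c / 2 * (n : ℝ) ^ β := by
    have := mul_le_mul_of_nonneg_left hn2 (show 0 ≤ c / 2 by positivity)
    calc |C| + |A| = c / 2 * ((|C| + |A|) * (2 / c)) := by field_simp
      _ ≤ _ := this
  have h4 : C + Real.log n - c * (n : ℝ) ^ β ≤ -|A| := by
    linarith [le_abs_self C, le_abs_self (Real.log n)]
  have h5 : 1 ≤ (n : ℝ) ^ γ := Real.one_le_rpow hn1' hγ
  calc (n : ℝ) ^ γ * (C + Real.log n) - c * ((n : ℝ) ^ γ * (n : ℝ) ^ β)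
      = (n : ℝ) ^ γ * (C + Real.log n - c * (n : ℝ) ^ β) := by ring
    _ ≤ (n : ℝ) ^ γ * (-|A|) := by gcongr
    _ ≤ 1 * (-|A|) := by
        apply mul_le_mul_of_nonpos_right h5
        simp
    _ ≤ -A := by linarith [le_abs_self A]

/-- One step raises the sparsity from `n ^ (k β)` to `n ^ ((k + 1) β)`, whose entropy is that power
times `log n`. The exponent available is of order `n * min (n ^ (k β - α)) 1`, which exceeds the
entropy by a factor `n ^ β` up to the logarithm, because `α + 2 β ≤ 1` and, at the step, `(k + 2) β
≤ 1`. -/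
lemma compBound_pow (hκ : 0 < κ) (hs : 1 ≤ s) (hK : 0 < K) {β : ℝ} (hβ : 0 < β)
    (hαβ : α + 2 * β ≤ 1) (k : ℕ) (hk : (k + 1) * β ≤ 1) :
    CompBound α κ s K fun n => 1 / √((n : ℝ) ^ (k * β)) := by
  induction k with
  | zero => simpa using compBound_one
  | succ k ih =>
    push_cast at hk
    have hpos : ∀ᶠ n : ℕ in Filter.atTop, 0 < 1 / √((n : ℝ) ^ (k * β)) := by
      filter_upwards [Filter.eventually_gt_atTop 0] with n hn
      have : (0 : ℝ) < n := by exact_mod_cast hn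
      positivity
    obtain ⟨ρ, ρ', hρ, hρ'0, hρ'1, H⟩ := compBound_step hK hpos (ih (by nlinarith))
    have hg := gaussConst_pos
    have hkβ : (0 : ℝ) ≤ k * β := by positivity
    set c0 : ℝ := κ * (ρ / 2) ^ 2 / (1024 * s ^ 2 * 4) with hc0
    have hc0p : 0 < c0 := by positivity
    push_cast
    -- The choice `t = m / n` makes `t * n = m`, so the entropy is at most `m` times a constant plus
    -- `log n`.
    refine H (fun n => (n : ℝ) ^ ((k + 1) * β)) (fun n => (n : ℝ) ^ ((k + 1) * β - 1)) ?_ fun A => ?_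
    · filter_upwards [Filter.eventually_gt_atTop 0] with n hn
      have hn0 : (0 : ℝ) < n := by exact_mod_cast hn
      refine ⟨by positivity, by positivity, ?_⟩
      exact Real.rpow_le_one_of_one_le_of_nonpos (by exact_mod_cast hn) (by linarith)
    · filter_upwards [eventually_rpow_mul_log_le (γ := (k + 1) * β) (β := β)
        (C := 1 + Real.log (3 / ρ')) (c := gaussConst / 4 * min c0 1) (A := A) (by positivity) hβ
        (by positivity), Filter.eventually_gt_atTop 0] with n hn hn1 p hp hp0
      have hn0 : (0 : ℝ) < n := by exact_mod_cast hn1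
      have hn1' : (1 : ℝ) ≤ n := by exact_mod_cast hn1
      set m : ℝ := (n : ℝ) ^ ((k + 1) * β) with hm
      have hm1 : 1 ≤ m := Real.one_le_rpow hn1' (by positivity)
      have e1 : (n : ℝ) ^ ((k + 1) * β - 1) * n = m := by
        rw [Real.rpow_sub_one hn0.ne']; field_simp; rfl
      have e2 : m * Real.log (1 / (n : ℝ) ^ ((k + 1) * β - 1)) ≤ m * Real.log n := by
        have : 1 / (n : ℝ) ^ ((k + 1) * β - 1) = (n : ℝ) ^ (1 - (k + 1) * β) := by
          rw [one_div, ← Real.rpow_neg hn0.le]; congr 1; ring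
        rw [this, Real.log_rpow hn0]
        have h0 : 0 ≤ Real.log n := Real.log_nonneg hn1'
        have h1 : (1 - (k + 1) * β) * Real.log n ≤ Real.log n := by
          have : 0 ≤ (k + 1) * β * Real.log n := by positivity
          linarith
        gcongr
      have e3 : gaussConst / 4 * min c0 1 * (n : ℝ) ^ ((k + 1) * β + β) ≤
          n / 2 * gaussConst / 2 *
            min (p * (ρ / 2) ^ 2 / (1024 * s ^ 2 * (2 * (1 / √((n : ℝ) ^ (k * β)))) ^ 2)) 1 := by
        have e4 : p * (ρ / 2) ^ 2 / (1024 * s ^ 2 * (2 * (1 / √((n : ℝ) ^ (k * β)))) ^ 2)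
            = p * (ρ / 2) ^ 2 / (1024 * s ^ 2 * 4) * (n : ℝ) ^ (k * β) := by
          exact div_mul_inv_sqrt_sq (by positivity)
        rw [e4]
        have e5 : c0 * (n : ℝ) ^ (k * β - α) ≤
            p * (ρ / 2) ^ 2 / (1024 * s ^ 2 * 4) * (n : ℝ) ^ (k * β) := by
          calc c0 * (n : ℝ) ^ (k * β - α)
              = (κ * (n : ℝ) ^ (-α)) * (ρ / 2) ^ 2 / (1024 * s ^ 2 * 4) * (n : ℝ) ^ (k * β) := by
                rw [sub_eq_add_neg, Real.rpow_add hn0, hc0]; ring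
            _ ≤ _ := by gcongr
        have e6 : min c0 1 * (n : ℝ) ^ ((k + 1) * β + β - 1) ≤
            min (p * (ρ / 2) ^ 2 / (1024 * s ^ 2 * 4) * (n : ℝ) ^ (k * β)) 1 := by
          refine le_min (le_trans ?_ e5) ?_
          · refine mul_le_mul (min_le_left _ _) ?_ (by positivity) hc0p.le
            exact Real.rpow_le_rpow_of_exponent_le hn1' (by linarith)
          · calc min c0 1 * (n : ℝ) ^ ((k + 1) * β + β - 1) ≤ 1 * 1 := by
                  gcongr
                  · exact min_le_right _ _
                  · exact Real.rpow_le_one_of_one_le_of_nonpos hn1' (by linarith)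
              _ = 1 := one_mul 1
        calc gaussConst / 4 * min c0 1 * (n : ℝ) ^ ((k + 1) * β + β)
            = n / 2 * gaussConst / 2 * (min c0 1 * (n : ℝ) ^ ((k + 1) * β + β - 1)) := by
              rw [Real.rpow_sub_one hn0.ne']; field_simp; norm_num
          _ ≤ _ := by gcongr
      rw [e1]
      nlinarith

/-- Unit vectors which are not spread over a constant proportion of the coordinates have images of
norm comparable to `√(n p)`, with high probability. -/
lemma exists_compBound_linear (hα₀ : 0 < α) (hα₁ : α < 1) (hκ : 0 < κ) (hs : 1 ≤ s) (hK : 0 < K) :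
    ∃ θ, 0 < θ ∧ θ ≤ 1 ∧ CompBound α κ s K fun n => 1 / √(θ * n) := by
  -- After `L = ⌈α / β⌉` steps `p * n ^ (L β)` is bounded below, so the exponent becomes linear in
  -- `n`; since `L β < α + β` and `α + 2 β = 1`, the chain still satisfies `(L + 1) β ≤ 1`.
  set β : ℝ := (1 - α) / 2 with hβ
  have hβ0 : 0 < β := by simp only [hβ]; linarith
  set L : ℕ := ⌈α / β⌉₊ with hL
  have hL1 : α ≤ L * β := by
    have := Nat.le_ceil (α / β)
    rwa [div_le_iff₀ hβ0] at this
  have hL2 : (L + 1) * β ≤ 1 := by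
    have := Nat.ceil_lt_add_one (show 0 ≤ α / β by positivity)
    have h2 : (L : ℝ) * β < (α / β + 1) * β := by gcongr
    have h3 : (α / β + 1) * β = α + β := by field_simp
    nlinarith
  have hpos : ∀ᶠ n : ℕ in Filter.atTop, 0 < 1 / √((n : ℝ) ^ (L * β)) := by
    filter_upwards [Filter.eventually_gt_atTop 0] with n hn
    have : (0 : ℝ) < n := by exact_mod_cast hn
    positivity
  obtain ⟨ρ, ρ', hρ, hρ'0, hρ'1, H⟩ := compBound_step hK hpos
    (compBound_pow (α := α) hκ hs hK hβ0 (by simp only [hβ]; linarith) L hL2)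
  have hg := gaussConst_pos
  set c0 : ℝ := κ * (ρ / 2) ^ 2 / (1024 * s ^ 2 * 4) with hc0
  have hc0p : 0 < c0 := by positivity
  set c1 : ℝ := gaussConst / 4 * min c0 1 with hc1
  have hc1p : 0 < c1 := by positivity
  -- choice of `θ`
  obtain ⟨θ, hθ0, hθ1, hθ⟩ : ∃ θ : ℝ, 0 < θ ∧ θ ≤ 1 ∧
      θ + θ * Real.log (1 / θ) + θ * Real.log (3 / ρ') ≤ c1 / 2 := by
    -- The entropy per coordinate of `θ n`-sparse vectors tends to zero with `θ`, hence eventually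
    -- falls below half of the linear rate `c1`.
    have hcont : Filter.Tendsto (fun θ : ℝ => θ - θ * Real.log θ + θ * Real.log (3 / ρ'))
        (nhdsWithin 0 (Set.Ioi 0)) (nhds 0) := by
      have h1 : Continuous fun θ : ℝ => θ - θ * Real.log θ + θ * Real.log (3 / ρ') :=
        (continuous_id.sub Real.continuous_mul_log).add (continuous_id.mul continuous_const)
      have := h1.tendsto 0
      simp only [zero_mul, sub_zero, add_zero] at this
      exact this.mono_left nhdsWithin_le_nhds
    have h2 := hcont.eventually (gt_mem_nhds (show 0 < c1 / 2 by positivity))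
    have h3 : ∀ᶠ θ : ℝ in nhdsWithin 0 (Set.Ioi 0), θ ∈ Set.Ioo (0 : ℝ) 1 :=
      Ioo_mem_nhdsGT one_pos
    obtain ⟨θ, h4, h5⟩ := (h2.and h3).exists
    refine ⟨θ, h5.1, h5.2.le, ?_⟩
    rw [one_div, Real.log_inv]; linarith
  refine ⟨θ, hθ0, hθ1, H (fun n => θ * n) (fun _ => θ) ?_ fun A => ?_⟩
  · filter_upwards [Filter.eventually_gt_atTop 0] with n hn
    have hn0 : (0 : ℝ) < n := by exact_mod_cast hn
    exact ⟨by positivity, hθ0, hθ1⟩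
  · filter_upwards [(tendsto_natCast_atTop_atTop (R := ℝ)).eventually_ge_atTop (2 * A / c1),
      Filter.eventually_gt_atTop 0] with n hn hn1 p hp hp0
    have hn0 : (0 : ℝ) < n := by exact_mod_cast hn1
    have hn1' : (1 : ℝ) ≤ n := by exact_mod_cast hn1
    have e4 : p * (ρ / 2) ^ 2 / (1024 * s ^ 2 * (2 * (1 / √((n : ℝ) ^ (L * β)))) ^ 2)
        = p * (ρ / 2) ^ 2 / (1024 * s ^ 2 * 4) * (n : ℝ) ^ (L * β) := by
      exact div_mul_inv_sqrt_sq (by positivity)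
    have e5 : c0 ≤ p * (ρ / 2) ^ 2 / (1024 * s ^ 2 * 4) * (n : ℝ) ^ (L * β) := by
      calc c0 = c0 * 1 := (mul_one _).symm
        _ ≤ c0 * (n : ℝ) ^ (L * β - α) := by
            gcongr; exact Real.one_le_rpow hn1' (by linarith)
        _ = (κ * (n : ℝ) ^ (-α)) * (ρ / 2) ^ 2 / (1024 * s ^ 2 * 4) * (n : ℝ) ^ (L * β) := by
            rw [sub_eq_add_neg, Real.rpow_add hn0, hc0]; ring
        _ ≤ _ := by gcongr
    have e6 : (n : ℝ) * c1 ≤ n / 2 * gaussConst / 2 *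
        min (p * (ρ / 2) ^ 2 / (1024 * s ^ 2 * (2 * (1 / √((n : ℝ) ^ (L * β)))) ^ 2)) 1 := by
      rw [e4]
      calc (n : ℝ) * c1 = n / 2 * gaussConst / 2 * min c0 1 := by rw [hc1]; ring
        _ ≤ _ := by gcongr
    have e7 : θ * n + θ * n * Real.log (1 / θ) + θ * n * Real.log (3 / ρ') ≤ n * (c1 / 2) := by
      calc _ = (n : ℝ) * (θ + θ * Real.log (1 / θ) + θ * Real.log (3 / ρ')) := by ring
        _ ≤ _ := by gcongr
    rw [div_le_iff₀ hc1p] at hn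
    linarith

end Chain

/-! ### Incompressible vectors -/

section Incompressible

/-- The linear combination of the vectors `C k` with coefficients `x k`. -/
def comb {ι J : Type*} [Fintype ι] (C : ι → J → ℝ) (x : ι → ℝ) : J → ℝ :=
  fun j => ∑ k, x k * C k j

lemma comb_dotProduct {ι J : Type*} [Fintype ι] [Fintype J] (C : ι → J → ℝ) (x : ι → ℝ)
    (v : J → ℝ) : comb C x ⬝ᵥ v = ∑ k, x k * (C k ⬝ᵥ v) := by
  simp only [comb, dotProduct, Finset.sum_mul, Finset.mul_sum]
  rw [Finset.sum_comm]
  refine Finset.sum_congr rfl fun k _ => Finset.sum_congr rfl fun j _ => by ring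

lemma isClosed_setOf_opBound {ι J : Type*} [Fintype ι] [Fintype J] (W : ι → J → ℝ) (K : ℝ) :
    IsClosed {C : ι → J → ℝ | OpBound (C + W) K} := by
  have : {C : ι → J → ℝ | OpBound (C + W) K} = ⋂ x : J → ℝ, {C | l2 (mv (C + W) x) ≤ K * l2 x} := by
    ext C; simp [OpBound]
  rw [this]
  refine isClosed_iInter fun x => ?_
  have hc : Continuous fun C : ι → J → ℝ => mv (C + W) x := by
    refine continuous_pi fun i => ?_
    simp only [mv, dotProduct, Pi.add_apply]
    fun_prop
  exact isClosed_le (continuous_l2.comp hc) continuous_const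

/-- The event that some unit vector with a large `k`-th coefficient gives a short combination. -/
def colEvent {ι J : Type*} [Fintype ι] [Fintype J] (W : ι → J → ℝ) (K a t : ℝ) (k : ι) :
    Set (ι → J → ℝ) :=
  {C | OpBound (C + W) K ∧ ∃ x, l2 x = 1 ∧ a ≤ |x k| ∧ l2 (comb (C + W) x) ≤ t}

/-- Needed for measurability: the event is an intersection with the projection of a closed set along
the compact set of admissible unit vectors. -/
lemma isClosed_colEvent {ι J : Type*} [Fintype ι] [Fintype J] (W : ι → J → ℝ) (K a t : ℝ) (k : ι) :
    IsClosed (colEvent W K a t k) := by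
  have e : colEvent W K a t k = {C : ι → J → ℝ | OpBound (C + W) K} ∩
      {C | ∃ x, l2 x = 1 ∧ a ≤ |x k| ∧ l2 (comb (C + W) x) ≤ t} := rfl
  rw [e]
  refine (isClosed_setOf_opBound W K).inter ?_
  have hcomp : IsCompact {x : ι → ℝ | l2 x = 1 ∧ a ≤ |x k|} := by
    refine Metric.isCompact_of_isClosed_isBounded ?_ ?_
    · exact (isClosed_eq continuous_l2 continuous_const).inter
        (isClosed_le continuous_const (continuous_apply k).abs)
    · refine (Metric.isBounded_closedBall (x := (0 : ι → ℝ)) (r := 1)).subset ?_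
      rintro x ⟨hx, -⟩
      rw [mem_closedBall_zero_iff, pi_norm_le_iff_of_nonneg zero_le_one]
      intro i
      rw [← hx]; exact abs_apply_le_l2 x i
  have : CompactSpace {x : ι → ℝ | l2 x = 1 ∧ a ≤ |x k|} := isCompact_iff_compactSpace.1 hcomp
  have hcl : IsClosed {z : (ι → J → ℝ) × {x : ι → ℝ | l2 x = 1 ∧ a ≤ |x k|} |
      l2 (comb (z.1 + W) z.2) ≤ t} := by
    have hc : Continuous fun z : (ι → J → ℝ) × {x : ι → ℝ | l2 x = 1 ∧ a ≤ |x k|} =>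
        comb (z.1 + W) z.2 := by
      refine continuous_pi fun j => ?_
      simp only [comb, Pi.add_apply]
      exact continuous_finsetSum _ fun i _ => ((continuous_apply i).comp
        (continuous_subtype_val.comp continuous_snd)).mul (by fun_prop)
    exact isClosed_le (continuous_l2.comp hc) continuous_const
  convert isClosedMap_fst_of_compactSpace _ hcl using 1
  ext C
  constructor
  · rintro ⟨x, h1, h2, h3⟩
    exact ⟨(C, ⟨x, h1, h2⟩), h3, rfl⟩
  · rintro ⟨⟨C', x, h1, h2⟩, h3, rfl⟩
    exact ⟨x, h1, h2, h3⟩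

/-- Supplies the unit normal to the span of all vectors but one. -/
lemma exists_unit_mv_eq_zero {n : ℕ} (B : Fin n → Fin (n + 1) → ℝ) :
    ∃ v, l2 v = 1 ∧ mv B v = 0 := by
  have hlin : ∃ f : (Fin (n + 1) → ℝ) →ₗ[ℝ] (Fin n → ℝ), ∀ v, f v = mv B v :=
    ⟨Matrix.mulVecLin (Matrix.of B), fun v => rfl⟩
  obtain ⟨f, hf⟩ := hlin
  have hker : LinearMap.ker f ≠ ⊥ := LinearMap.ker_ne_bot_of_finrank_lt (by simp)
  obtain ⟨v, hv, hv0⟩ := Submodule.exists_mem_ne_zero_of_ne_bot hker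
  have hl : 0 < l2 v := lt_of_le_of_ne (l2_nonneg v) fun h => hv0 (l2_eq_zero.1 h.symm)
  refine ⟨(l2 v)⁻¹ • v, ?_, ?_⟩
  · rw [l2_smul, abs_of_pos (inv_pos.2 hl), inv_mul_cancel₀ hl.ne']
  · rw [mv_smul, ← hf, LinearMap.mem_ker.1 hv, smul_zero]

lemma OpBound.succAbove {n : ℕ} {J : Type*} [Fintype J] {B : Fin (n + 1) → J → ℝ} {K : ℝ}
    (h : OpBound B K) (k : Fin (n + 1)) : OpBound (fun j => B (k.succAbove j)) K := by
  intro x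
  refine le_trans ?_ (h x)
  refine l2_le_of_sq_le (l2_nonneg _) ?_
  rw [l2_sq, Fin.sum_univ_succAbove _ k]
  have : 0 ≤ mv B x k ^ 2 := sq_nonneg _
  simp only [mv] at this ⊢
  linarith

/-- Fix all vectors but the `k`-th and let `v` be a unit normal to them. Pairing a short combination
with `v` leaves only `x k` times the product of the `k`-th vector with `v`, so that product is at
most `t / a`. Outside `compEvent` of the remaining vectors `v` has flat mass, and it does not depend
on the `k`-th vector, so the one-dimensional small ball bound applies conditionally. -/
lemma CenteredLaw.measureReal_colEvent_le {s p : ℝ} {ν : Measure ℝ} (hν : CenteredLaw s p ν) {n : ℕ}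
    (W : Fin (n + 1) → Fin (n + 1) → ℝ) {K a t h ρ τ : ℝ} (ha : 0 < a) (ht : 0 < t) (h0 : 0 < h)
    (hρ : 0 < ρ) (hτ : 0 ≤ τ) (k : Fin (n + 1)) :
    (matLaw ν (Fin (n + 1)) (Fin (n + 1))).real (colEvent W K a t k) ≤
      (matLaw ν (Fin n) (Fin (n + 1))).real (compEvent (fun j => W (k.succAbove j)) K h ρ τ) +
      2 * (√(4 * Real.pi * (t / a) ^ 2 / (p * ρ ^ 2)) + (16 * s * h / (t / a)) ^ 2) := by
  have := hν.isProb
  set b : ℝ := 2 * (√(4 * Real.pi * (t / a) ^ 2 / (p * ρ ^ 2)) + (16 * s * h / (t / a)) ^ 2)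
  have hb : 0 ≤ b := by positivity
  set G := compEvent (fun j => W (k.succAbove j)) K h ρ τ
  set R := Measure.pi fun _ : Fin (n + 1) => ν
  set e := MeasurableEquiv.piFinSuccAbove (fun _ : Fin (n + 1) => Fin (n + 1) → ℝ) k
  have hmp : MeasurePreserving e (matLaw ν (Fin (n + 1)) (Fin (n + 1)))
      (R.prod (matLaw ν (Fin n) (Fin (n + 1)))) :=
    measurePreserving_piFinSuccAbove (fun _ : Fin (n + 1) => R) k
  have hmeas : MeasurableSet (colEvent W K a t k) := (isClosed_colEvent W K a t k).measurableSet
  have hslice : ∀ y ∉ G, R {c | e.symm (c, y) ∈ colEvent W K a t k} ≤ ENNReal.ofReal b := by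
    intro y hy
    by_cases hop : OpBound (y + fun j => W (k.succAbove j)) K
    · obtain ⟨v, hv1, hv0⟩ := exists_unit_mv_eq_zero (y + fun j => W (k.succAbove j))
      have hflat : ρ ^ 2 ≤ flatMass h v := by
        by_contra! hcon
        exact hy ⟨hop, v, hv1, hcon, by rw [hv0, l2_zero]; exact hτ⟩
      have hsub : {c | e.symm (c, y) ∈ colEvent W K a t k} ⊆
          {c | |c ⬝ᵥ v - (-(W k ⬝ᵥ v))| ≤ t / a} := by
        rintro c ⟨-, x, hx1, hxa, hxt⟩
        have hk : e.symm (c, y) k = c := by simp [e]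
        have hj : ∀ j, e.symm (c, y) (k.succAbove j) = y j := by simp [e]
        have h1 := comb_dotProduct (e.symm (c, y) + W) x v
        rw [Fin.sum_univ_succAbove _ k] at h1
        have h2 : ∀ j, (e.symm (c, y) + W) (k.succAbove j) ⬝ᵥ v = 0 := by
          intro j
          have := congrFun hv0 j
          simpa only [mv, Pi.add_apply, hj, Pi.zero_apply] using this
        simp only [h2, mul_zero, Finset.sum_const_zero, add_zero] at h1
        rw [Pi.add_apply, hk, add_dotProduct] at h1
        have h3 := abs_dotProduct_le (comb (e.symm (c, y) + W) x) v
        rw [h1, hv1, mul_one, abs_mul] at h3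
        simp only [Set.mem_ofPred_eq, sub_neg_eq_add]
        rw [le_div_iff₀ ha]
        calc |c ⬝ᵥ v + W k ⬝ᵥ v| * a ≤ |c ⬝ᵥ v + W k ⬝ᵥ v| * |x k| := by gcongr
          _ ≤ t := by rw [mul_comm]; exact h3.trans hxt
      refine (measure_mono hsub).trans ?_
      have := hν.measureReal_abs_dotProduct_sub_le v (-(W k ⬝ᵥ v)) (div_pos ht ha) h0 hρ hflat
      rw [ENNReal.le_ofReal_iff_toReal_le (measure_ne_top _ _) hb]
      exact this
    · have : {c | e.symm (c, y) ∈ colEvent W K a t k} = ∅ := by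
        rw [Set.eq_empty_iff_forall_notMem]
        rintro c ⟨h1, -⟩
        apply hop
        have h2 := h1.succAbove k
        have hj : ∀ j, e.symm (c, y) (k.succAbove j) = y j := by simp [e]
        have h3 : (fun j => (e.symm (c, y) + W) (k.succAbove j))
            = y + fun j => W (k.succAbove j) := by
          funext j; simp only [Pi.add_apply, hj]
        rwa [h3] at h2
      rw [this, measure_empty]; exact zero_le
  have hkey : matLaw ν (Fin (n + 1)) (Fin (n + 1)) (colEvent W K a t k) ≤
      matLaw ν (Fin n) (Fin (n + 1)) G + ENNReal.ofReal b := by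
    have h1 : matLaw ν (Fin (n + 1)) (Fin (n + 1)) (colEvent W K a t k) =
        (R.prod (matLaw ν (Fin n) (Fin (n + 1)))) (e.symm ⁻¹' colEvent W K a t k) := by
      rw [← hmp.measure_preimage (e.symm.measurable hmeas).nullMeasurableSet]
      congr 1
      ext C; simp
    rw [h1, Measure.prod_apply_symm (e.symm.measurable hmeas)]
    -- `compEvent` is not shown to be measurable; its measurable hull has the same measure and
    -- serves in the integral.
    set G' := toMeasurable (matLaw ν (Fin n) (Fin (n + 1))) G
    calc ∫⁻ y, R ((fun c => (c, y)) ⁻¹' (e.symm ⁻¹' colEvent W K a t k))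
          ∂(matLaw ν (Fin n) (Fin (n + 1)))
        ≤ ∫⁻ y, (G'.indicator 1 y + ENNReal.ofReal b) ∂(matLaw ν (Fin n) (Fin (n + 1))) := by
          refine lintegral_mono fun y => ?_
          by_cases hy : y ∈ G'
          · rw [Set.indicator_of_mem hy]
            exact (prob_le_one).trans (by simp)
          · have : y ∉ G := fun h => hy (subset_toMeasurable _ _ h)
            exact (hslice y this).trans (by simp)
      _ = matLaw ν (Fin n) (Fin (n + 1)) G + ENNReal.ofReal b := by
          rw [lintegral_add_right _ measurable_const,
            lintegral_indicator_one (measurableSet_toMeasurable _ _), measure_toMeasurable]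
          simp
  have := ENNReal.toReal_mono (by simp [measure_ne_top]) hkey
  rwa [ENNReal.toReal_add (measure_ne_top _ _) ENNReal.ofReal_ne_top, ENNReal.toReal_ofReal hb]
    at this

/-- The event that some unit vector with squared mass at least `ρ ^ 2` on the coordinates of size
at most `h` gives a combination of norm at most `t`, while the operator norm is at most `K`. -/
def incompEvent {ι J : Type*} [Fintype ι] [Fintype J] (W : ι → J → ℝ) (K h ρ t : ℝ) :
    Set (ι → J → ℝ) :=
  {C | OpBound (C + W) K ∧ ∃ x, l2 x = 1 ∧ ρ ^ 2 ≤ flatMass h x ∧ l2 (comb (C + W) x) ≤ t}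

/-- Coordinates below `ρ / √(2n)` carry at most `ρ² / 2` of the flat mass; the rest is carried by
coordinates contributing at most `1 / (θ n)` each, so there are many of them. -/
lemma le_card_filter_le_abs {n : ℕ} (hn : 0 < n) {x : Fin n → ℝ} {θ ρ : ℝ} (hθ : 0 < θ)
    (hx : ρ ^ 2 ≤ flatMass (1 / √(θ * n)) x) :
    ρ ^ 2 * θ * n / 2 ≤ ((Finset.univ.filter fun k => ρ / √(2 * n) ≤ |x k|).card : ℝ) := by
  have hn0 : (0 : ℝ) < n := by exact_mod_cast hn
  set F := Finset.univ.filter fun k => ρ / √(2 * n) ≤ |x k|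
  have h1 : flatMass (1 / √(θ * n)) x ≤ F.card * (1 / (θ * n)) + n * (ρ ^ 2 / (2 * n)) := by
    calc flatMass (1 / √(θ * n)) x
        ≤ ∑ k, ((if ρ / √(2 * n) ≤ |x k| then 1 / (θ * n) else 0) + ρ ^ 2 / (2 * n)) := by
          rw [flatMass, Finset.sum_filter]
          refine Finset.sum_le_sum fun k _ => ?_
          have e1 : (1 / √(θ * n)) ^ 2 = 1 / (θ * n) := by
            rw [div_pow, one_pow, Real.sq_sqrt (by positivity)]
          have e2 : (ρ / √(2 * n)) ^ 2 = ρ ^ 2 / (2 * n) := by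
            rw [div_pow, Real.sq_sqrt (by positivity)]
          split_ifs with h1 h2 h2
          · have : x k ^ 2 ≤ (1 / √(θ * n)) ^ 2 := by rw [← sq_abs]; gcongr
            rw [e1] at this
            have : 0 ≤ ρ ^ 2 / (2 * n) := by positivity
            linarith
          · have : x k ^ 2 ≤ (ρ / √(2 * n)) ^ 2 := by
              rw [← sq_abs]; push Not at h2; gcongr
            rw [e2] at this; linarith
          · positivity
          · positivity
      _ = _ := by
          rw [Finset.sum_add_distrib, ← Finset.sum_filter, Finset.sum_const, Finset.sum_const,
            Finset.card_univ, Fintype.card_fin, nsmul_eq_mul, nsmul_eq_mul]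
  have h2 : (n : ℝ) * (ρ ^ 2 / (2 * n)) = ρ ^ 2 / 2 := by field_simp
  rw [h2] at h1
  have h3 : ρ ^ 2 / 2 ≤ F.card * (1 / (θ * n)) := by linarith
  rw [mul_one_div, le_div_iff₀ (by positivity)] at h3
  linarith

/-- Markov's inequality for the number of events `E k` that occur. -/
lemma mul_measureReal_le_sum {Ω : Type*} [MeasurableSpace Ω] (P : Measure Ω) [IsProbabilityMeasure P]
    {ι : Type*} [Fintype ι] {E : ι → Set Ω} (hE : ∀ k, MeasurableSet (E k)) {S : Set Ω} {r : ℝ}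
    (hS : ∀ ω ∈ S, r ≤ ∑ k, (E k).indicator 1 ω) :
    r * P.real S ≤ ∑ k, P.real (E k) := by
  rcases le_or_gt r 0 with hr | hr
  · exact (mul_nonpos_of_nonpos_of_nonneg hr measureReal_nonneg).trans
      (Finset.sum_nonneg fun _ _ => measureReal_nonneg)
  have hInt : ∀ k, Integrable ((E k).indicator (1 : Ω → ℝ)) P := fun k =>
    (integrable_const (1 : ℝ)).indicator (hE k)
  have h1 := mul_meas_ge_le_integral_of_nonneg (μ := P) (f := fun ω => ∑ k, (E k).indicator 1 ω)
    (Filter.Eventually.of_forall fun ω => Finset.sum_nonneg fun k _ =>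
      Set.indicator_nonneg (fun _ _ => zero_le_one) _)
    (integrable_finsetSum _ fun k _ => hInt k) r
  rw [integral_finsetSum _ fun k _ => hInt k] at h1
  simp_rw [integral_indicator_one (hE _)] at h1
  refine le_trans ?_ h1
  gcongr ?_ * ?_
  exact measureReal_mono hS

/-- Every spread vector puts the outcome in `colEvent` for at least `ρ² θ n / 2` indices, so
averaging over `k` replaces the factor `n` of a union bound by `2 / (ρ² θ)`. -/
lemma CenteredLaw.measureReal_incompEvent_le {s p : ℝ} {ν : Measure ℝ} (hν : CenteredLaw s p ν)
    {n : ℕ} (hn : 0 < n) (W : Fin n → Fin n → ℝ) {K θ ρ t b : ℝ} (hθ : 0 < θ) (hρ : 0 < ρ)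
    (hb : ∀ k, (matLaw ν (Fin n) (Fin n)).real (colEvent W K (ρ / √(2 * n)) t k) ≤ b) :
    (matLaw ν (Fin n) (Fin n)).real (incompEvent W K (1 / √(θ * n)) ρ t) ≤
      2 / (ρ ^ 2 * θ) * b := by
  have := hν.isProb
  have hn0 : (0 : ℝ) < n := by exact_mod_cast hn
  have h1 := mul_measureReal_le_sum (matLaw ν (Fin n) (Fin n))
    (E := colEvent W K (ρ / √(2 * n)) t) (S := incompEvent W K (1 / √(θ * n)) ρ t)
    (r := ρ ^ 2 * θ * n / 2) (fun k => (isClosed_colEvent _ _ _ _ k).measurableSet) (by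
      rintro C ⟨hop, x, hx1, hxρ, hxt⟩
      refine (le_card_filter_le_abs hn hθ hxρ).trans ?_
      rw [Finset.card_filter]
      push_cast
      refine Finset.sum_le_sum fun k _ => ?_
      split_ifs with hk
      · rw [Set.indicator_of_mem]
        · simp
        · exact ⟨hop, x, hx1, hk, hxt⟩
      · exact Set.indicator_nonneg (fun _ _ => zero_le_one) _)
  have h2 : ∑ k : Fin n, (matLaw ν (Fin n) (Fin n)).real (colEvent W K (ρ / √(2 * n)) t k)
      ≤ n * b := by
    calc _ ≤ ∑ _k : Fin n, b := Finset.sum_le_sum fun k _ => hb k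
      _ = _ := by simp
  have h3 := h1.trans h2
  rw [div_mul_eq_mul_div, le_div_iff₀ (by positivity)]
  have h4 : ρ ^ 2 * θ * (matLaw ν (Fin n) (Fin n)).real (incompEvent W K (1 / √(θ * n)) ρ t) * n
      ≤ (2 * b) * n := by linarith
  have := le_of_mul_le_mul_right h4 hn0
  linarith

/-- With `t = ε √(p/n)` and `a = ρ / √(2n)` the scale `t / a` is `ε √(2p) / ρ`. The first term is
then `ε √(8π) / ρ²`, which `ε` makes equal to `b / 6`; the second is of order `1 / (np)`, small for
large `n`. -/
lemma smallBall_parameters {n p s θ ρ ε κ α b : ℝ} (hn : 0 < n) (hp : 0 < p) (hs : 1 ≤ s)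
    (hθ : 0 < θ) (hρ : 0 < ρ) (hκ : 0 < κ) (hb : 0 < b)
    (hε : ε = b / 6 * ρ ^ 2 / √(8 * Real.pi)) (hpn : κ * n ^ (-α) ≤ p)
    (hbig : 128 * s ^ 2 * ρ ^ 2 / (θ * ε ^ 2) / κ * (6 / b) ≤ n ^ (1 - α)) :
    2 * (√(4 * Real.pi * (ε * √(p / n) / (ρ / √(2 * n))) ^ 2 / (p * ρ ^ 2)) +
      (16 * s * (1 / √(θ * n)) / (ε * √(p / n) / (ρ / √(2 * n)))) ^ 2) ≤ 2 * (b / 6 + b / 6) := by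
  have hpi := Real.pi_pos
  have hε0 : 0 < ε := by rw [hε]; positivity
  have hnp : κ * n ^ (1 - α) ≤ n * p := by
    calc κ * n ^ (1 - α) = n * (κ * n ^ (-α)) := by
          rw [sub_eq_add_neg, Real.rpow_add hn, Real.rpow_one]; ring
      _ ≤ _ := by gcongr
  have hta : ε * √(p / n) / (ρ / √(2 * n)) = ε * √2 * √p / ρ := by
    rw [Real.sqrt_div hp.le, Real.sqrt_mul (by norm_num)]
    have : 0 < √n := by positivity
    field_simp
  rw [hta]
  have h2 : √(4 * Real.pi * (ε * √2 * √p / ρ) ^ 2 / (p * ρ ^ 2)) = b / 6 := by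
    have : 4 * Real.pi * (ε * √2 * √p / ρ) ^ 2 / (p * ρ ^ 2) = (ε * √(8 * Real.pi) / ρ ^ 2) ^ 2 := by
      rw [div_pow, div_pow, mul_pow, mul_pow, mul_pow, Real.sq_sqrt hp.le,
        Real.sq_sqrt (by positivity), Real.sq_sqrt (by positivity)]
      field_simp; norm_num
    rw [this, Real.sqrt_sq (by positivity), hε]
    have : 0 < √(8 * Real.pi) := by positivity
    field_simp
  have h3 : (16 * s * (1 / √(θ * n)) / (ε * √2 * √p / ρ)) ^ 2 ≤ b / 6 := by
    have : (16 * s * (1 / √(θ * n)) / (ε * √2 * √p / ρ)) ^ 2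
        = 128 * s ^ 2 * ρ ^ 2 / (θ * ε ^ 2) / (n * p) := by
      have e1 : √(θ * n) ^ 2 = θ * n := Real.sq_sqrt (by positivity)
      have e2 : √2 ^ 2 = (2 : ℝ) := Real.sq_sqrt (by positivity)
      have e3 : √p ^ 2 = p := Real.sq_sqrt hp.le
      simp only [div_pow, mul_pow, e1, e2, e3]
      field_simp; norm_num
    rw [this, div_le_iff₀ (by positivity)]
    have h4 : 128 * s ^ 2 * ρ ^ 2 / (θ * ε ^ 2) = b / 6 *
        (κ * (128 * s ^ 2 * ρ ^ 2 / (θ * ε ^ 2) / κ * (6 / b))) := by field_simp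
    rw [h4]
    exact mul_le_mul_of_nonneg_left (le_trans (mul_le_mul_of_nonneg_left hbig hκ.le) hnp)
      (by positivity)
  linarith

/-- Spread unit vectors give combinations of norm at least `ε √(p / n)`, up to probability `η`. -/
lemma exists_measureReal_incompEvent_le {α κ s K θ ρ c : ℝ} (hα₁ : α < 1) (hκ : 0 < κ)
    (hs : 1 ≤ s) (hθ : 0 < θ) (hρ : 0 < ρ) (hc : 0 < c)
    (H : ∀ η > 0, ∀ᶠ n : ℕ in Filter.atTop,
      ∀ p : ℝ, κ * (n : ℝ) ^ (-α) ≤ p → ∀ ν : Measure ℝ, CenteredLaw s p ν →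
      ∀ N : ℕ, n ≤ 2 * N → ∀ W : Fin N → Fin n → ℝ, (matLaw ν (Fin N) (Fin n)).real
        (compEvent W (K * √(n * p)) (1 / √(θ * n)) ρ (c * √(n * p))) ≤ η) {η : ℝ} (hη : 0 < η) :
    ∃ ε > 0, ∀ᶠ n : ℕ in Filter.atTop, ∀ p : ℝ, κ * (n : ℝ) ^ (-α) ≤ p →
      ∀ ν : Measure ℝ, CenteredLaw s p ν → ∀ W : Fin n → Fin n → ℝ,
        (matLaw ν (Fin n) (Fin n)).real
          (incompEvent W (K * √(n * p)) (1 / √(θ * n)) ρ (ε * √(p / n))) ≤ η := by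
  set b : ℝ := η * (ρ ^ 2 * θ) / 2 with hb
  have hb0 : 0 < b := by positivity
  have hpi := Real.pi_pos
  set ε : ℝ := b / 6 * ρ ^ 2 / √(8 * Real.pi) with hε
  have hε0 : 0 < ε := by positivity
  refine ⟨ε, hε0, ?_⟩
  have htend : Filter.Tendsto (fun n : ℕ => (n : ℝ) ^ (1 - α)) Filter.atTop Filter.atTop :=
    (tendsto_rpow_atTop (by linarith)).comp tendsto_natCast_atTop_atTop
  filter_upwards [H (b / 3) (by positivity), Filter.eventually_ge_atTop 2,
    htend.eventually_ge_atTop (128 * s ^ 2 * ρ ^ 2 / (θ * ε ^ 2) / κ * (6 / b))]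
    with n hH hn2 hbig p hp ν hν W
  have hp0 := hν.p_pos
  have hn0 : (0 : ℝ) < (n : ℝ) := by exact_mod_cast (by omega : 0 < n)
  refine (hν.measureReal_incompEvent_le (by omega) W hθ hρ (b := b) fun k => ?_).trans_eq ?_
  · have hpar := smallBall_parameters hn0 hp0 hs hθ hρ hκ hb0 hε hp hbig
    obtain ⟨n', rfl⟩ : ∃ n', n = n' + 1 := ⟨n - 1, by omega⟩
    -- The normal is annihilated by only `n - 1` rows in dimension `n`, which is why the
    -- compressible bound allows every `N` with `n ≤ 2 N`.
    have h1 := hH p hp ν hν n' (by omega) fun j => W (k.succAbove j)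
    refine (hν.measureReal_colEvent_le W (h := 1 / √(θ * (n' + 1 : ℕ))) (ρ := ρ)
      (τ := c * √((n' + 1 : ℕ) * p)) (by positivity) (by positivity) (by positivity) hρ
      (by positivity) k).trans ?_
    linarith
  · rw [hb]; field_simp

end Incompressible

/-! ### Traces of powers as sums over closed walks -/

section Walks

open Matrix

/-- The last vertex is left free and tested by `φ`, so that the induction can peel off the first
step; `φ b = M b a` closes the walk. -/
lemma sum_walk_eq_pow {ι : Type*} [Fintype ι] [DecidableEq ι] (M : Matrix ι ι ℝ) (k : ℕ) (a : ι)
    (φ : ι → ℝ) :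
    ∑ g : Fin k → ι, (∏ t : Fin k, M ((Fin.cons a g : Fin (k + 1) → ι) t.castSucc)
        ((Fin.cons a g : Fin (k + 1) → ι) t.succ)) *
          φ ((Fin.cons a g : Fin (k + 1) → ι) (Fin.last k))
      = ∑ b, (M ^ k) a b * φ b := by
  induction k generalizing a with
  | zero => simp [Matrix.one_apply]
  | succ k ih =>
    rw [← (Fin.consEquiv fun _ : Fin (k + 1) => ι).sum_comp, Fintype.sum_prod_type]
    have : ∀ (b : ι) (g : Fin k → ι),
        (∏ t : Fin (k + 1), M ((Fin.cons a (Fin.cons b g : Fin (k + 1) → ι) : Fin (k + 2) → ι)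
          t.castSucc) ((Fin.cons a (Fin.cons b g : Fin (k + 1) → ι) : Fin (k + 2) → ι) t.succ)) *
            φ ((Fin.cons a (Fin.cons b g : Fin (k + 1) → ι) : Fin (k + 2) → ι) (Fin.last (k + 1)))
        = M a b * ((∏ t : Fin k, M ((Fin.cons b g : Fin (k + 1) → ι) t.castSucc)
            ((Fin.cons b g : Fin (k + 1) → ι) t.succ)) *
              φ ((Fin.cons b g : Fin (k + 1) → ι) (Fin.last k))) := by
      intro b g
      rw [Fin.prod_univ_succ, ← Fin.succ_last]
      simp only [Fin.castSucc_zero, Fin.cons_zero, Fin.cons_succ, ← Fin.succ_castSucc]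
      ring
    refine (Finset.sum_congr rfl fun b _ => Finset.sum_congr rfl fun g _ => this b g).trans ?_
    simp_rw [← Finset.mul_sum, ih]
    simp_rw [pow_succ', Matrix.mul_apply, Finset.sum_mul, Finset.mul_sum]
    rw [Finset.sum_comm]
    simp_rw [mul_assoc]

/-- The addition in `t + 1` is cyclic, so the last step returns to `f 0`. -/
lemma trace_pow_succ {ι : Type*} [Fintype ι] [DecidableEq ι] (M : Matrix ι ι ℝ) (k : ℕ) :
    (M ^ (k + 1)).trace = ∑ f : Fin (k + 1) → ι, ∏ t, M (f t) (f (t + 1)) := by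
  rw [← (Fin.consEquiv fun _ : Fin (k + 1) => ι).sum_comp, Fintype.sum_prod_type]
  simp only [Matrix.trace, Matrix.diag_apply, pow_succ, Matrix.mul_apply]
  refine Finset.sum_congr rfl fun a _ => ?_
  rw [← sum_walk_eq_pow M k a fun b => M b a]
  refine Finset.sum_congr rfl fun g _ => ?_
  rw [Fin.prod_univ_castSucc]
  simp only [Fin.consEquiv_apply, Fin.coeSucc_eq_succ, Fin.last_add_one, Fin.cons_zero]

/-- The row index of the `s`-th step of a closed walk alternating between rows and columns. -/
def rowIdx {k : ℕ} : Fin (k + 1) ⊕ Fin (k + 1) → Fin (k + 1) := Sum.elim id (· + 1)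

/-- The column index of the `s`-th step of a closed walk alternating between rows and columns. -/
def colIdx {k : ℕ} : Fin (k + 1) ⊕ Fin (k + 1) → Fin (k + 1) := Sum.elim id id

/-- The entry used at the `s`-th step of the closed walk with rows `f` and columns `g`. -/
def walk {ι J : Type*} {k : ℕ} (f : Fin (k + 1) → ι) (g : Fin (k + 1) → J)
    (s : Fin (k + 1) ⊕ Fin (k + 1)) : ι × J := (f (rowIdx s), g (colIdx s))

lemma trace_mul_transpose_pow {ι J : Type*} [Fintype ι] [DecidableEq ι] [Fintype J]
    (X : Matrix ι J ℝ) (k : ℕ) :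
    ((X * Xᵀ) ^ (k + 1)).trace = ∑ f : Fin (k + 1) → ι, ∑ g : Fin (k + 1) → J,
      ∏ s, X (walk f g s).1 (walk f g s).2 := by
  classical
  rw [trace_pow_succ]
  refine Finset.sum_congr rfl fun f _ => ?_
  simp only [Matrix.mul_apply, Matrix.transpose_apply]
  rw [Finset.prod_univ_sum, Fintype.piFinset_univ]
  refine Finset.sum_congr rfl fun g _ => ?_
  rw [Fintype.prod_sum_type, Finset.prod_mul_distrib]
  simp [walk, rowIdx, colIdx]

/-- How often the closed walk uses the entry `e`. -/
def walkMult {ι J : Type*} [DecidableEq ι] [DecidableEq J] {k : ℕ} (f : Fin (k + 1) → ι)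
    (g : Fin (k + 1) → J) (e : ι × J) : ℕ := (Finset.univ.filter fun s => walk f g s = e).card

lemma prod_walk {ι J : Type*} [Fintype ι] [DecidableEq ι] [Fintype J] [DecidableEq J]
    (X : ι → J → ℝ) {k : ℕ} (f : Fin (k + 1) → ι) (g : Fin (k + 1) → J) :
    ∏ s, X (walk f g s).1 (walk f g s).2 = ∏ i, ∏ j, X i j ^ walkMult f g (i, j) := by
  rw [← Fintype.prod_prod_type' fun i j => X i j ^ walkMult f g (i, j),
    ← Finset.prod_fiberwise Finset.univ (walk f g)]
  refine Finset.prod_congr rfl fun e _ => ?_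
  rw [walkMult, ← Finset.prod_const]
  refine Finset.prod_congr rfl fun s hs => ?_
  rw [(Finset.mem_filter.1 hs).2]

lemma sum_walkMult {ι J : Type*} [Fintype ι] [DecidableEq ι] [Fintype J] [DecidableEq J]
    {k : ℕ} (f : Fin (k + 1) → ι) (g : Fin (k + 1) → J) :
    ∑ e ∈ Finset.univ.image (walk f g), walkMult f g e = 2 * (k + 1) := by
  simp only [walkMult]
  rw [← Finset.card_eq_sum_card_image]
  simp; ring

/-! A closed walk visits at most one vertex more than it uses edges. -/

lemma card_image_add_card_image_insert {ι J : Type*} [DecidableEq ι] [DecidableEq J]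
    {S : Finset (ι × J)} (hS : (S.image Prod.fst).card + (S.image Prod.snd).card ≤ S.card + 1)
    {e : ι × J} (he : e.1 ∈ S.image Prod.fst ∨ e.2 ∈ S.image Prod.snd) :
    ((insert e S).image Prod.fst).card + ((insert e S).image Prod.snd).card
      ≤ (insert e S).card + 1 := by
  by_cases h : e ∈ S
  · rwa [Finset.insert_eq_of_mem h]
  · rw [Finset.card_insert_of_notMem h, Finset.image_insert, Finset.image_insert]
    have h1 := Finset.card_insert_le e.1 (S.image Prod.fst)
    have h2 := Finset.card_insert_le e.2 (S.image Prod.snd)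
    rcases he with he | he
    · rw [Finset.insert_eq_of_mem he]; omega
    · rw [Finset.insert_eq_of_mem he]; omega

/-- The entries used in the first `2 t + 1` steps of a walk. -/
def walkPrefix {ι J : Type*} [DecidableEq ι] [DecidableEq J] (F : ℕ → ι) (G : ℕ → J) :
    ℕ → Finset (ι × J)
  | 0 => {(F 0, G 0)}
  | t + 1 => insert (F (t + 1), G (t + 1)) (insert (F (t + 1), G t) (walkPrefix F G t))

lemma mem_walkPrefix {ι J : Type*} [DecidableEq ι] [DecidableEq J] (F : ℕ → ι) (G : ℕ → J)
    {i t : ℕ} (hi : i ≤ t) : (F i, G i) ∈ walkPrefix F G t := by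
  induction t with
  | zero => obtain rfl : i = 0 := by omega
            simp [walkPrefix]
  | succ t ih =>
    rcases hi.lt_or_eq with h | rfl
    · exact Finset.mem_insert_of_mem (Finset.mem_insert_of_mem (ih (by omega)))
    · exact Finset.mem_insert_self _ _

lemma card_image_walkPrefix_le {ι J : Type*} [DecidableEq ι] [DecidableEq J] (F : ℕ → ι)
    (G : ℕ → J) (t : ℕ) :
    ((walkPrefix F G t).image Prod.fst).card + ((walkPrefix F G t).image Prod.snd).card
      ≤ (walkPrefix F G t).card + 1 := by
  induction t with
  | zero => simp [walkPrefix]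
  | succ t ih =>
    -- Both new edges share an endpoint with an earlier one: the first its column, the second its
    -- row. Each therefore adds at most one vertex.
    refine card_image_add_card_image_insert (card_image_add_card_image_insert ih (Or.inr ?_))
      (Or.inl ?_)
    · exact Finset.mem_image.2 ⟨(F t, G t), mem_walkPrefix F G le_rfl, rfl⟩
    · rw [Finset.image_insert]; exact Finset.mem_insert_self _ _

lemma card_image_add_card_image_le {ι J : Type*} [DecidableEq ι] [DecidableEq J] {k : ℕ}
    (f : Fin (k + 1) → ι) (g : Fin (k + 1) → J) :
    (Finset.univ.image f).card + (Finset.univ.image g).card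
      ≤ (Finset.univ.image (walk f g)).card + 1 := by
  set F : ℕ → ι := fun i => f (Fin.ofNat (k + 1) i)
  set G : ℕ → J := fun i => g (Fin.ofNat (k + 1) i)
  have hval : ∀ t : Fin (k + 1), Fin.ofNat (k + 1) (t : ℕ) = t := fun t => by
    ext; simp
  have hsub : ∀ t, walkPrefix F G t ⊆ Finset.univ.image (walk f g) := by
    intro t
    induction t with
    | zero =>
      intro e he
      rw [walkPrefix, Finset.mem_singleton] at he
      exact Finset.mem_image.2 ⟨Sum.inl (Fin.ofNat (k + 1) 0), Finset.mem_univ _, by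
        rw [he]; rfl⟩
    | succ t ih =>
      intro e he
      rw [walkPrefix, Finset.mem_insert, Finset.mem_insert] at he
      rcases he with he | he | he
      · exact Finset.mem_image.2 ⟨Sum.inl (Fin.ofNat (k + 1) (t + 1)), Finset.mem_univ _, by
          rw [he]; rfl⟩
      · refine Finset.mem_image.2 ⟨Sum.inr (Fin.ofNat (k + 1) t), Finset.mem_univ _, ?_⟩
        rw [he]
        have : Fin.ofNat (k + 1) t + 1 = Fin.ofNat (k + 1) (t + 1) := by
          ext; simp [Fin.val_add]
        simp only [walk, rowIdx, colIdx, F, G, Sum.elim_inr, this, id]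
      · exact ih he
  have hf : Finset.univ.image f ⊆ (walkPrefix F G k).image Prod.fst := by
    intro i hi
    obtain ⟨t, -, rfl⟩ := Finset.mem_image.1 hi
    refine Finset.mem_image.2 ⟨(F t, G t), mem_walkPrefix F G (by omega), ?_⟩
    simp only [F, hval]
  have hg : Finset.univ.image g ⊆ (walkPrefix F G k).image Prod.snd := by
    intro i hi
    obtain ⟨t, -, rfl⟩ := Finset.mem_image.1 hi
    refine Finset.mem_image.2 ⟨(F t, G t), mem_walkPrefix F G (by omega), ?_⟩
    simp only [G, hval]
  have h1 := Finset.card_le_card hf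
  have h2 := Finset.card_le_card hg
  have h3 := Finset.card_le_card (hsub k)
  have h4 := card_image_walkPrefix_le F G k
  omega

end Walks

/-! ### Comparing sums over walks in index sets of different sizes -/

section Kernels

instance finite_setoid (α : Type*) [Finite α] : Finite (Setoid α) :=
  Finite.of_injective (fun s : Setoid α => fun a b => s a b) fun s s' h => by
    ext a b; exact iff_of_eq (congrFun (congrFun h a) b)

lemma card_ker_eq_le {α : Type*} [Finite α] (n : ℕ) (π : Setoid α) :
    Nat.card {f : α → Fin n // Setoid.ker f = π} ≤ n ^ Nat.card (Quotient π) := by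
  have : Nat.card (Quotient π → Fin n) = n ^ Nat.card (Quotient π) := by
    rw [Nat.card_fun, Nat.card_fin]
  rw [← this]
  refine Nat.card_le_card_of_injective
    (fun f : {f : α → Fin n // Setoid.ker f = π} => fun q : Quotient π =>
      Quotient.lift f.1 (fun a b hab => by
        have : Setoid.ker f.1 a b := by rw [f.2]; exact hab
        exact this) q) fun f f' h => ?_
  ext a
  exact congrArg Fin.val (congrFun h (Quotient.mk π a))

/-- Injections of the quotient by `π` pull back to maps with kernel exactly `π`. -/
lemma descFactorial_le_card_ker_eq {α : Type*} [Finite α] (n : ℕ) (π : Setoid α) :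
    n.descFactorial (Nat.card (Quotient π)) ≤ Nat.card {f : α → Fin n // Setoid.ker f = π} := by
  classical
  have := Fintype.ofFinite α
  have := Fintype.ofFinite (Quotient π)
  have hc : Nat.card (Quotient π ↪ Fin n) = n.descFactorial (Nat.card (Quotient π)) := by
    rw [Nat.card_eq_fintype_card, Fintype.card_embedding_eq, Fintype.card_fin,
      Nat.card_eq_fintype_card]
  rw [← hc]
  refine Nat.card_le_card_of_injective
    (fun e : Quotient π ↪ Fin n => (⟨fun a => e (Quotient.mk π a), ?_⟩ :
      {f : α → Fin n // Setoid.ker f = π})) fun e e' h => ?_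
  · ext a b
    rw [Setoid.ker_def]
    exact e.injective.eq_iff.trans Quotient.eq
  · ext q
    induction q using Quotient.inductionOn with
    | h a => exact congrArg Fin.val (congrFun (congrArg Subtype.val h) a)

lemma card_image_eq_card_quotient_ker {α β : Type*} [Fintype α] [DecidableEq β] (f : α → β) :
    (Finset.univ.image f).card = Nat.card (Quotient (Setoid.ker f)) := by
  have h : Set.range f = ((Finset.univ.image f : Finset β) : Set β) := by simp
  rw [Nat.card_congr (Setoid.quotientKerEquivRange f), Nat.card_coe_set_eq, h,
    Set.ncard_coe_finset]

/-- A function of the kernel has a larger sum over maps into a sufficiently large set than the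
sum over maps into `Fin n`, when the latter is normalized by the size of the images. -/
lemma sum_ker_le_sum_ker {k n : ℕ} (hn : 0 < n) (H : Setoid (Fin k) → ℝ) (hH : ∀ π, 0 ≤ H π) :
    ∑ f : Fin k → Fin n, (((k : ℝ) + 1) / n) ^ (Finset.univ.image f).card * H (Setoid.ker f)
      ≤ ∑ f : Fin k → Fin (2 * k), H (Setoid.ker f) := by
  classical
  have := Fintype.ofFinite (Setoid (Fin k))
  have hn0 : (0 : ℝ) < n := by exact_mod_cast hn
  rw [← Finset.sum_fiberwise Finset.univ (fun f : Fin k → Fin n => Setoid.ker f),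
    ← Finset.sum_fiberwise Finset.univ (fun f : Fin k → Fin (2 * k) => Setoid.ker f)]
  refine Finset.sum_le_sum fun π _ => ?_
  set v := Nat.card (Quotient π) with hv
  have hvk : v ≤ k := by
    have := Nat.card_le_card_of_surjective (Quotient.mk π) Quotient.mk_surjective
    rwa [Nat.card_fin] at this
  have h1 : ∑ f : Fin k → Fin n with Setoid.ker f = π,
      (((k : ℝ) + 1) / n) ^ (Finset.univ.image f).card * H (Setoid.ker f)
      = (Nat.card {f : Fin k → Fin n // Setoid.ker f = π} : ℝ) * ((((k : ℝ) + 1) / n) ^ v * H π) := by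
    rw [Nat.card_eq_fintype_card, Fintype.card_subtype, ← nsmul_eq_mul, ← Finset.sum_const]
    refine Finset.sum_congr rfl fun f hf => ?_
    have hf : Setoid.ker f = π := (Finset.mem_filter.1 hf).2
    rw [card_image_eq_card_quotient_ker, hf]
  have h2 : ∑ f : Fin k → Fin (2 * k) with Setoid.ker f = π, H (Setoid.ker f)
      = (Nat.card {f : Fin k → Fin (2 * k) // Setoid.ker f = π} : ℝ) * H π := by
    rw [Nat.card_eq_fintype_card, Fintype.card_subtype, ← nsmul_eq_mul, ← Finset.sum_const]
    refine Finset.sum_congr rfl fun f hf => ?_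
    rw [(Finset.mem_filter.1 hf).2]
  rw [h1, h2]
  have h3 : (Nat.card {f : Fin k → Fin n // Setoid.ker f = π} : ℝ) ≤ (n : ℝ) ^ v := by
    exact_mod_cast card_ker_eq_le n π
  -- The size `2 k` leaves at least `k + 1` free values for each of the `v ≤ k` classes.
  have h4 : ((k : ℝ) + 1) ^ v ≤ (Nat.card {f : Fin k → Fin (2 * k) // Setoid.ker f = π} : ℝ) := by
    have h5 := descFactorial_le_card_ker_eq (2 * k) π
    have h6 := Nat.pow_sub_le_descFactorial (2 * k) v
    have h7 : (k + 1) ^ v ≤ (2 * k + 1 - v) ^ v := Nat.pow_le_pow_left (by omega) v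
    exact_mod_cast h7.trans (h6.trans h5)
  calc (Nat.card {f : Fin k → Fin n // Setoid.ker f = π} : ℝ) * ((((k : ℝ) + 1) / n) ^ v * H π)
      ≤ (n : ℝ) ^ v * ((((k : ℝ) + 1) / n) ^ v * H π) := by
        have := hH π
        gcongr
    _ = ((k : ℝ) + 1) ^ v * H π := by
        rw [div_pow]; field_simp
    _ ≤ _ := mul_le_mul_of_nonneg_right h4 (hH π)

end Kernels

/-! ### Comparison of moments of traces -/

section Moments

open Matrix

/-- The expected contribution of a closed walk, in terms of the moments `m` of the entries. -/
def walkWeight {ι J : Type*} [Fintype ι] [DecidableEq ι] [Fintype J] [DecidableEq J] (m : ℕ → ℝ)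
    {k : ℕ} (f : Fin (k + 1) → ι) (g : Fin (k + 1) → J) : ℝ :=
  ∏ i, ∏ j, m (walkMult f g (i, j))

lemma integral_prod_walk {ι J : Type*} [Fintype ι] [DecidableEq ι] [Fintype J] [DecidableEq J]
    (ν : Measure ℝ) [IsProbabilityMeasure ν] (T : ℝ → ℝ) {k : ℕ} (f : Fin (k + 1) → ι)
    (g : Fin (k + 1) → J) :
    ∫ X, ∏ s, T (X (walk f g s).1 (walk f g s).2) ∂(matLaw ν ι J)
      = walkWeight (fun l => ∫ x, T x ^ l ∂ν) f g := by
  have h : ∀ X : ι → J → ℝ, ∏ s, T (X (walk f g s).1 (walk f g s).2)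
      = ∏ i, ∏ j, T (X i j) ^ walkMult f g (i, j) := fun X => prod_walk (fun i j => T (X i j)) f g
  simp_rw [h]
  unfold matLaw walkWeight
  rw [integral_fintype_prod_eq_prod
    (f := fun i (x : J → ℝ) => ∏ j, T (x j) ^ walkMult f g (i, j))]
  refine Finset.prod_congr rfl fun i _ => ?_
  rw [integral_fintype_prod_eq_prod (f := fun j (x : ℝ) => T x ^ walkMult f g (i, j))]

lemma integrable_prod_walk {ι J : Type*} [Fintype ι] [Fintype J]
    (ν : Measure ℝ) [IsProbabilityMeasure ν] {T : ℝ → ℝ} (hT : Measurable T) {C : ℝ}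
    (hC : ∀ᵐ x ∂ν, |T x| ≤ C) {k : ℕ} (f : Fin (k + 1) → ι) (g : Fin (k + 1) → J) :
    Integrable (fun X => ∏ s, T (X (walk f g s).1 (walk f g s).2)) (matLaw ν ι J) := by
  have hae : ∀ s, ∀ᵐ X ∂(matLaw ν ι J), |T (X (walk f g s).1 (walk f g s).2)| ≤ C := by
    intro s
    have h1 : MeasurePreserving (fun x : J → ℝ => x (walk f g s).2) (Measure.pi fun _ : J => ν) ν :=
      measurePreserving_eval (fun _ : J => ν) _
    have h2 : MeasurePreserving (fun X : ι → J → ℝ => X (walk f g s).1) (matLaw ν ι J)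
        (Measure.pi fun _ : J => ν) :=
      measurePreserving_eval (fun _ : ι => Measure.pi fun _ : J => ν) _
    exact (h1.comp h2).quasiMeasurePreserving.ae hC
  refine Integrable.of_bound (C := ∏ _s : Fin (k + 1) ⊕ Fin (k + 1), C) ?_ ?_
  · refine (Finset.measurable_prod _ fun s _ => hT.comp ?_).aestronglyMeasurable
    exact (measurable_pi_apply _).comp (measurable_pi_apply _)
  · filter_upwards [ae_all_iff.2 hae] with X hX
    rw [norm_prod]
    exact Finset.prod_le_prod (fun _ _ => norm_nonneg _) fun s _ => hX s

lemma integral_trace_pow {ι J : Type*} [Fintype ι] [DecidableEq ι] [Fintype J] [DecidableEq J]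
    (ν : Measure ℝ) [IsProbabilityMeasure ν] {T : ℝ → ℝ} (hT : Measurable T) {C : ℝ}
    (hC : ∀ᵐ x ∂ν, |T x| ≤ C) (k : ℕ) :
    Integrable (fun X : ι → J → ℝ => ((Matrix.of (fun i j => T (X i j)) *
      (Matrix.of fun i j => T (X i j))ᵀ) ^ (k + 1)).trace) (matLaw ν ι J) ∧
    ∫ X : ι → J → ℝ, ((Matrix.of (fun i j => T (X i j)) *
      (Matrix.of fun i j => T (X i j))ᵀ) ^ (k + 1)).trace ∂(matLaw ν ι J)
      = ∑ f : Fin (k + 1) → ι, ∑ g : Fin (k + 1) → J, walkWeight (fun l => ∫ x, T x ^ l ∂ν) f g := by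
  have hi := fun (f : Fin (k + 1) → ι) (g : Fin (k + 1) → J) => integrable_prod_walk ν hT hC f g
  simp_rw [trace_mul_transpose_pow, Matrix.of_apply]
  refine ⟨integrable_finsetSum _ fun f _ => integrable_finsetSum _ fun g _ => hi f g, ?_⟩
  rw [integral_finsetSum _ fun f _ => integrable_finsetSum _ fun g _ => hi f g]
  refine Finset.sum_congr rfl fun f _ => ?_
  rw [integral_finsetSum _ fun g _ => hi f g]
  exact Finset.sum_congr rfl fun g _ => integral_prod_walk ν T f g

/-- No step of a closed walk with kernels `π₁` and `π₂` uses an entry which is used only once. -/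
def NoSingle {k : ℕ} (π₁ π₂ : Setoid (Fin (k + 1))) : Prop :=
  ∀ s, ∃ s' ≠ s, π₁ (rowIdx s') (rowIdx s) ∧ π₂ (colIdx s') (colIdx s)

lemma NoSingle.two_le_walkMult {ι J : Type*} [DecidableEq ι] [DecidableEq J] {k : ℕ}
    {f : Fin (k + 1) → ι} {g : Fin (k + 1) → J} (h : NoSingle (Setoid.ker f) (Setoid.ker g)) {e : ι × J}
    (he : e ∈ Finset.univ.image (walk f g)) : 2 ≤ walkMult f g e := by
  obtain ⟨s, -, rfl⟩ := Finset.mem_image.1 he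
  obtain ⟨s', hne, h1, h2⟩ := h s
  have h3 : walk f g s' = walk f g s := Prod.ext h1 h2
  exact Finset.one_lt_card.2 ⟨s', by simp [h3], s, by simp, hne⟩

lemma exists_walkMult_eq_one {ι J : Type*} [DecidableEq ι] [DecidableEq J] {k : ℕ}
    {f : Fin (k + 1) → ι} {g : Fin (k + 1) → J} (h : ¬ NoSingle (Setoid.ker f) (Setoid.ker g)) :
    ∃ e, walkMult f g e = 1 := by
  unfold NoSingle at h
  push Not at h
  obtain ⟨s, hs⟩ := h
  refine ⟨walk f g s, Finset.card_eq_one.2 ⟨s, ?_⟩⟩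
  ext s'
  simp only [Finset.mem_filter, Finset.mem_univ, true_and, Finset.mem_singleton]
  refine ⟨fun h => ?_, fun h => by rw [h]⟩
  by_contra hne
  exact hs s' hne (congrArg Prod.fst h) (congrArg Prod.snd h)

variable {ι J : Type*} [Fintype ι] [DecidableEq ι] [Fintype J] [DecidableEq J] {k : ℕ}
  {f : Fin (k + 1) → ι} {g : Fin (k + 1) → J}

lemma walkWeight_eq_prod (m : ℕ → ℝ) (hm0 : m 0 = 1) (f : Fin (k + 1) → ι) (g : Fin (k + 1) → J) :
    walkWeight m f g = ∏ e ∈ Finset.univ.image (walk f g), m (walkMult f g e) := by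
  rw [walkWeight, ← Fintype.prod_prod_type' fun i j => m (walkMult f g (i, j))]
  symm
  refine Finset.prod_subset (Finset.subset_univ _) fun e _ he => ?_
  have : walkMult f g e = 0 := by
    rw [walkMult, Finset.card_eq_zero, Finset.filter_eq_empty_iff]
    intro s _ hs
    exact he (hs ▸ Finset.mem_image_of_mem _ (Finset.mem_univ s))
  rw [show m (walkMult f g (e.1, e.2)) = m (walkMult f g e) from rfl, this, hm0]

/-- An entry used exactly once contributes its mean, which is zero. -/
lemma walkWeight_eq_zero {m : ℕ → ℝ} (hm1 : m 1 = 0)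
    (h : ¬ NoSingle (Setoid.ker f) (Setoid.ker g)) : walkWeight m f g = 0 := by
  obtain ⟨e, he⟩ := exists_walkMult_eq_one h
  rw [walkWeight, ← Fintype.prod_prod_type' fun i j => m (walkMult f g (i, j))]
  exact Finset.prod_eq_zero (Finset.mem_univ e) (by
    rw [show walkMult f g (e.1, e.2) = walkMult f g e from rfl, he, hm1])

lemma NoSingle.card_image_le
    (h : NoSingle (Setoid.ker f) (Setoid.ker g)) :
    (Finset.univ.image (walk f g)).card ≤ k + 1 := by
  have h1 := sum_walkMult f g
  have h2 : ∑ _e ∈ Finset.univ.image (walk f g), 2 ≤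
      ∑ e ∈ Finset.univ.image (walk f g), walkMult f g e :=
    Finset.sum_le_sum fun e he => h.two_le_walkMult he
  rw [h1, Finset.sum_const, smul_eq_mul] at h2
  omega

/-- Each distinct entry costs `a`, and each use beyond the second costs `b`. The walk has `2 (k +
1)` steps, so the excess uses number twice `k + 1` minus the number of distinct entries. -/
lemma abs_walkWeight_le {m : ℕ → ℝ} (hm0 : m 0 = 1) {a b : ℝ}
    (hm : ∀ l, 2 ≤ l → |m l| ≤ a * b ^ (l - 2))
    (h : NoSingle (Setoid.ker f) (Setoid.ker g)) :
    |walkWeight m f g| ≤ a ^ (Finset.univ.image (walk f g)).card *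
      (b ^ 2) ^ (k + 1 - (Finset.univ.image (walk f g)).card) := by
  set S := Finset.univ.image (walk f g)
  rw [walkWeight_eq_prod m hm0, Finset.abs_prod]
  calc ∏ e ∈ S, |m (walkMult f g e)| ≤ ∏ e ∈ S, a * b ^ (walkMult f g e - 2) :=
        Finset.prod_le_prod (fun _ _ => abs_nonneg _) fun e he => hm _ (h.two_le_walkMult he)
    _ = a ^ S.card * (b ^ 2) ^ (k + 1 - S.card) := by
        rw [Finset.prod_mul_distrib, Finset.prod_const, Finset.prod_pow_eq_pow_sum, ← pow_mul]
        congr 2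
        have h1 := sum_walkMult f g
        have h2 : ∑ e ∈ S, walkMult f g e = ∑ e ∈ S, (walkMult f g e - 2) + ∑ _e ∈ S, 2 := by
          rw [← Finset.sum_add_distrib]
          refine Finset.sum_congr rfl fun e he => ?_
          have := h.two_le_walkMult he
          omega
        rw [h1, Finset.sum_const, smul_eq_mul] at h2
        omega

lemma one_le_walkWeight {m : ℕ → ℝ} (hm0 : m 0 = 1) (hm : ∀ l, 2 ≤ l → 1 ≤ m l)
    (h : NoSingle (Setoid.ker f) (Setoid.ker g)) : 1 ≤ walkWeight m f g := by
  rw [walkWeight_eq_prod m hm0]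
  have : ∏ e ∈ Finset.univ.image (walk f g), (1 : ℝ)
      ≤ ∏ e ∈ Finset.univ.image (walk f g), m (walkMult f g e) :=
    Finset.prod_le_prod (fun _ _ => zero_le_one) fun e he => hm _ (h.two_le_walkMult he)
  simpa using this

/-- With `E` edges and `v` vertices, each of the `K - E` missing edges is paid by `b ≤ n a / L`, and
each vertex missing from the maximum `E + 1` by `L ≤ n`. What remains is the normalization `(L / n)
^ v` required by `sum_ker_le_sum_ker`. -/
lemma pow_comparison {a b n L : ℝ} {E K v : ℕ} (ha : 0 ≤ a) (hb : 0 ≤ b) (hn : 0 < n) (hL : 0 < L)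
    (hbP : b * L ≤ n * a) (hLn : L ≤ n) (hE : E ≤ K) (hv : v ≤ E + 1) :
    a ^ E * b ^ (K - E) ≤ n * (n * a) ^ K / L ^ (K + 1) * (L / n) ^ v := by
  obtain ⟨D, hD⟩ := Nat.exists_eq_add_of_le hv
  obtain ⟨F, rfl⟩ := Nat.exists_eq_add_of_le hE
  have h1 : b ^ F ≤ (n * a / L) ^ F := by
    apply pow_le_pow_left₀ hb
    rwa [le_div_iff₀ hL]
  rw [Nat.add_sub_cancel_left]
  calc a ^ E * b ^ F ≤ a ^ E * (n * a / L) ^ F := by gcongr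
    _ = (n * a) ^ (E + F) * (1 / (n ^ E * L ^ F)) := by
        rw [div_pow, pow_add, mul_pow n a E]; field_simp
    _ ≤ (n * a) ^ (E + F) * (n / L ^ (E + F + 1) * (L / n) ^ v) := by
        gcongr
        rw [div_pow, div_mul_div_comm, div_le_div_iff₀ (by positivity) (by positivity), one_mul]
        have e1 : L ^ (E + F + 1) = L ^ v * L ^ F * L ^ D := by
          rw [← pow_add, ← pow_add]; congr 1; omega
        have e2 : n * L ^ v * (n ^ E * L ^ F) = n ^ v * n ^ D * L ^ v * L ^ F := by
          rw [← pow_add, ← hD, pow_succ]; ring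
        rw [e1, e2]
        have : L ^ D ≤ n ^ D := by gcongr
        calc L ^ v * L ^ F * L ^ D * n ^ v ≤ L ^ v * L ^ F * n ^ D * n ^ v := by gcongr
          _ = _ := by ring
    _ = _ := by ring

/-- Comparison of the sums over closed walks for an `n × n` matrix with entries of small
moments, and for a small matrix with entries whose moments are at least one. -/
lemma sum_walkWeight_le {n k : ℕ} {m m' : ℕ → ℝ} (hm0 : m 0 = 1) (hm1 : m 1 = 0) {a b : ℝ}
    (ha : 0 ≤ a) (hm : ∀ l, 2 ≤ l → |m l| ≤ a * b ^ (l - 2))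
    (hm'0 : m' 0 = 1) (hm'1 : m' 1 = 0) (hm' : ∀ l, 2 ≤ l → 1 ≤ m' l)
    (hbP : b ^ 2 * (k + 2) ≤ n * a) (hkn : k + 2 ≤ n) :
    ∑ f : Fin (k + 1) → Fin n, ∑ g : Fin (k + 1) → Fin n, walkWeight m f g
      ≤ n * (n * a) ^ (k + 1) / ((k : ℝ) + 2) ^ (k + 2) *
        ∑ f : Fin (k + 1) → Fin (2 * (k + 1)), ∑ g : Fin (k + 1) → Fin (2 * (k + 1)),
          walkWeight m' f g := by
  classical
  have hn : 0 < n := by omega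
  have hn0 : (0 : ℝ) < n := by exact_mod_cast hn
  set c : ℝ := n * (n * a) ^ (k + 1) / ((k : ℝ) + 2) ^ (k + 2)
  have hc : 0 ≤ c := by positivity
  set L : ℝ := ((k + 1 : ℕ) : ℝ) + 1 with hL
  have hL2 : L = (k : ℝ) + 2 := by rw [hL]; push_cast; ring
  -- The indicator depends only on the two kernels. It separates the upper bound on the large matrix
  -- from the lower bound on the reference one, and `sum_ker_le_sum_ker` is applied once to columns
  -- and once to rows.
  set I' : Setoid (Fin (k + 1)) → Setoid (Fin (k + 1)) → ℝ :=
    fun π₁ π₂ => if NoSingle π₁ π₂ then 1 else 0 with hI'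
  have hI0 : ∀ π₁ π₂, 0 ≤ I' π₁ π₂ := fun π₁ π₂ => by simp only [hI']; split_ifs <;> norm_num
  have h1 : ∀ f g : Fin (k + 1) → Fin n, walkWeight m f g ≤
      c * ((L / n) ^ (Finset.univ.image f).card *
        ((L / n) ^ (Finset.univ.image g).card * I' (Setoid.ker f) (Setoid.ker g))) := by
    intro f g
    by_cases h : NoSingle (Setoid.ker f) (Setoid.ker g)
    · simp only [hI', if_pos h, mul_one]
      rw [← pow_add]
      refine (le_abs_self _).trans ((abs_walkWeight_le hm0 hm h).trans ?_)
      have := pow_comparison (a := a) (b := b ^ 2) (n := n) (L := L)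
        (E := (Finset.univ.image (walk f g)).card) (K := k + 1)
        (v := (Finset.univ.image f).card + (Finset.univ.image g).card) ha (sq_nonneg b) hn0
        (by positivity) (by rw [hL2]; exact hbP) (by rw [hL2]; exact_mod_cast hkn)
        h.card_image_le (card_image_add_card_image_le f g)
      rwa [hL2] at this ⊢
    · rw [walkWeight_eq_zero hm1 h]
      have := hI0 (Setoid.ker f) (Setoid.ker g)
      positivity
  have h2 : ∀ f g : Fin (k + 1) → Fin (2 * (k + 1)), I' (Setoid.ker f) (Setoid.ker g) ≤
      walkWeight m' f g := by
    intro f g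
    by_cases h : NoSingle (Setoid.ker f) (Setoid.ker g)
    · simp only [hI', if_pos h]
      exact one_le_walkWeight hm'0 hm' h
    · rw [walkWeight_eq_zero hm'1 h]
      simp only [hI', if_neg h, le_refl]
  calc ∑ f : Fin (k + 1) → Fin n, ∑ g : Fin (k + 1) → Fin n, walkWeight m f g
      ≤ ∑ f : Fin (k + 1) → Fin n, ∑ g : Fin (k + 1) → Fin n,
        c * ((L / n) ^ (Finset.univ.image f).card *
        ((L / n) ^ (Finset.univ.image g).card * I' (Setoid.ker f) (Setoid.ker g))) :=
        Finset.sum_le_sum fun f _ => Finset.sum_le_sum fun g _ => h1 f g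
    _ = c * ∑ f : Fin (k + 1) → Fin n, (L / n) ^ (Finset.univ.image f).card *
        ∑ g : Fin (k + 1) → Fin n,
          (L / n) ^ (Finset.univ.image g).card * I' (Setoid.ker f) (Setoid.ker g) := by
        simp_rw [Finset.mul_sum]
    _ ≤ c * ∑ f : Fin (k + 1) → Fin n, (L / n) ^ (Finset.univ.image f).card *
        ∑ g : Fin (k + 1) → Fin (2 * (k + 1)), I' (Setoid.ker f) (Setoid.ker g) := by
        gcongr with f _
        exact sum_ker_le_sum_ker hn (fun π => I' (Setoid.ker f) π) fun π => hI0 _ π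
    _ ≤ c * ∑ f : Fin (k + 1) → Fin (2 * (k + 1)),
        ∑ g : Fin (k + 1) → Fin (2 * (k + 1)), I' (Setoid.ker f) (Setoid.ker g) := by
        gcongr
        exact sum_ker_le_sum_ker hn
          (fun π => ∑ g : Fin (k + 1) → Fin (2 * (k + 1)), I' π (Setoid.ker g))
          fun π => Finset.sum_nonneg fun g _ => hI0 π _
    _ ≤ _ := by
        gcongr with f _ g _
        exact h2 f g

end Moments

/-! ### Operator norms and traces -/

section OperatorTrace

open Matrix

lemma mv_dotProduct {ι J : Type*} [Fintype ι] [Fintype J] (B : ι → J → ℝ) (x : J → ℝ) (y : ι → ℝ) :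
    mv B x ⬝ᵥ y = x ⬝ᵥ mv (fun j i => B i j) y := by
  simp only [mv, dotProduct, Finset.sum_mul, Finset.mul_sum]
  rw [Finset.sum_comm]
  refine Finset.sum_congr rfl fun j _ => Finset.sum_congr rfl fun i _ => by ring

lemma dotProduct_self_eq_l2_sq {J : Type*} [Fintype J] (y : J → ℝ) : y ⬝ᵥ y = l2 y ^ 2 := by
  rw [l2_sq, dotProduct]; simp only [sq]

lemma OpBound.transpose {ι J : Type*} [Fintype ι] [Fintype J] {B : ι → J → ℝ} {K : ℝ} (hK : 0 ≤ K)
    (h : OpBound (fun j i => B i j) K) : OpBound B K := by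
  intro x
  set y := mv B x with hy
  have h1 : l2 y ^ 2 ≤ l2 x * (K * l2 y) := by
    calc l2 y ^ 2 = x ⬝ᵥ mv (fun j i => B i j) y := by
          rw [← mv_dotProduct, ← hy, dotProduct_self_eq_l2_sq]
      _ ≤ |x ⬝ᵥ mv (fun j i => B i j) y| := le_abs_self _
      _ ≤ l2 x * l2 (mv (fun j i => B i j) y) := abs_dotProduct_le _ _
      _ ≤ _ := mul_le_mul_of_nonneg_left (h y) (l2_nonneg x)
  rcases (l2_nonneg y).eq_or_lt with h0 | h0
  · rw [← h0]; exact mul_nonneg hK (l2_nonneg x)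
  · have : l2 y * l2 y ≤ (K * l2 x) * l2 y := by nlinarith
    exact le_of_mul_le_mul_right this h0

lemma opBound_of_unit {ι J : Type*} [Fintype ι] [Fintype J] {B : ι → J → ℝ} {K : ℝ}
    (h : ∀ x, l2 x = 1 → l2 (mv B x) ≤ K) : OpBound B K := by
  intro x
  rcases (l2_nonneg x).eq_or_lt with h0 | h0
  · have : x = 0 := l2_eq_zero.1 h0.symm
    have h1 : mv B (0 : J → ℝ) = 0 := by funext i; simp [mv]
    rw [this, h1]; simp
  · have h1 := h ((l2 x)⁻¹ • x) (by
      rw [l2_smul, abs_of_pos (inv_pos.2 h0), inv_mul_cancel₀ h0.ne'])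
    rw [mv_smul, l2_smul, abs_of_pos (inv_pos.2 h0), inv_mul_le_iff₀ h0] at h1
    linarith

/-- The trace of an even power of `X Xᵀ` controls the operator norm of `X`. -/
lemma opBound_of_trace_le {ι J : Type*} [Fintype ι] [DecidableEq ι] [Fintype J] (X : ι → J → ℝ)
    {K : ℝ} (hK : 0 ≤ K) (j : ℕ)
    (h : ((Matrix.of X * (Matrix.of X)ᵀ) ^ 2 ^ (j + 1)).trace ≤ (K ^ 2) ^ 2 ^ (j + 1)) :
    OpBound X K := by
  set M := Matrix.of X * (Matrix.of X)ᵀ with hM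
  have hsymm : ∀ l, (M ^ l)ᵀ = M ^ l := by
    intro l
    rw [Matrix.transpose_pow]
    congr 1
    rw [hM, Matrix.transpose_mul, Matrix.transpose_transpose]
  have hdot : ∀ (l : ℕ) (x : ι → ℝ), x ⬝ᵥ (M ^ (l + l)) *ᵥ x = l2 ((M ^ l) *ᵥ x) ^ 2 := by
    intro l x
    rw [pow_add, ← Matrix.mulVec_mulVec, Matrix.dotProduct_mulVec, ← Matrix.mulVec_transpose, hsymm,
      dotProduct_self_eq_l2_sq]
  -- Each doubling of the exponent is one use of Cauchy–Schwarz, which avoids the spectral theorem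
  -- and explains the powers of two.
  have hpow : ∀ (i : ℕ) (x : ι → ℝ), l2 x = 1 → (x ⬝ᵥ M *ᵥ x) ^ 2 ^ i ≤ x ⬝ᵥ (M ^ 2 ^ i) *ᵥ x := by
    intro i x hx
    have h0 : 0 ≤ x ⬝ᵥ M *ᵥ x := by
      rw [hM, ← Matrix.mulVec_mulVec, Matrix.dotProduct_mulVec, ← Matrix.mulVec_transpose,
        dotProduct_self_eq_l2_sq]
      positivity
    induction i with
    | zero => simp
    | succ i ih =>
      have e : 2 ^ (i + 1) = 2 ^ i + 2 ^ i := by rw [pow_succ]; ring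
      have h1 := abs_dotProduct_le x ((M ^ 2 ^ i) *ᵥ x)
      rw [hx, one_mul] at h1
      rw [e, hdot, ← two_mul, mul_comm, pow_mul]
      refine pow_le_pow_left₀ (by positivity) (ih.trans ((le_abs_self _).trans h1)) 2
  -- The trace of an even power is the squared Frobenius norm of its symmetric half.
  have hfrob : ∀ (l : ℕ) (x : ι → ℝ), l2 x = 1 → x ⬝ᵥ (M ^ (l + l)) *ᵥ x ≤ (M ^ (l + l)).trace := by
    intro l x hx
    rw [hdot, l2_sq]
    have e : (M ^ (l + l)).trace = ∑ i, ∑ j, (M ^ l) i j ^ 2 := by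
      rw [pow_add]
      nth_rewrite 2 [← hsymm l]
      simp only [Matrix.trace, Matrix.diag_apply, Matrix.mul_apply, Matrix.transpose_apply, sq]
    rw [e]
    refine Finset.sum_le_sum fun i _ => ?_
    have h1 := abs_dotProduct_le ((M ^ l) i) x
    rw [hx, mul_one] at h1
    have h2 := pow_le_pow_left₀ (abs_nonneg _) h1 2
    rw [sq_abs, l2_sq] at h2
    exact h2
  refine OpBound.transpose hK (opBound_of_unit fun x hx => ?_)
  have h1 := hpow (j + 1) x hx
  have e : 2 ^ (j + 1) = 2 ^ j + 2 ^ j := by rw [pow_succ]; ring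
  have h2 := hfrob (2 ^ j) x hx
  rw [← e] at h2
  have h3 : x ⬝ᵥ M *ᵥ x = l2 (mv (fun j i => X i j) x) ^ 2 := by
    rw [hM, ← Matrix.mulVec_mulVec, Matrix.dotProduct_mulVec, ← Matrix.mulVec_transpose,
      dotProduct_self_eq_l2_sq]
    rfl
  rw [h3] at h1
  have h4 := (h1.trans h2).trans h
  have h5 := le_of_pow_le_pow_left₀ (by positivity) (by positivity) h4
  exact (abs_le_of_sq_le_sq' h5 hK).2

lemma trace_pow_le_of_opBound {r : ℕ} (Y : Fin r → Fin r → ℝ) {B : ℝ} (hB : 0 ≤ B)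
    (h : OpBound Y B) (k : ℕ) :
    ((Matrix.of Y * (Matrix.of Y)ᵀ) ^ k).trace ≤ r * B ^ (2 * k) := by
  set M := Matrix.of Y * (Matrix.of Y)ᵀ with hM
  have hT : ∀ x, l2 ((Matrix.of Y)ᵀ *ᵥ x) ≤ B * l2 x := fun x =>
    OpBound.transpose (B := fun j i => Y i j) hB h x
  have hMx : ∀ x, l2 (M *ᵥ x) ≤ B ^ 2 * l2 x := by
    intro x
    rw [hM, ← Matrix.mulVec_mulVec]
    calc l2 (Matrix.of Y *ᵥ ((Matrix.of Y)ᵀ *ᵥ x)) ≤ B * l2 ((Matrix.of Y)ᵀ *ᵥ x) := h _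
      _ ≤ B * (B * l2 x) := by gcongr; exact hT x
      _ = _ := by ring
  have hpow : ∀ l x, l2 ((M ^ l) *ᵥ x) ≤ B ^ (2 * l) * l2 x := by
    intro l
    induction l with
    | zero => intro x; simp
    | succ l ih =>
      intro x
      rw [pow_succ, ← Matrix.mulVec_mulVec]
      calc l2 ((M ^ l) *ᵥ (M *ᵥ x)) ≤ B ^ (2 * l) * l2 (M *ᵥ x) := ih _
        _ ≤ B ^ (2 * l) * (B ^ 2 * l2 x) := by gcongr; exact hMx x
        _ = _ := by ring
  calc (M ^ k).trace = ∑ i, (M ^ k) i i := rfl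
    _ ≤ ∑ _i : Fin r, B ^ (2 * k) := by
        refine Finset.sum_le_sum fun i _ => ?_
        have h1 := abs_apply_le_l2 ((M ^ k) *ᵥ Pi.single i 1) i
        have h2 := hpow k (Pi.single i 1)
        have h3 : l2 (Pi.single i 1 : Fin r → ℝ) = 1 := by
          rw [l2_eq_sqrt]
          have : ∑ j, (Pi.single i 1 : Fin r → ℝ) j ^ 2 = 1 := by
            rw [Finset.sum_eq_single i]
            · simp
            · intro j _ hj; simp [Pi.single_eq_of_ne hj]
            · simp
          rw [this, Real.sqrt_one]
        rw [h3, mul_one] at h2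
        rw [Matrix.mulVec_single_one] at h1
        exact (le_abs_self _).trans (h1.trans (by rw [← Matrix.mulVec_single_one]; exact h2))
    _ = _ := by simp

/-- The operator norm is attained, up to a factor two, on a net. -/
lemma exists_opBound_of_net {r : ℕ} (hr : 0 < r) (Y : Fin r → Fin r → ℝ) {S : Finset (Fin r → ℝ)}
    (hS1 : ∀ z ∈ S, l2 z ≤ 1)
    (hS : ∀ x : Fin r → ℝ, l2 x ≤ 1 → ∃ z ∈ S, l2 (x - z) ≤ 1 / 4) :
    ∃ x ∈ S, ∃ y ∈ S, OpBound Y (2 * |mv Y x ⬝ᵥ y|) := by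
  have hcomp : IsCompact {x : Fin r → ℝ | l2 x = 1} := by
    refine Metric.isCompact_of_isClosed_isBounded (isClosed_eq continuous_l2 continuous_const) ?_
    refine (Metric.isBounded_closedBall (x := (0 : Fin r → ℝ)) (r := 1)).subset fun x hx => ?_
    rw [mem_closedBall_zero_iff, pi_norm_le_iff_of_nonneg zero_le_one]
    intro i
    rw [← show l2 x = 1 from hx]; exact abs_apply_le_l2 x i
  have hne : {x : Fin r → ℝ | l2 x = 1}.Nonempty := by
    obtain ⟨v, hv⟩ : ∃ v : Fin r → ℝ, v ≠ 0 :=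
      ⟨fun _ => 1, fun h => one_ne_zero (congrFun h ⟨0, hr⟩)⟩
    have hl : 0 < l2 v := lt_of_le_of_ne (l2_nonneg v) fun h => hv (l2_eq_zero.1 h.symm)
    refine ⟨(l2 v)⁻¹ • v, ?_⟩
    rw [Set.mem_ofPred_eq, l2_smul, abs_of_pos (inv_pos.2 hl), inv_mul_cancel₀ hl.ne']
  have hcont : Continuous fun x : Fin r → ℝ => l2 (mv Y x) := by
    refine continuous_l2.comp (continuous_pi fun i => ?_)
    simp only [mv, dotProduct]; fun_prop
  obtain ⟨x₀, hx₀, hmax⟩ := hcomp.exists_isMaxOn hne hcont.continuousOn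
  have hx₀ : l2 x₀ = 1 := hx₀
  set N := l2 (mv Y x₀) with hN
  have hop : OpBound Y N := opBound_of_unit fun x hx => hmax hx
  have hN0 : 0 ≤ N := l2_nonneg _
  obtain ⟨x, hxS, hx⟩ := hS x₀ hx₀.le
  set y₀ : Fin r → ℝ := N⁻¹ • mv Y x₀ with hy₀
  have hy₀1 : l2 y₀ ≤ 1 := by
    rw [hy₀, l2_smul, ← hN, abs_of_nonneg (inv_nonneg.2 hN0)]
    exact inv_mul_le_one
  obtain ⟨y, hyS, hy⟩ := hS y₀ hy₀1
  refine ⟨x, hxS, y, hyS, fun z => (hop z).trans ?_⟩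
  have hNy : mv Y x₀ ⬝ᵥ y₀ = N := by
    rw [hy₀, dotProduct_smul, dotProduct_self_eq_l2_sq, ← hN, smul_eq_mul]
    rcases hN0.eq_or_lt with h | h
    · rw [← h]; simp
    · field_simp
  -- Replacing the maximizers by net points costs `N / 4` twice, leaving at least `N / 2`.
  have e : mv Y x₀ ⬝ᵥ y₀ = mv Y x ⬝ᵥ y + mv Y (x₀ - x) ⬝ᵥ y₀ + mv Y x ⬝ᵥ (y₀ - y) := by
    rw [mv_sub, sub_dotProduct, dotProduct_sub]; ring
  have h1 : |mv Y (x₀ - x) ⬝ᵥ y₀| ≤ N / 4 := by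
    calc _ ≤ l2 (mv Y (x₀ - x)) * l2 y₀ := abs_dotProduct_le _ _
      _ ≤ (N * (1 / 4)) * 1 := by
          refine mul_le_mul ((hop _).trans (by gcongr)) hy₀1 (l2_nonneg _) (by positivity)
      _ = _ := by ring
  have h2 : |mv Y x ⬝ᵥ (y₀ - y)| ≤ N / 4 := by
    calc _ ≤ l2 (mv Y x) * l2 (y₀ - y) := abs_dotProduct_le _ _
      _ ≤ (N * 1) * (1 / 4) := by
          refine mul_le_mul ((hop _).trans ?_) hy (l2_nonneg _) (by positivity)
          gcongr; exact hS1 x hxS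
      _ = _ := by ring
  have h3 : N ≤ 2 * |mv Y x ⬝ᵥ y| := by
    have := le_abs_self (mv Y x ⬝ᵥ y)
    have := (abs_le.1 h1).2
    have := (abs_le.1 h2).2
    linarith
  gcongr
  exact l2_nonneg z

end OperatorTrace

/-! ### The reference ensemble -/

section Reference

open Matrix

/-- A centered two-point law all of whose higher moments are at least one. -/
noncomputable def refLaw : Measure ℝ := bernoulliMeasure (2 : ℝ) (-1) ⟨1 / 3, by norm_num, by norm_num⟩

instance isProbabilityMeasure_refLaw : IsProbabilityMeasure refLaw := by
  unfold refLaw; infer_instance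

lemma integral_refLaw (φ : ℝ → ℝ) : ∫ x, φ x ∂refLaw = 1 / 3 * φ 2 + 2 / 3 * φ (-1) := by
  unfold refLaw
  rw [integral_bernoulliMeasure]
  simp only [smul_eq_mul]; norm_num

lemma integrable_refLaw (φ : ℝ → ℝ) : Integrable φ refLaw := by
  unfold refLaw; exact integrable_bernoulliMeasure _ _ _ _

lemma ae_refLaw {Q : ℝ → Prop} (h2 : Q 2) (h1 : Q (-1)) : ∀ᵐ x ∂refLaw, Q x := by
  unfold refLaw
  rw [bernoulliMeasure_def, ae_add_measure_iff]
  constructor <;> refine Measure.ae_smul_measure ?_ _ <;> simpa [ae_dirac_eq]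

/-- The skewness matters: a symmetric law has vanishing odd moments, whereas the comparison needs
every moment of order at least two to be at least one. -/
lemma one_le_moment_refLaw {l : ℕ} (hl : 2 ≤ l) : 1 ≤ ∫ x, x ^ l ∂refLaw := by
  rw [integral_refLaw]
  have h1 : (4 : ℝ) ≤ 2 ^ l := by
    calc (4 : ℝ) = 2 ^ 2 := by norm_num
      _ ≤ 2 ^ l := pow_le_pow_right₀ (by norm_num) hl
  rcases Nat.even_or_odd l with h | h
  · rw [h.neg_one_pow]; linarith
  · rw [h.neg_one_pow]
    have h3 : 3 ≤ l := by rcases h with ⟨c, hc⟩; omega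
    have : (8 : ℝ) ≤ 2 ^ l := by
      calc (8 : ℝ) = 2 ^ 3 := by norm_num
        _ ≤ 2 ^ l := pow_le_pow_right₀ (by norm_num) h3
    linarith

/-- Hoeffding's lemma on an interval of length three. -/
lemma mgf_refLaw_le (t : ℝ) : ∫ x, Real.exp (t * x) ∂refLaw ≤ Real.exp (9 / 8 * t ^ 2) := by
  have h := hasSubgaussianMGF_of_mem_Icc_of_integral_eq_zero (μ := refLaw) (X := fun x => x)
    (a := -1) (b := 2) (by fun_prop) (ae_refLaw (by norm_num) (by norm_num))
    (by rw [integral_refLaw]; norm_num)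
  have := h.mgf_le t
  rw [mgf] at this
  refine this.trans (Real.exp_le_exp.2 (le_of_eq ?_))
  push_cast
  norm_num
  ring

variable {r : ℕ}

lemma exp_mv_dotProduct (Y : Fin r → Fin r → ℝ) (x y : Fin r → ℝ) (t : ℝ) :
    Real.exp (t * (mv Y x ⬝ᵥ y)) = ∏ i, ∏ j, Real.exp (t * (y i * x j) * Y i j) := by
  simp_rw [← Real.exp_sum]
  congr 1
  simp only [mv, dotProduct, Finset.sum_mul, Finset.mul_sum]
  refine Finset.sum_congr rfl fun i _ => Finset.sum_congr rfl fun j _ => by ring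

lemma integral_exp_mv_refLaw_le {x y : Fin r → ℝ} (hx : l2 x ≤ 1) (hy : l2 y ≤ 1) (t : ℝ) :
    Integrable (fun Y => Real.exp (t * (mv Y x ⬝ᵥ y))) (matLaw refLaw (Fin r) (Fin r)) ∧
    ∫ Y, Real.exp (t * (mv Y x ⬝ᵥ y)) ∂(matLaw refLaw (Fin r) (Fin r))
      ≤ Real.exp (9 / 8 * t ^ 2) := by
  simp_rw [exp_mv_dotProduct]
  unfold matLaw
  constructor
  · refine Integrable.fintype_prod (f := fun i (z : Fin r → ℝ) =>
      ∏ j, Real.exp (t * (y i * x j) * z j)) fun i => ?_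
    exact Integrable.fintype_prod (f := fun j (z : ℝ) => Real.exp (t * (y i * x j) * z))
      fun j => integrable_refLaw _
  · rw [integral_fintype_prod_eq_prod (f := fun i (z : Fin r → ℝ) =>
      ∏ j, Real.exp (t * (y i * x j) * z j))]
    simp_rw [fun i => integral_fintype_prod_eq_prod (μ := fun _ : Fin r => refLaw)
      (f := fun j (z : ℝ) => Real.exp (t * (y i * x j) * z))]
    calc ∏ i, ∏ j, ∫ z, Real.exp (t * (y i * x j) * z) ∂refLaw
        ≤ ∏ i, ∏ j, Real.exp (9 / 8 * (t * (y i * x j)) ^ 2) := by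
          refine Finset.prod_le_prod (fun i _ => Finset.prod_nonneg fun j _ =>
            integral_nonneg fun z => (Real.exp_pos _).le) fun i _ => ?_
          exact Finset.prod_le_prod (fun j _ => integral_nonneg fun z => (Real.exp_pos _).le)
            fun j _ => mgf_refLaw_le _
      _ = Real.exp (9 / 8 * t ^ 2 * (l2 y ^ 2 * l2 x ^ 2)) := by
          simp_rw [← Real.exp_sum]
          congr 1
          rw [l2_sq, l2_sq, Finset.sum_mul_sum, Finset.mul_sum]
          refine Finset.sum_congr rfl fun i _ => ?_
          rw [Finset.mul_sum]
          refine Finset.sum_congr rfl fun j _ => by ring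
      _ ≤ _ := by
          apply Real.exp_le_exp.2
          have h1 : l2 y ^ 2 ≤ 1 := pow_le_one₀ (l2_nonneg y) hy
          have h2 : l2 x ^ 2 ≤ 1 := pow_le_one₀ (l2_nonneg x) hx
          have h3 : l2 y ^ 2 * l2 x ^ 2 ≤ 1 := mul_le_one₀ h1 (sq_nonneg _) h2
          have : 0 ≤ 9 / 8 * t ^ 2 := by positivity
          nlinarith

/-- The subgaussian moment generating function bounds the `2K`-th moment; `t = √K` balances `(2K)! /
t ^ (2K)` against `exp (9 t² / 8)`. -/
lemma integral_mv_pow_refLaw_le {x y : Fin r → ℝ} (hx : l2 x ≤ 1) (hy : l2 y ≤ 1) {K : ℕ}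
    (hK : 0 < K) :
    Integrable (fun Y => (mv Y x ⬝ᵥ y) ^ (2 * K)) (matLaw refLaw (Fin r) (Fin r)) ∧
    ∫ Y, (mv Y x ⬝ᵥ y) ^ (2 * K) ∂(matLaw refLaw (Fin r) (Fin r)) ≤ 2 * (16 * K) ^ K := by
  have hK0 : (0 : ℝ) < K := by exact_mod_cast hK
  set t : ℝ := √K with ht
  have ht0 : 0 < t := by positivity
  have ht2 : t ^ 2 = K := Real.sq_sqrt hK0.le
  obtain ⟨hi1, hb1⟩ := integral_exp_mv_refLaw_le hx hy t
  obtain ⟨hi2, hb2⟩ := integral_exp_mv_refLaw_le hx hy (-t)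
  rw [neg_sq] at hb2
  rw [ht2] at hb1 hb2
  set c : ℝ := (2 * K).factorial / t ^ (2 * K) with hc
  have hc0 : 0 ≤ c := by positivity
  have hpt : ∀ Z : ℝ, Z ^ (2 * K) ≤ c * (Real.exp (t * Z) + Real.exp (-t * Z)) := by
    intro Z
    have h1 := Real.pow_div_factorial_le_exp _ (abs_nonneg (t * Z)) (2 * K)
    rw [abs_mul, mul_pow, abs_of_pos ht0, (even_two_mul K).pow_abs] at h1
    have h2 : Real.exp (t * |Z|) ≤ Real.exp (t * Z) + Real.exp (-t * Z) := by
      have := Real.exp_pos (t * Z)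
      have := Real.exp_pos (-t * Z)
      rcases abs_cases Z with ⟨h, -⟩ | ⟨h, -⟩ <;> rw [h]
      · linarith
      · rw [mul_neg, ← neg_mul]; linarith
    rw [div_le_iff₀ (by positivity)] at h1
    rw [hc, div_mul_eq_mul_div, le_div_iff₀ (by positivity)]
    calc Z ^ (2 * K) * t ^ (2 * K) = t ^ (2 * K) * Z ^ (2 * K) := mul_comm _ _
      _ ≤ Real.exp (t * |Z|) * (2 * K).factorial := h1
      _ ≤ (Real.exp (t * Z) + Real.exp (-t * Z)) * (2 * K).factorial := by gcongr
      _ = _ := mul_comm _ _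
  have hi3 : Integrable (fun Y : Fin r → Fin r → ℝ => c * (Real.exp (t * (mv Y x ⬝ᵥ y)) +
      Real.exp (-t * (mv Y x ⬝ᵥ y)))) (matLaw refLaw (Fin r) (Fin r)) := (hi1.add hi2).const_mul c
  have hInt : Integrable (fun Y => (mv Y x ⬝ᵥ y) ^ (2 * K)) (matLaw refLaw (Fin r) (Fin r)) := by
    refine hi3.mono' ?_ (Filter.Eventually.of_forall fun Y => ?_)
    · refine Measurable.aestronglyMeasurable ?_
      simp only [mv, dotProduct]; fun_prop
    · rw [Real.norm_eq_abs, abs_of_nonneg ((even_two_mul K).pow_nonneg _)]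
      exact hpt _
  refine ⟨hInt, ?_⟩
  calc ∫ Y, (mv Y x ⬝ᵥ y) ^ (2 * K) ∂(matLaw refLaw (Fin r) (Fin r))
      ≤ ∫ Y, c * (Real.exp (t * (mv Y x ⬝ᵥ y)) + Real.exp (-t * (mv Y x ⬝ᵥ y)))
        ∂(matLaw refLaw (Fin r) (Fin r)) := integral_mono hInt hi3 fun Y => hpt _
    _ ≤ c * (2 * Real.exp (9 / 8 * K)) := by
        rw [integral_const_mul, integral_add hi1 hi2]
        gcongr; linarith
    _ ≤ ((2 * K : ℕ) : ℝ) ^ (2 * K) / t ^ (2 * K) * (2 * 4 ^ K) := by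
        have h1 : ((2 * K).factorial : ℝ) ≤ ((2 * K : ℕ) : ℝ) ^ (2 * K) := by
          exact_mod_cast Nat.factorial_le_pow (2 * K)
        have h2 : Real.exp (9 / 8 * K) ≤ 4 ^ K := by
          rw [mul_comm, Real.exp_nat_mul]
          gcongr
          have h3 := Real.exp_bound_div_one_sub_of_interval (x := 1 / 8) (by norm_num) (by norm_num)
          have h4 := Real.exp_one_lt_d9
          calc Real.exp (9 / 8) = Real.exp 1 * Real.exp (1 / 8) := by
                rw [← Real.exp_add]; norm_num
            _ ≤ 2.7182818286 * (1 / (1 - 1 / 8)) := by gcongr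
            _ ≤ 4 := by norm_num
        rw [hc]; gcongr
    _ = 2 * (16 * K) ^ K := by
        rw [pow_mul, pow_mul t, ht2]
        push_cast
        rw [← div_pow, mul_comm, mul_assoc, ← mul_pow]
        congr 2
        field_simp; norm_num

/-- A moment bound for the traces of the reference ensemble. -/
lemma integral_trace_refLaw_le {K : ℕ} (hK : 0 < K) :
    ∫ Y : Fin (2 * K) → Fin (2 * K) → ℝ, ((Matrix.of Y * (Matrix.of Y)ᵀ) ^ K).trace
        ∂(matLaw refLaw (Fin (2 * K)) (Fin (2 * K)))
      ≤ 4 * K * (1327104 * K) ^ K := by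
  set P := matLaw refLaw (Fin (2 * K)) (Fin (2 * K))
  obtain ⟨S, hcard, hS1, hS⟩ := exists_net_supported (Finset.univ : Finset (Fin (2 * K)))
    (ε := 1 / 4) (by norm_num) (by norm_num)
  -- A `1/4`-net in dimension `2K` has at most `12 ^ (2K)` points. Pairs of points then give `144² *
  -- 4 * 16 = 1327104` per power.
  have hScard : (S.card : ℝ) ≤ 144 ^ K := by
    refine hcard.trans_eq ?_
    rw [Finset.card_univ, Fintype.card_fin, pow_mul]; norm_num
  have hS' : ∀ x : Fin (2 * K) → ℝ, l2 x ≤ 1 → ∃ z ∈ S, l2 (x - z) ≤ 1 / 4 := fun x hx =>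
    hS x hx fun j hj => absurd (Finset.mem_univ j) hj
  have hpt : ∀ Y : Fin (2 * K) → Fin (2 * K) → ℝ, ((Matrix.of Y * (Matrix.of Y)ᵀ) ^ K).trace ≤
      ∑ x ∈ S, ∑ y ∈ S, (2 * K * 4 ^ K) * (mv Y x ⬝ᵥ y) ^ (2 * K) := by
    intro Y
    obtain ⟨x, hx, y, hy, hop⟩ := exists_opBound_of_net (by omega) Y hS1 hS'
    refine (trace_pow_le_of_opBound Y (by positivity) hop K).trans ?_
    have e : ((2 * K : ℕ) : ℝ) * (2 * |mv Y x ⬝ᵥ y|) ^ (2 * K)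
        = (2 * K * 4 ^ K) * (mv Y x ⬝ᵥ y) ^ (2 * K) := by
      rw [mul_pow, (even_two_mul K).pow_abs, pow_mul 2]; push_cast; norm_num; ring
    rw [e]
    have hnn : ∀ x y, 0 ≤ (2 * K * 4 ^ K) * (mv Y x ⬝ᵥ y) ^ (2 * K) := fun x y => by
      have := (even_two_mul K).pow_nonneg (mv Y x ⬝ᵥ y)
      positivity
    refine le_trans ?_ (Finset.single_le_sum (f := fun x => ∑ y ∈ S, (2 * K * 4 ^ K) *
      (mv Y x ⬝ᵥ y) ^ (2 * K)) (fun x _ => Finset.sum_nonneg fun y _ => hnn x y) hx)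
    exact Finset.single_le_sum (f := fun y => (2 * K * 4 ^ K) * (mv Y x ⬝ᵥ y) ^ (2 * K))
      (fun y _ => hnn x y) hy
  have hi : ∀ x ∈ S, ∀ y ∈ S,
      Integrable (fun Y => (2 * K * 4 ^ K : ℝ) * (mv Y x ⬝ᵥ y) ^ (2 * K)) P :=
    fun x hx y hy => (integral_mv_pow_refLaw_le (hS1 x hx) (hS1 y hy) hK).1.const_mul _
  obtain ⟨k, rfl⟩ : ∃ k, K = k + 1 := ⟨K - 1, by omega⟩
  calc ∫ Y, ((Matrix.of Y * (Matrix.of Y)ᵀ) ^ (k + 1)).trace ∂P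
      ≤ ∫ Y, ∑ x ∈ S, ∑ y ∈ S, (2 * ((k + 1 : ℕ) : ℝ) * 4 ^ (k + 1)) * (mv Y x ⬝ᵥ y) ^ (2 * (k + 1)) ∂P := by
        refine integral_mono ?_ (integrable_finsetSum _ fun x hx => integrable_finsetSum _
          fun y hy => hi x hx y hy) hpt
        exact (integral_trace_pow refLaw (T := fun x => x) measurable_id
          (C := 2) (ae_refLaw (by norm_num) (by norm_num)) k).1
    _ = ∑ x ∈ S, ∑ y ∈ S, (2 * ((k + 1 : ℕ) : ℝ) * 4 ^ (k + 1)) *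
          ∫ Y, (mv Y x ⬝ᵥ y) ^ (2 * (k + 1)) ∂P := by
        rw [integral_finsetSum _ fun x hx => integrable_finsetSum _ fun y hy => hi x hx y hy]
        refine Finset.sum_congr rfl fun x hx => ?_
        rw [integral_finsetSum _ fun y hy => hi x hx y hy]
        exact Finset.sum_congr rfl fun y _ => integral_const_mul _ _
    _ ≤ ∑ x ∈ S, ∑ y ∈ S, (2 * ((k + 1 : ℕ) : ℝ) * 4 ^ (k + 1)) *
          (2 * (16 * ((k + 1 : ℕ) : ℝ)) ^ (k + 1)) := by
        refine Finset.sum_le_sum fun x hx => Finset.sum_le_sum fun y hy => ?_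
        gcongr
        exact (integral_mv_pow_refLaw_le (hS1 x hx) (hS1 y hy) hK).2
    _ = (S.card : ℝ) * S.card * ((2 * ((k + 1 : ℕ) : ℝ) * 4 ^ (k + 1)) *
          (2 * (16 * ((k + 1 : ℕ) : ℝ)) ^ (k + 1))) := by
        simp only [Finset.sum_const, nsmul_eq_mul]; ring
    _ ≤ 144 ^ (k + 1) * 144 ^ (k + 1) * ((2 * ((k + 1 : ℕ) : ℝ) * 4 ^ (k + 1)) *
          (2 * (16 * ((k + 1 : ℕ) : ℝ)) ^ (k + 1))) := by gcongr
    _ = 4 * ((k + 1 : ℕ) : ℝ) * (144 * 144 * 4 * (16 * ((k + 1 : ℕ) : ℝ))) ^ (k + 1) := by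
        simp only [mul_pow]; ring
    _ = _ := by
        congr 2; ring

end Reference

/-! ### The operator norm of the random matrix -/

section TruncatedNorm

variable {ν : Measure ℝ} [IsProbabilityMeasure ν] {T : ℝ → ℝ} {a b : ℝ} {n : ℕ}

open Matrix in
lemma trace_mul_transpose_pow_nonneg {ι J : Type*} [Fintype ι] [DecidableEq ι] [Fintype J]
    (X : Matrix ι J ℝ) (k : ℕ) : 0 ≤ ((X * Xᵀ) ^ k).trace := by
  have h := Matrix.posSemidef_self_mul_conjTranspose X
  rw [Matrix.conjTranspose_eq_transpose_of_trivial] at h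
  exact (h.pow k).trace_nonneg

lemma abs_integral_pow_le (hT : Measurable T) (hb : ∀ᵐ x ∂ν, |T x| ≤ b)
    (hsq : ∫ x, T x ^ 2 ∂ν ≤ a) {l : ℕ} (hl : 2 ≤ l) :
    |∫ x, T x ^ l ∂ν| ≤ a * b ^ (l - 2) := by
  have hb0 : 0 ≤ b := by
    obtain ⟨x, hx⟩ := hb.exists
    exact (abs_nonneg _).trans hx
  have hi : Integrable (fun x => T x ^ 2) ν := by
    refine Integrable.of_bound (hT.pow_const 2).aestronglyMeasurable (b ^ 2) ?_
    filter_upwards [hb] with x hx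
    rw [norm_pow, Real.norm_eq_abs]
    gcongr
  calc |∫ x, T x ^ l ∂ν| ≤ ∫ x, T x ^ 2 * b ^ (l - 2) ∂ν := by
        rw [← Real.norm_eq_abs]
        refine norm_integral_le_of_norm_le (hi.mul_const _) ?_
        filter_upwards [hb] with x hx
        rw [norm_pow, Real.norm_eq_abs]
        calc |T x| ^ l = |T x| ^ 2 * |T x| ^ (l - 2) := by rw [← pow_add]; congr 1; omega
          _ ≤ T x ^ 2 * b ^ (l - 2) := by rw [sq_abs]; gcongr
    _ = (∫ x, T x ^ 2 ∂ν) * b ^ (l - 2) := integral_mul_const _ _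
    _ ≤ a * b ^ (l - 2) := by gcongr

-- The walk comparison followed by the reference bound: the factor `K * K ^ K` of the latter is
-- absorbed by the `(K + 1) ^ (K + 1)` in the denominator of the former.
open Matrix in
lemma integral_trace_pow_le (hT : Measurable T) (hb : ∀ᵐ x ∂ν, |T x| ≤ b)
    (hmean : ∫ x, T x ∂ν = 0) (hsq : ∫ x, T x ^ 2 ∂ν ≤ a) {K : ℕ} (hK : 0 < K)
    (hbP : b ^ 2 * (K + 1) ≤ n * a) (hKn : K + 1 ≤ n) :
    Integrable (fun X : Fin n → Fin n → ℝ => ((Matrix.of (fun i j => T (X i j)) *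
      (Matrix.of fun i j => T (X i j))ᵀ) ^ K).trace) (matLaw ν (Fin n) (Fin n)) ∧
    ∫ X : Fin n → Fin n → ℝ, ((Matrix.of (fun i j => T (X i j)) *
      (Matrix.of fun i j => T (X i j))ᵀ) ^ K).trace ∂(matLaw ν (Fin n) (Fin n))
      ≤ 4 * n * (1327104 * (n * a)) ^ K := by
  have href := integral_trace_refLaw_le hK
  obtain ⟨k, rfl⟩ : ∃ k, K = k + 1 := ⟨K - 1, by omega⟩
  have ha : 0 ≤ a := (integral_nonneg fun _ => sq_nonneg _).trans hsq
  have h1 := integral_trace_pow (ι := Fin n) (J := Fin n) ν hT hb k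
  refine ⟨h1.1, ?_⟩
  rw [h1.2]
  have h2 := (integral_trace_pow (ι := Fin (2 * (k + 1))) (J := Fin (2 * (k + 1))) refLaw
    (T := fun x => x) measurable_id (C := 2) (ae_refLaw (by norm_num) (by norm_num)) k).2
  rw [h2] at href
  have h3 := sum_walkWeight_le (n := n) (k := k) (m := fun l => ∫ x, T x ^ l ∂ν)
    (m' := fun l => ∫ x, x ^ l ∂refLaw) (by simp) (by simpa using hmean) ha
    (fun l hl => abs_integral_pow_le hT hb hsq hl) (by simp) (by norm_num [integral_refLaw])
    (fun l hl => one_le_moment_refLaw hl) (by push_cast at hbP; linarith) (by omega)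
  refine h3.trans ?_
  calc _ ≤ (n : ℝ) * (n * a) ^ (k + 1) / ((k : ℝ) + 2) ^ (k + 2) *
        (4 * ((k + 1 : ℕ) : ℝ) * (1327104 * ((k + 1 : ℕ) : ℝ)) ^ (k + 1)) := by gcongr
    _ = 4 * n * (1327104 * (n * a)) ^ (k + 1) *
        (((k + 1 : ℕ) : ℝ) ^ (k + 2) / ((k : ℝ) + 2) ^ (k + 2)) := by
        simp only [mul_pow, pow_succ]; ring
    _ ≤ 4 * n * (1327104 * (n * a)) ^ (k + 1) * 1 := by
        gcongr
        refine div_le_one_of_le₀ ?_ (by positivity)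
        push_cast
        gcongr
        linarith
    _ = _ := mul_one _

/-- Markov's inequality for the trace of a high power; the extra factor `exp 1` in the level
produces a decay that beats `4 n` once the power exceeds a multiple of `log n`. -/
lemma measureReal_not_opBound_le (hT : Measurable T) (hb : ∀ᵐ x ∂ν, |T x| ≤ b)
    (hmean : ∫ x, T x ∂ν = 0) (hsq : ∫ x, T x ^ 2 ∂ν ≤ a) (ha : 0 < a) {j : ℕ}
    (hbP : b ^ 2 * (2 ^ (j + 1) + 1) ≤ n * a) (hKn : 2 ^ (j + 1) + 1 ≤ n) :
    (matLaw ν (Fin n) (Fin n)).real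
      {X | ¬ OpBound (fun i j => T (X i j)) √(Real.exp 1 * (1327104 * (n * a)))}
      ≤ 4 * n * Real.exp (-2 ^ (j + 1)) := by
  have hn : (0 : ℝ) < n := by
    have : 0 < n := (Nat.succ_pos _).trans_le hKn
    exact_mod_cast this
  obtain ⟨hi, hle⟩ := integral_trace_pow_le (n := n) hT hb hmean hsq (K := 2 ^ (j + 1))
    (by positivity) (by push_cast; exact hbP) hKn
  set P : ℝ := 1327104 * (n * a) with hP
  have hP0 : 0 < P := by positivity
  have h1 := mul_meas_ge_le_integral_of_nonneg (Filter.Eventually.of_forall fun X =>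
    trace_mul_transpose_pow_nonneg _ _) hi ((Real.exp 1 * P) ^ 2 ^ (j + 1))
  have h2 := h1.trans hle
  have hsub : {X : Fin n → Fin n → ℝ | ¬ OpBound (fun i j => T (X i j)) √(Real.exp 1 * P)} ⊆
      {X | (Real.exp 1 * P) ^ 2 ^ (j + 1) ≤ ((Matrix.of (fun i j => T (X i j)) *
      (Matrix.of fun i j => T (X i j)).transpose) ^ 2 ^ (j + 1)).trace} := by
    intro X hX
    by_contra hlt
    rw [Set.mem_ofPred_eq, not_le] at hlt
    refine hX (opBound_of_trace_le _ (Real.sqrt_nonneg _) j ?_)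
    rw [Real.sq_sqrt (by positivity)]
    exact hlt.le
  refine (measureReal_mono hsub).trans ?_
  have h3 : Real.exp (-2 ^ (j + 1)) = (Real.exp 1 ^ 2 ^ (j + 1))⁻¹ := by
    rw [← Real.exp_nat_mul, ← Real.exp_neg]; push_cast; ring_nf
  rw [h3, ← div_eq_mul_inv, le_div_iff₀ (by positivity)]
  refine le_of_mul_le_mul_right ?_ (show 0 < P ^ 2 ^ (j + 1) by positivity)
  rw [mul_pow] at h2
  calc _ = _ := by ring_nf
    _ ≤ _ := h2

end TruncatedNorm

/-! ### Union bounds for large entries -/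

section Entries

variable {ν : Measure ℝ} [IsProbabilityMeasure ν]

lemma matLaw_real_forall_mem {ι J : Type*} [Fintype ι] [Fintype J] [DecidableEq ι] [DecidableEq J]
    (S : Set ℝ) (E : Finset (ι × J)) :
    (matLaw ν ι J).real {X | ∀ e ∈ E, X e.1 e.2 ∈ S} = ν.real S ^ E.card := by
  have h1 : {X : ι → J → ℝ | ∀ e ∈ E, X e.1 e.2 ∈ S} = Set.univ.pi fun i => Set.univ.pi fun j =>
      if (i, j) ∈ E then S else Set.univ := by
    ext X
    simp only [Set.mem_ofPred_eq, Set.mem_pi, Set.mem_univ, true_implies, Prod.forall]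
    refine forall_congr' fun i => forall_congr' fun j => ?_
    split_ifs with h <;> simp [h]
  rw [h1, Measure.real, matLaw, Measure.pi_pi]
  simp_rw [Measure.pi_pi]
  rw [← Finset.prod_product', ENNReal.toReal_prod, Finset.univ_product_univ]
  have h2 : ∀ e : ι × J, (ν (if (e.1, e.2) ∈ E then S else Set.univ)).toReal =
      if e ∈ E then ν.real S else 1 := by
    intro e
    rw [Prod.mk.eta]
    split_ifs <;> simp [Measure.real]
  simp_rw [h2]
  rw [Finset.prod_ite_mem, Finset.univ_inter, Finset.prod_const]

lemma measureReal_exists_mem_le {n : ℕ} (S : Set ℝ) :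
    (matLaw ν (Fin n) (Fin n)).real {X | ∃ i j, X i j ∈ S} ≤ n ^ 2 * ν.real S := by
  have h1 : {X : Fin n → Fin n → ℝ | ∃ i j, X i j ∈ S} = ⋃ e : Fin n × Fin n,
      {X | ∀ e' ∈ ({e} : Finset (Fin n × Fin n)), X e'.1 e'.2 ∈ S} := by
    ext X; simp
  rw [h1]
  refine (measureReal_iUnion_fintype_le _).trans ?_
  simp_rw [matLaw_real_forall_mem]
  simp [sq]

lemma measureReal_exists_pair_row_le {n : ℕ} (S : Set ℝ) :
    (matLaw ν (Fin n) (Fin n)).real {X | ∃ i j k, j ≠ k ∧ X i j ∈ S ∧ X i k ∈ S}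
      ≤ n ^ 3 * ν.real S ^ 2 := by
  have h1 : {X : Fin n → Fin n → ℝ | ∃ i j k, j ≠ k ∧ X i j ∈ S ∧ X i k ∈ S} ⊆
      ⋃ t : Fin n × Fin n × Fin n, {X | t.2.1 ≠ t.2.2 ∧
        ∀ e ∈ ({(t.1, t.2.1), (t.1, t.2.2)} : Finset (Fin n × Fin n)), X e.1 e.2 ∈ S} := by
    rintro X ⟨i, j, k, h, h1, h2⟩
    refine Set.mem_iUnion.2 ⟨(i, j, k), h, ?_⟩
    simp [h1, h2]
  refine (measureReal_mono h1).trans ((measureReal_iUnion_fintype_le _).trans ?_)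
  refine (Finset.sum_le_card_nsmul _ _ (ν.real S ^ 2) fun t _ => ?_).trans_eq ?_
  · by_cases h : t.2.1 = t.2.2
    · simp [h]
    · simp only [ne_eq, h, not_false_eq_true, true_and]
      rw [matLaw_real_forall_mem, Finset.card_pair (by simpa using h)]
  · simp only [Finset.card_univ, Fintype.card_prod, Fintype.card_fin, nsmul_eq_mul]
    push_cast; ring

lemma measureReal_exists_pair_col_le {n : ℕ} (S : Set ℝ) :
    (matLaw ν (Fin n) (Fin n)).real {X | ∃ i j k, j ≠ k ∧ X j i ∈ S ∧ X k i ∈ S}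
      ≤ n ^ 3 * ν.real S ^ 2 := by
  have h1 : {X : Fin n → Fin n → ℝ | ∃ i j k, j ≠ k ∧ X j i ∈ S ∧ X k i ∈ S} ⊆
      ⋃ t : Fin n × Fin n × Fin n, {X | t.2.1 ≠ t.2.2 ∧
        ∀ e ∈ ({(t.2.1, t.1), (t.2.2, t.1)} : Finset (Fin n × Fin n)), X e.1 e.2 ∈ S} := by
    rintro X ⟨i, j, k, h, h1, h2⟩
    refine Set.mem_iUnion.2 ⟨(i, j, k), h, ?_⟩
    simp [h1, h2]
  refine (measureReal_mono h1).trans ((measureReal_iUnion_fintype_le _).trans ?_)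
  refine (Finset.sum_le_card_nsmul _ _ (ν.real S ^ 2) fun t _ => ?_).trans_eq ?_
  · by_cases h : t.2.1 = t.2.2
    · simp [h]
    · simp only [ne_eq, h, not_false_eq_true, true_and]
      rw [matLaw_real_forall_mem, Finset.card_pair (by simpa using h)]
  · simp only [Finset.card_univ, Fintype.card_prod, Fintype.card_fin, nsmul_eq_mul]
    push_cast; ring

end Entries

/-! ### Deterministic operator norm bounds -/

section DeterministicNorm

variable {ι J : Type*} [Fintype ι] [Fintype J]

lemma OpBound.add {B C : ι → J → ℝ} {K L : ℝ} (hB : OpBound B K) (hC : OpBound C L) :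
    OpBound (B + C) (K + L) := fun x => by
  rw [mv_add_left, add_mul]
  exact (l2_add_le _ _).trans (add_le_add (hB x) (hC x))

lemma OpBound.mono {B : ι → J → ℝ} {K L : ℝ} (hB : OpBound B K) (h : K ≤ L) : OpBound B L :=
  fun x => (hB x).trans (mul_le_mul_of_nonneg_right h (l2_nonneg x))

lemma sum_sq_le_of_unique {ι : Type*} [Fintype ι] (f : ι → ℝ) {L : ℝ}
    (hf : ∀ j k, f j ≠ 0 → f k ≠ 0 → j = k) (hL : ∀ j, |f j| ≤ L) : ∑ j, f j ^ 2 ≤ L ^ 2 := by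
  by_cases h : ∃ j, f j ≠ 0
  · obtain ⟨j, hj⟩ := h
    rw [Finset.sum_eq_single j (fun k _ hk => ?_) (by simp)]
    · rw [← sq_abs]
      exact pow_le_pow_left₀ (abs_nonneg _) (hL j) 2
    · by_contra h0
      exact hk (hf k j (fun h => h0 (by rw [h]; simp)) hj)
  · push Not at h
    simp [h]; positivity

/-- With at most one nonzero entry per row and column, distinct coordinates do not interact and the
norm is that of the largest entry. -/
lemma opBound_of_unique {B : ι → J → ℝ} {L : ℝ} (hL : 0 ≤ L)
    (hrow : ∀ i j k, B i j ≠ 0 → B i k ≠ 0 → j = k)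
    (hcol : ∀ j i k, B i j ≠ 0 → B k j ≠ 0 → i = k) (hB : ∀ i j, |B i j| ≤ L) : OpBound B L := by
  intro x
  refine l2_le_of_sq_le (mul_nonneg hL (l2_nonneg x)) ?_
  have h1 : ∀ i, mv B x i ^ 2 = ∑ j, B i j ^ 2 * x j ^ 2 := by
    intro i
    simp only [mv, dotProduct]
    by_cases h : ∃ j, B i j ≠ 0
    · obtain ⟨j, hj⟩ := h
      have h0 : ∀ k, k ≠ j → B i k = 0 := fun k hk => by
        by_contra h0; exact hk (hrow i k j h0 hj)
      rw [Finset.sum_eq_single j (fun k _ hk => by simp [h0 k hk]) (by simp),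
        Finset.sum_eq_single j (fun k _ hk => by simp [h0 k hk]) (by simp), mul_pow]
    · push Not at h
      simp [h]
  simp_rw [h1]
  rw [Finset.sum_comm, mul_pow, l2_sq, Finset.mul_sum]
  refine Finset.sum_le_sum fun j _ => ?_
  rw [← Finset.sum_mul]
  exact mul_le_mul_of_nonneg_right
    (sum_sq_le_of_unique _ (fun i k => hcol j i k) fun i => hB i j) (sq_nonneg _)

lemma opBound_const (n : ℕ) (m : ℝ) : OpBound (fun (_ _ : Fin n) => m) (n * |m|) := by
  intro x
  refine l2_le_of_sq_le (by have := l2_nonneg x; positivity) ?_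
  have h1 : ∀ i : Fin n, mv (fun (_ _ : Fin n) => m) x i ^ 2 ≤ n * m ^ 2 * l2 x ^ 2 := by
    intro i
    simp only [mv, dotProduct]
    rw [← Finset.mul_sum, mul_pow, l2_sq]
    have := sq_sum_le_card_mul_sum_sq (s := Finset.univ) (f := x)
    rw [Finset.card_univ, Fintype.card_fin] at this
    nlinarith [sq_nonneg m]
  refine (Finset.sum_le_sum fun i _ => h1 i).trans_eq ?_
  rw [Finset.sum_const, Finset.card_univ, Fintype.card_fin, nsmul_eq_mul, mul_pow, mul_pow, sq_abs]
  ring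

end DeterministicNorm

/-! ### Entry laws with a finite moment of order `q` -/

/-- The properties of the law of a product of a Bernoulli variable of parameter `p` and an
independent centered variable with variance at least one and absolute `q`-th moment at most `M`. -/
structure EntryLaw (q M p : ℝ) (ν : Measure ℝ) : Prop where
  isProb : IsProbabilityMeasure ν
  p_pos : 0 < p
  p_le_one : p ≤ 1
  support_le : ν.real {0}ᶜ ≤ p
  integrable_rpow : Integrable (fun x => |x| ^ q) ν
  rpow_le : ∫ x, |x| ^ q ∂ν ≤ p * M
  centered : ∫ x, x ∂ν = 0
  le_sq : p ≤ ∫ x, x ^ 2 ∂ν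

namespace EntryLaw

variable {q M p : ℝ} {ν : Measure ℝ}

lemma integrable_indicator_ne (hν : EntryLaw q M p ν) :
    Integrable (({0}ᶜ : Set ℝ).indicator fun _ => (1 : ℝ)) ν := by
  have := hν.isProb
  exact (integrable_const 1).indicator (measurableSet_singleton 0).compl

/-- The indicator keeps the factor `p` in every lower moment; Hölder's inequality between moments
alone would lose part of it. -/
lemma pow_le_indicator_add {q : ℝ} {r : ℕ} (hr : 0 < r) (hrq : (r : ℝ) ≤ q) (x : ℝ) :
    |x| ^ r ≤ ({0}ᶜ : Set ℝ).indicator (fun _ => (1 : ℝ)) x + |x| ^ q := by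
  by_cases hx : x = 0
  · subst hx
    have : (0 : ℝ) ≤ |(0 : ℝ)| ^ q := by positivity
    rw [abs_zero, zero_pow hr.ne']
    rw [abs_zero] at this
    simpa using this
  · rw [Set.indicator_of_mem (by simpa using hx)]
    rcases le_total |x| 1 with h | h
    · have h1 : |x| ^ r ≤ 1 := pow_le_one₀ (abs_nonneg _) h
      have h2 : (0 : ℝ) ≤ |x| ^ q := by positivity
      linarith
    · rw [← Real.rpow_natCast]
      have := Real.rpow_le_rpow_of_exponent_le h hrq
      linarith

lemma moment (hν : EntryLaw q M p ν) {r : ℕ} (hr : 0 < r) (hrq : (r : ℝ) ≤ q) :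
    Integrable (fun x => |x| ^ r) ν ∧ ∫ x, |x| ^ r ∂ν ≤ p * (1 + M) := by
  have hi := hν.integrable_indicator_ne.add hν.integrable_rpow
  have h1 : Integrable (fun x => |x| ^ r) ν := by
    refine hi.mono' (by fun_prop) (Filter.Eventually.of_forall fun x => ?_)
    rw [Real.norm_eq_abs, abs_of_nonneg (by positivity)]
    exact pow_le_indicator_add hr hrq x
  refine ⟨h1, (integral_mono h1 hi fun x => pow_le_indicator_add hr hrq x).trans ?_⟩
  have h2 := integral_add hν.integrable_indicator_ne hν.integrable_rpow
  rw [integral_indicator (measurableSet_singleton 0).compl] at h2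
  simp only [integral_const, MeasurableSet.univ, measureReal_restrict_apply, Set.univ_inter,
    smul_eq_mul, mul_one] at h2
  have h3 := hν.support_le
  have h4 := hν.rpow_le
  simp only [Pi.add_apply]
  rw [h2]; linarith

lemma nonneg (hν : EntryLaw q M p ν) : 0 ≤ M := by
  have h1 : 0 ≤ ∫ x, |x| ^ q ∂ν := integral_nonneg fun x => by positivity
  exact nonneg_of_mul_nonneg_right (h1.trans hν.rpow_le) hν.p_pos

lemma centeredLaw (hν : EntryLaw q M p ν) (hq : 3 ≤ q) : CenteredLaw (1 + M) p ν where
  isProb := hν.isProb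
  p_pos := hν.p_pos
  p_le_one := hν.p_le_one
  one_le := by have := hν.nonneg; linarith
  integrable_id := by
    have h := (hν.moment (r := 1) one_pos (by norm_num; linarith)).1
    simp only [pow_one] at h
    exact (integrable_norm_iff (by fun_prop)).1 h
  integrable_sq := by
    simpa using (hν.moment (r := 2) two_pos (by norm_num; linarith)).1
  integrable_cube := (hν.moment (r := 3) three_pos (by norm_num; linarith)).1
  centered := hν.centered
  le_sq := hν.le_sq
  sq_le := by
    simpa using (hν.moment (r := 2) two_pos (by norm_num; linarith)).2
  cube_le := (hν.moment (r := 3) three_pos (by norm_num; linarith)).2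

lemma measureReal_lt_abs_le (hν : EntryLaw q M p ν) (hq : 0 < q) {t : ℝ} (ht : 0 < t) :
    ν.real {x | t < |x|} ≤ p * M * t ^ (-q) := by
  have := hν.isProb
  have h1 := mul_meas_ge_le_integral_of_nonneg (Filter.Eventually.of_forall fun x => by positivity)
    hν.integrable_rpow (t ^ q)
  have h2 : {x : ℝ | t < |x|} ⊆ {x | t ^ q ≤ |x| ^ q} := fun x hx =>
    Real.rpow_le_rpow ht.le (le_of_lt hx) hq.le
  refine (measureReal_mono h2).trans ?_
  rw [Real.rpow_neg ht.le, ← div_eq_mul_inv, le_div_iff₀ (by positivity), mul_comm]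
  exact h1.trans hν.rpow_le

/-- By centering, the truncated mean is minus the mean of the tail, where `|x| ≤ |x| ^ q * t ^ (1 -
q)`. -/
lemma abs_integral_trunc_le (hν : EntryLaw q M p ν) (hq : 1 ≤ q) {t : ℝ} (ht : 0 < t)
    (hInt : Integrable (fun x => x) ν) :
    |∫ x, (if |x| ≤ t then x else 0) ∂ν| ≤ p * M * t ^ (1 - q) := by
  have hm : MeasurableSet {x : ℝ | |x| ≤ t} := measurableSet_le (by fun_prop) (by fun_prop)
  have hsm : Integrable (fun x => if |x| ≤ t then x else 0) ν := by
    have := hInt.indicator hm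
    refine this.congr (Filter.Eventually.of_forall fun x => ?_)
    simp [Set.indicator]
  have h1 : ∫ x, (if |x| ≤ t then x else 0) ∂ν = - ∫ x, (x - if |x| ≤ t then x else 0) ∂ν := by
    rw [integral_sub hInt hsm, hν.centered]; ring
  rw [h1, abs_neg, ← Real.norm_eq_abs]
  calc _ ≤ ∫ x, |x| ^ q * t ^ (1 - q) ∂ν := by
        refine norm_integral_le_of_norm_le (hν.integrable_rpow.mul_const _)
          (Filter.Eventually.of_forall fun x => ?_)
        rw [Real.norm_eq_abs]
        split_ifs with h
        · simp only [sub_self, abs_zero]; positivity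
        · rw [sub_zero]
          push Not at h
          have hx : 0 < |x| := ht.trans h
          calc |x| = |x| ^ q * |x| ^ (1 - q) := by rw [← Real.rpow_add hx]; simp
            _ ≤ _ := mul_le_mul_of_nonneg_left
              (Real.rpow_le_rpow_of_nonpos ht h.le (by linarith)) (by positivity)
    _ = (∫ x, |x| ^ q ∂ν) * t ^ (1 - q) := integral_mul_const _ _
    _ ≤ _ := mul_le_mul_of_nonneg_right hν.rpow_le (by positivity)

/-- Decomposition of the operator norm into a truncated centered part, a rank one part and a part
with few large entries. -/
lemma measureReal_not_opBound_le (hν : EntryLaw q M p ν) (hq : 3 ≤ q) {n j : ℕ} {b L : ℝ}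
    (hb : 0 < b) (hL : 0 < L) (hbP : (2 * b) ^ 2 * (2 ^ (j + 1) + 1) ≤ n * (p * (1 + M)))
    (hKn : 2 ^ (j + 1) + 1 ≤ n) :
    (matLaw ν (Fin n) (Fin n)).real
      {X | ¬ OpBound X (√(Real.exp 1 * (1327104 * (n * (p * (1 + M))))) +
        n * (p * M * b ^ (1 - q)) + L)}
      ≤ 4 * n * Real.exp (-2 ^ (j + 1)) + 2 * (n ^ 3 * (p * M * b ^ (-q)) ^ 2) +
        n ^ 2 * (p * M * L ^ (-q)) := by
  have := hν.isProb
  have hc := hν.centeredLaw hq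
  have hm : MeasurableSet {x : ℝ | |x| ≤ b} := measurableSet_le (by fun_prop) (by fun_prop)
  set g : ℝ → ℝ := fun x => if |x| ≤ b then x else 0 with hg
  have hgm : Measurable g := Measurable.ite hm measurable_id measurable_const
  have hgb : ∀ x, |g x| ≤ b := fun x => by
    simp only [hg]; split_ifs with h
    · exact h
    · simpa using hb.le
  have hgi : Integrable g ν := Integrable.of_bound hgm.aestronglyMeasurable b
    (Filter.Eventually.of_forall hgb)
  have hgsq : ∀ x, g x ^ 2 ≤ x ^ 2 := fun x => by
    simp only [hg]; split_ifs
    · exact le_rfl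
    · rw [zero_pow two_ne_zero]; positivity
  have hgi2 : Integrable (fun x => g x ^ 2) ν := hc.integrable_sq.mono'
    (hgm.pow_const 2).aestronglyMeasurable (Filter.Eventually.of_forall fun x => by
      rw [Real.norm_eq_abs, abs_of_nonneg (sq_nonneg _)]; exact hgsq x)
  set m : ℝ := ∫ x, g x ∂ν with hm_def
  have hmb : |m| ≤ b := by
    rw [← Real.norm_eq_abs]
    refine (norm_integral_le_of_norm_le_const (C := b) (Filter.Eventually.of_forall hgb)).trans_eq ?_
    simp
  have hm2 : |m| ≤ p * M * b ^ (1 - q) :=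
    hν.abs_integral_trunc_le (by linarith) hb hc.integrable_id
  have hmean : ∫ x, (g x - m) ∂ν = 0 := by
    rw [integral_sub hgi (integrable_const m)]; simp [hm_def]
  have hsq : ∫ x, (g x - m) ^ 2 ∂ν ≤ p * (1 + M) := by
    have e : ∫ x, (g x - m) ^ 2 ∂ν = (∫ x, g x ^ 2 ∂ν) - m ^ 2 := by
      have e1 : (fun x => (g x - m) ^ 2) = fun x => (g x ^ 2 - (2 * m) * g x) + m ^ 2 := by
        funext x; ring
      have hi1 : Integrable (fun x => g x ^ 2 - (2 * m) * g x) ν := hgi2.sub (hgi.const_mul _)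
      rw [e1, integral_add hi1 (integrable_const _),
        integral_sub hgi2 (hgi.const_mul _), integral_const_mul, ← hm_def]
      simp only [integral_const, probReal_univ, one_smul]; ring
    have := integral_mono hgi2 hc.integrable_sq hgsq
    have := hc.sq_le
    rw [e]; nlinarith [sq_nonneg m]
  have hM := hν.nonneg
  have hp := hν.p_pos
  have h1 := _root_.measureReal_not_opBound_le (ν := ν) (T := fun x => g x - m) (a := p * (1 + M))
    (b := 2 * b) (n := n) (j := j) (hgm.sub_const m) (Filter.Eventually.of_forall fun x =>
      (abs_sub _ _).trans (by linarith [hgb x])) hmean hsq (by positivity) hbP hKn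
  have h2 := measureReal_exists_pair_row_le (ν := ν) (n := n) {x | b < |x|}
  have h3 := measureReal_exists_pair_col_le (ν := ν) (n := n) {x | b < |x|}
  have h4 := measureReal_exists_mem_le (ν := ν) (n := n) {x | L < |x|}
  have h5 := hν.measureReal_lt_abs_le (by linarith) hb
  have h6 := hν.measureReal_lt_abs_le (by linarith) hL
  set E1 := {X : Fin n → Fin n → ℝ | ¬ OpBound (fun i j => g (X i j) - m)
    √(Real.exp 1 * (1327104 * (n * (p * (1 + M)))))}
  set E2 := {X : Fin n → Fin n → ℝ | ∃ i j k, j ≠ k ∧ X i j ∈ {x | b < |x|} ∧ X i k ∈ {x | b < |x|}}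
  set E3 := {X : Fin n → Fin n → ℝ | ∃ i j k, j ≠ k ∧ X j i ∈ {x | b < |x|} ∧ X k i ∈ {x | b < |x|}}
  set E4 := {X : Fin n → Fin n → ℝ | ∃ i j, X i j ∈ {x | L < |x|}}
  have hsub : {X | ¬ OpBound X (√(Real.exp 1 * (1327104 * (n * (p * (1 + M))))) +
        n * (p * M * b ^ (1 - q)) + L)} ⊆ (E1 ∪ (E2 ∪ E3)) ∪ E4 := by
    intro X hX
    by_contra hE
    simp only [Set.mem_union, not_or] at hE
    obtain ⟨⟨hE1, hE2, hE3⟩, hE4⟩ := hE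
    refine hX ?_
    have hg0 : ∀ i j, X i j - g (X i j) ≠ 0 → b < |X i j| := by
      intro i j h
      by_contra h'
      push Not at h'
      exact h (by simp [hg, h'])
    -- Outside `E2` and `E3` no row or column holds two entries above `b`, and outside `E4` none
    -- exceeds `L`.
    have hbig : OpBound (fun i j => X i j - g (X i j)) L := by
      refine opBound_of_unique hL.le (fun i j k hj hk => ?_) (fun i j k hj hk => ?_) fun i j => ?_
      · by_contra hjk
        exact hE2 ⟨i, j, k, hjk, hg0 i j hj, hg0 i k hk⟩
      · by_contra hjk
        exact hE3 ⟨i, j, k, hjk, hg0 j i hj, hg0 k i hk⟩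
      · have hXL : |X i j| ≤ L := by
          by_contra h
          exact hE4 ⟨i, j, not_le.1 h⟩
        simp only [hg]; split_ifs
        · simpa using hL.le
        · simpa using hXL
    have hsmall := not_not.1 hE1
    have hall := (hsmall.add ((opBound_const n m).mono
      (mul_le_mul_of_nonneg_left hm2 (Nat.cast_nonneg n)))).add hbig
    convert hall using 1
    funext i j
    simp
  have hnn : (0 : ℝ) ≤ n := Nat.cast_nonneg n
  have h7 : (n : ℝ) ^ 3 * ν.real {x | b < |x|} ^ 2 ≤ n ^ 3 * (p * M * b ^ (-q)) ^ 2 := by gcongr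
  have h8 : (n : ℝ) ^ 2 * ν.real {x | L < |x|} ≤ n ^ 2 * (p * M * L ^ (-q)) := by gcongr
  calc _ ≤ _ := measureReal_mono hsub
    _ ≤ _ := measureReal_union_le _ _
    _ ≤ (_ + (_ + _)) + _ := by
        gcongr
        refine (measureReal_union_le _ _).trans ?_
        gcongr
        exact measureReal_union_le _ _
    _ ≤ _ := by linarith

end EntryLaw

/-! ### Choice of parameters for the operator norm -/

section NormAsymptotics

open Filter Topology

lemma four_lt_momentExponent {α : ℝ} (hα₀ : 0 < α) (hα₁ : α < 1) : 4 < momentExponent α := by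
  have : 0 < 1 - α := by linarith
  rw [momentExponent, lt_div_iff₀ this]
  linarith

/-- The origin of `q`: since `q / 2 = 1 + 1 / (1 - α)`, the power `√(np) ^ (-q)` is `1 / (np)` times
`(np) ^ (-1 / (1 - α))`, and the latter is `O(1 / n)` because `np ≥ κ n ^ (1 - α)`. Up to `M`, the
left side bounds the expected number of entries above `√(np)`. -/
lemma sq_mul_rpow_neg_momentExponent_le {α κ p : ℝ} {n : ℕ} (hα₁ : α < 1) (hκ : 0 < κ)
    (hn : 0 < n) (hp : κ * (n : ℝ) ^ (-α) ≤ p) :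
    (n : ℝ) ^ 2 * (p * √(n * p) ^ (-momentExponent α)) ≤ κ ^ (-(1 / (1 - α))) := by
  have hn0 : (0 : ℝ) < n := by exact_mod_cast hn
  have hp0 : 0 < p := lt_of_lt_of_le (by positivity) hp
  have h1α : 0 < 1 - α := by linarith
  have hN : 0 < (n : ℝ) * p := by positivity
  have hle : κ * (n : ℝ) ^ (1 - α) ≤ n * p := by
    calc κ * (n : ℝ) ^ (1 - α) = n * (κ * (n : ℝ) ^ (-α)) := by
          rw [sub_eq_add_neg, Real.rpow_add hn0, Real.rpow_one]; ring
      _ ≤ n * p := by gcongr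
  have h1 : √(n * p) ^ (-momentExponent α) = (n * p) ^ (-(1 / (1 - α))) * (n * p : ℝ)⁻¹ := by
    rw [Real.sqrt_eq_rpow, ← Real.rpow_mul hN.le, ← Real.rpow_neg_one, ← Real.rpow_add hN]
    congr 1
    rw [momentExponent]
    field_simp
    ring
  have h2 : ((n : ℝ) * p) ^ (-(1 / (1 - α))) ≤ κ ^ (-(1 / (1 - α))) * (n : ℝ)⁻¹ := by
    calc ((n : ℝ) * p) ^ (-(1 / (1 - α))) ≤ (κ * (n : ℝ) ^ (1 - α)) ^ (-(1 / (1 - α))) := by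
          refine Real.rpow_le_rpow_of_nonpos (by positivity) hle ?_
          have : 0 ≤ 1 / (1 - α) := by positivity
          linarith
      _ = κ ^ (-(1 / (1 - α))) * (n : ℝ)⁻¹ := by
          rw [Real.mul_rpow hκ.le (by positivity), ← Real.rpow_mul hn0.le]
          congr 1
          rw [mul_neg, mul_one_div, div_self h1α.ne', Real.rpow_neg_one]
  rw [h1]
  calc (n : ℝ) ^ 2 * (p * ((n * p) ^ (-(1 / (1 - α))) * (n * p : ℝ)⁻¹))
      = n * (n * p) ^ (-(1 / (1 - α))) := by field_simp
    _ ≤ n * (κ ^ (-(1 / (1 - α))) * (n : ℝ)⁻¹) := by gcongr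
    _ = _ := by field_simp

lemma tendsto_const_mul_natCast_rpow_neg (C : ℝ) {r : ℝ} (hr : 0 < r) :
    Tendsto (fun n : ℕ => C * (n : ℝ) ^ (-r)) atTop (𝓝 0) := by
  simpa using ((tendsto_rpow_neg_atTop hr).comp tendsto_natCast_atTop_atTop).const_mul C

lemma tendsto_log_mul_natCast_rpow_neg {r : ℝ} (hr : 0 < r) :
    Tendsto (fun n : ℕ => (4 * Real.log n + 3) * (n : ℝ) ^ (-r)) atTop (𝓝 0) := by
  have h1 : Tendsto (fun x : ℝ => Real.log x / x ^ r) atTop (𝓝 0) :=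
    (isLittleO_log_rpow_atTop hr).tendsto_div_nhds_zero
  have h2 := (h1.comp tendsto_natCast_atTop_atTop).const_mul 4
  have h3 := tendsto_const_mul_natCast_rpow_neg 3 hr
  have h4 := h2.add h3
  rw [mul_zero, add_zero] at h4
  refine h4.congr fun n => ?_
  simp only [Function.comp_apply]
  rw [Real.rpow_neg (Nat.cast_nonneg n)]
  ring

/-- Rounds `2 log n` up to a power of two, as the trace method requires. -/
lemma exists_two_pow_log {n : ℕ} (hn : 2 ≤ n) :
    ∃ j : ℕ, 2 * Real.log n ≤ 2 ^ (j + 1) ∧ (2 : ℝ) ^ (j + 1) + 1 ≤ 4 * Real.log n + 3 := by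
  have hlog : 0 < Real.log n := Real.log_pos (by exact_mod_cast hn)
  set m := ⌈2 * Real.log n⌉₊ with hm
  have hm0 : m ≠ 0 := (Nat.ceil_pos.2 (by positivity)).ne'
  refine ⟨Nat.log 2 m, ?_, ?_⟩
  · refine (Nat.le_ceil _).trans ?_
    exact_mod_cast (Nat.lt_pow_succ_log_self one_lt_two m).le
  · have h1 : (2 : ℝ) ^ Nat.log 2 m ≤ m := by exact_mod_cast Nat.pow_log_le_self 2 hm0
    have h2 := (Nat.ceil_lt_add_one (show 0 ≤ 2 * Real.log n by positivity)).le
    rw [← hm] at h2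
    rw [pow_succ]
    linarith

/-- Truncating at `b = √(np) n ^ (-e)` leaves room for a power of order `log n` in the trace method.
With `e = 1 / (4q)` the tail probability at `b` grows only by `n ^ (1/4)` over that at `√(np)`, so
two large entries share a row or column with probability `O(n ^ (-1/2))`. The constant `L` bounds
the largest entries and is the only one fixed by `δ`. -/
theorem exists_measureReal_not_opBound_le {α κ M δ : ℝ} (hα₀ : 0 < α) (hα₁ : α < 1) (hκ : 0 < κ)
    (hM : 0 ≤ M) (hδ : 0 < δ) :
    ∃ K : ℝ, 0 < K ∧ ∀ᶠ n : ℕ in atTop, ∀ p : ℝ, κ * (n : ℝ) ^ (-α) ≤ p →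
      ∀ ν : Measure ℝ, EntryLaw (momentExponent α) M p ν →
        (matLaw ν (Fin n) (Fin n)).real {X | ¬ OpBound X (K * √(n * p))} ≤ δ := by
  set q := momentExponent α with hq_def
  have hq : 4 < q := four_lt_momentExponent hα₀ hα₁
  set C : ℝ := M * κ ^ (-(1 / (1 - α))) with hC
  have hC0 : 0 ≤ C := by positivity
  obtain ⟨L, hL0, hL⟩ : ∃ L : ℝ, 0 < L ∧ C * L ^ (-q) ≤ δ / 2 := by
    have h : Tendsto (fun L : ℝ => C * L ^ (-q)) atTop (𝓝 0) := by
      simpa using (tendsto_rpow_neg_atTop (show 0 < q by linarith)).const_mul C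
    obtain ⟨L, h1, h2⟩ := ((h.eventually_le_const (show 0 < δ / 2 by positivity)).and
      (eventually_gt_atTop 0)).exists
    exact ⟨L, h2, h1⟩
  set e : ℝ := 1 / (4 * q) with he
  have he0 : 0 < e := by positivity
  have heq : e * q = 1 / 4 := by rw [he]; field_simp
  refine ⟨√(Real.exp 1 * (1327104 * (1 + M))) + 1 + L, by positivity, ?_⟩
  filter_upwards [(tendsto_const_mul_natCast_rpow_neg C (show 0 < (3 / 4 : ℝ) by norm_num)).eventually_le_const
      one_pos,
    (tendsto_const_mul_natCast_rpow_neg (2 * C ^ 2) (show 0 < (1 / 2 : ℝ) by norm_num)).eventually_le_const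
      (show 0 < δ / 4 by positivity),
    (tendsto_const_mul_natCast_rpow_neg 4 (one_pos)).eventually_le_const (show 0 < δ / 4 by positivity),
    (tendsto_log_mul_natCast_rpow_neg (show 0 < 2 * e by positivity)).eventually_le_const
      (show (0 : ℝ) < 1 / 4 by norm_num),
    (tendsto_log_mul_natCast_rpow_neg one_pos).eventually_le_const one_pos,
    eventually_ge_atTop 2] with n hn1 hn2 hn3 hn4 hn5 hn p hp ν hν
  have hn0 : (0 : ℝ) < n := by
    have : 0 < n := by omega
    exact_mod_cast this
  have hn1' : (1 : ℝ) ≤ n := by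
    have : 1 ≤ n := by omega
    exact_mod_cast this
  have hp0 : 0 < p := hν.p_pos
  have hkey := sq_mul_rpow_neg_momentExponent_le hα₁ hκ (show 0 < n by omega) hp
  rw [← hq_def] at hkey
  set w : ℝ := √(n * p) with hw
  have hw0 : 0 < w := by positivity
  have hw2 : w ^ 2 = n * p := Real.sq_sqrt (by positivity)
  set Q : ℝ := p * M * w ^ (-q) with hQ
  have hQ0 : 0 ≤ Q := by positivity
  have hQC : n ^ 2 * Q ≤ C := by
    calc (n : ℝ) ^ 2 * Q = M * (n ^ 2 * (p * w ^ (-q))) := by rw [hQ]; ring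
      _ ≤ C := by rw [hC]; gcongr
  set b : ℝ := w * (n : ℝ) ^ (-e) with hb
  have hb0 : 0 < b := by positivity
  have hbq : p * M * b ^ (-q) = Q * (n : ℝ) ^ (1 / 4 : ℝ) := by
    rw [hb, Real.mul_rpow hw0.le (by positivity), ← Real.rpow_mul hn0.le, hQ, neg_mul_neg, heq]
    ring
  have hbw : b ≤ w := by
    rw [hb]
    refine mul_le_of_le_one_right hw0.le (Real.rpow_le_one_of_one_le_of_nonpos hn1' ?_)
    linarith
  have hbw2 : b ^ 2 = n * p * (n : ℝ) ^ (-(2 * e)) := by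
    rw [hb, mul_pow, hw2, ← Real.rpow_natCast, ← Real.rpow_mul hn0.le]
    congr 2
    push_cast; ring
  obtain ⟨j, hj1, hj2⟩ := exists_two_pow_log hn
  have hbP : (2 * b) ^ 2 * (2 ^ (j + 1) + 1) ≤ n * (p * (1 + M)) := by
    calc (2 * b) ^ 2 * (2 ^ (j + 1) + 1) ≤ (2 * b) ^ 2 * (4 * Real.log n + 3) := by gcongr
      _ = 4 * (n * p) * ((4 * Real.log n + 3) * (n : ℝ) ^ (-(2 * e))) := by
          rw [mul_pow, hbw2]; ring
      _ ≤ 4 * (n * p) * (1 / 4) := by gcongr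
      _ = n * (p * 1) := by ring
      _ ≤ n * (p * (1 + M)) := by gcongr; linarith
  have hKn : 2 ^ (j + 1) + 1 ≤ n := by
    rw [Real.rpow_neg_one, ← div_eq_mul_inv, div_le_one hn0] at hn5
    exact_mod_cast hj2.trans hn5
  have hmain := hν.measureReal_not_opBound_le (by linarith) hb0 (show 0 < L * w by positivity)
    hbP hKn
  have hA : (n : ℝ) * (p * M * b ^ (1 - q)) ≤ w := by
    calc (n : ℝ) * (p * M * b ^ (1 - q)) = n * (p * M * b ^ (-q)) * b := by
          rw [sub_eq_add_neg, Real.rpow_add hb0, Real.rpow_one]; ring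
      _ ≤ n * (p * M * b ^ (-q)) * w := by gcongr
      _ = n ^ 2 * Q * ((n : ℝ) ^ (-1 : ℝ) * (n : ℝ) ^ (1 / 4 : ℝ)) * w := by
          rw [hbq, Real.rpow_neg_one]; field_simp
      _ = n ^ 2 * Q * (n : ℝ) ^ (-(3 / 4) : ℝ) * w := by
          rw [← Real.rpow_add hn0]; norm_num
      _ ≤ C * (n : ℝ) ^ (-(3 / 4) : ℝ) * w := by gcongr
      _ ≤ 1 * w := by gcongr
      _ = w := one_mul w
  have hS : √(Real.exp 1 * (1327104 * (n * (p * (1 + M))))) =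
      √(Real.exp 1 * (1327104 * (1 + M))) * w := by
    rw [hw, ← Real.sqrt_mul (by positivity)]
    congr 1; ring
  have hB1 : 4 * n * Real.exp (-2 ^ (j + 1)) ≤ δ / 4 := by
    refine le_trans ?_ hn3
    have h1 : Real.exp (-2 ^ (j + 1)) ≤ (n : ℝ) ^ (-2 : ℝ) := by
      rw [Real.rpow_def_of_pos hn0]
      gcongr
      linarith
    calc 4 * n * Real.exp (-2 ^ (j + 1)) ≤ 4 * n * (n : ℝ) ^ (-2 : ℝ) := by gcongr
      _ = 4 * ((n : ℝ) ^ (1 : ℝ) * (n : ℝ) ^ (-2 : ℝ)) := by rw [Real.rpow_one]; ring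
      _ = 4 * (n : ℝ) ^ (-1 : ℝ) := by rw [← Real.rpow_add hn0]; norm_num
  have hB2 : 2 * (n ^ 3 * (p * M * b ^ (-q)) ^ 2) ≤ δ / 4 := by
    refine le_trans ?_ hn2
    calc 2 * (n ^ 3 * (p * M * b ^ (-q)) ^ 2)
        = 2 * (n ^ 2 * Q) ^ 2 * ((n : ℝ) ^ (-1 : ℝ) * ((n : ℝ) ^ (1 / 4 : ℝ) * (n : ℝ) ^ (1 / 4 : ℝ))) := by
          rw [hbq, Real.rpow_neg_one]; field_simp
      _ = 2 * (n ^ 2 * Q) ^ 2 * (n : ℝ) ^ (-(1 / 2) : ℝ) := by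
          rw [← Real.rpow_add hn0, ← Real.rpow_add hn0]; norm_num
      _ ≤ 2 * C ^ 2 * (n : ℝ) ^ (-(1 / 2) : ℝ) := by gcongr
  have hB3 : (n : ℝ) ^ 2 * (p * M * (L * w) ^ (-q)) ≤ δ / 2 := by
    refine le_trans ?_ hL
    calc (n : ℝ) ^ 2 * (p * M * (L * w) ^ (-q)) = n ^ 2 * Q * L ^ (-q) := by
          rw [Real.mul_rpow hL0.le hw0.le, hQ]; ring
      _ ≤ C * L ^ (-q) := by gcongr
  have := hν.isProb
  refine (measureReal_mono fun X hX => ?_).trans (hmain.trans (by linarith))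
  refine fun hop => hX (hop.mono ?_)
  rw [hS]
  linarith

end NormAsymptotics

/-! ### The law of the sparse ensemble -/

section Law

/-- The law of the product of a Bernoulli variable of parameter `p` and an independent variable of
law `m`. -/
noncomputable def sparseLaw (p : I) (m : Measure ℝ) : Measure ℝ :=
  unitInterval.toNNReal p • m + unitInterval.toNNReal (unitInterval.symm p) • Measure.dirac 0

lemma map_mul_bernoulliMeasure_prod (p : I) (m : Measure ℝ) [IsProbabilityMeasure m] :
    ((bernoulliMeasure (1 : ℝ) 0 p).prod m).map (fun x => x.1 * x.2) = sparseLaw p m := by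
  have hmul : Measurable fun x : ℝ × ℝ => x.1 * x.2 := by fun_prop
  rw [bernoulliMeasure_def, Measure.add_prod, Measure.map_add _ _ hmul, Measure.prod_smul_left,
    Measure.prod_smul_left, Measure.map_smul, Measure.map_smul, Measure.dirac_prod,
    Measure.dirac_prod, Measure.map_map hmul (by fun_prop), Measure.map_map hmul (by fun_prop),
    sparseLaw]
  congr 2
  · convert Measure.map_id using 2
    funext x; simp
  · have : ((fun x : ℝ × ℝ => x.1 * x.2) ∘ Prod.mk 0) = fun _ => (0 : ℝ) := by funext x; simp
    rw [this, Measure.map_const]; simp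

lemma integrable_sparseLaw {p : I} {m : Measure ℝ} {φ : ℝ → ℝ} (hφ : Integrable φ m)
    (hm : StronglyMeasurable φ) : Integrable φ (sparseLaw p m) := by
  refine Integrable.add_measure hφ.smul_measure_nnreal (Integrable.smul_measure_nnreal ?_)
  exact integrable_dirac' hm (by simp)

lemma integral_sparseLaw {p : I} {m : Measure ℝ} {φ : ℝ → ℝ} (hφ : Integrable φ m)
    (hm : StronglyMeasurable φ) (h0 : φ 0 = 0) : ∫ x, φ x ∂(sparseLaw p m) = p * ∫ x, φ x ∂m := by
  rw [sparseLaw, integral_add_measure hφ.smul_measure_nnreal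
    (Integrable.smul_measure_nnreal (integrable_dirac' hm (by simp))),
    integral_smul_nnreal_measure, integral_smul_nnreal_measure, integral_dirac' _ _ hm, h0, smul_zero,
    add_zero]
  rfl

lemma entryLaw_sparseLaw {q M : ℝ} {p : I} (hp : 0 < (p : ℝ)) {m : Measure ℝ}
    [IsProbabilityMeasure m] (hq : 1 ≤ q) (hi : Integrable (fun x => |x| ^ q) m)
    (hM : ∫ x, |x| ^ q ∂m ≤ M) (hmean : ∫ x, x ∂m = 0) (hvar : 1 ≤ ∫ x, x ^ 2 ∂m) :
    EntryLaw q M p (sparseLaw p m) where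
  isProb := by
    rw [← map_mul_bernoulliMeasure_prod]
    exact Measure.isProbabilityMeasure_map (by fun_prop)
  p_pos := hp
  p_le_one := p.2.2
  support_le := by
    have h1 : sparseLaw p m {0}ᶜ ≤ unitInterval.toNNReal p := by
      rw [sparseLaw, Measure.add_apply, Measure.smul_apply, Measure.smul_apply,
        Measure.dirac_apply' _ (measurableSet_singleton 0).compl]
      simp only [Set.mem_compl_iff, Set.mem_singleton_iff, not_true_eq_false, not_false_eq_true,
        Set.indicator_of_notMem, smul_zero, add_zero]
      rw [ENNReal.smul_def, smul_eq_mul]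
      exact mul_le_of_le_one_right' prob_le_one
    exact ENNReal.toReal_le_coe_of_le_coe h1
  integrable_rpow := integrable_sparseLaw hi (by fun_prop)
  rpow_le := by
    rw [integral_sparseLaw hi (by fun_prop) (by rw [abs_zero, Real.zero_rpow (by linarith)])]
    exact mul_le_mul_of_nonneg_left hM hp.le
  centered := by
    have hid : Integrable (fun x => x) m := by
      refine ((integrable_const (1 : ℝ)).add hi).mono' (by fun_prop)
        (Filter.Eventually.of_forall fun x => ?_)
      rw [Real.norm_eq_abs, Pi.add_apply]
      rcases le_total |x| 1 with h | h
      · have : 0 ≤ |x| ^ q := by positivity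
        linarith
      · have := Real.rpow_le_rpow_of_exponent_le h hq
        rw [Real.rpow_one] at this
        linarith
    rw [integral_sparseLaw hid (by fun_prop) rfl, hmean, mul_zero]
  le_sq := by
    have hsq : Integrable (fun x => x ^ 2) m := by
      -- A non-integrable square would have integral zero by convention, contradicting `hvar`.
      by_contra h
      rw [integral_undef h] at hvar
      linarith
    rw [integral_sparseLaw hsq (by fun_prop) (by simp)]
    exact le_mul_of_one_le_right hp.le hvar

lemma EntryLaw.mono {q M M' p : ℝ} {ν : Measure ℝ} (hν : EntryLaw q M p ν) (h : M ≤ M') :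
    EntryLaw q M' p ν :=
  { hν with rpow_le := hν.rpow_le.trans (mul_le_mul_of_nonneg_left h hν.p_pos.le) }

/-- Joint independence makes the law of the whole family a product over `ι ⊕ ι`; regrouped into
pairs over `ι`, it is pushed forward by multiplication in each coordinate. -/
lemma map_mul_eq_pi {ι Ω : Type*} [Fintype ι] [MeasurableSpace Ω] {μ : Measure Ω}
    [IsProbabilityMeasure μ] {χ ξ : ι → Ω → ℝ} (hχ : ∀ e, Measurable (χ e))
    (hξ : ∀ e, Measurable (ξ e)) (hind : iIndepFun (Sum.elim χ ξ) μ) :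
    μ.map (fun ω e => χ e ω * ξ e ω) =
      Measure.pi fun e => ((μ.map (χ e)).prod (μ.map (ξ e))).map fun x => x.1 * x.2 := by
  have hm : ∀ s, Measurable (Sum.elim χ ξ s) := by
    rintro (e | e)
    · exact hχ e
    · exact hξ e
  have hp : ∀ s, IsProbabilityMeasure (μ.map (Sum.elim χ ξ s)) := fun s =>
    Measure.isProbabilityMeasure_map (hm s).aemeasurable
  have hpχ : ∀ e, IsProbabilityMeasure (μ.map (χ e)) := fun e => hp (Sum.inl e)
  have hpξ : ∀ e, IsProbabilityMeasure (μ.map (ξ e)) := fun e => hp (Sum.inr e)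
  have hmul : Measurable fun x : ℝ × ℝ => x.1 * x.2 := by fun_prop
  have hpm : ∀ e, IsProbabilityMeasure (((μ.map (χ e)).prod (μ.map (ξ e))).map
      fun x => x.1 * x.2) := fun e => Measure.isProbabilityMeasure_map hmul.aemeasurable
  have h1 := hind.map_fun_eq_pi_map fun s => (hm s).aemeasurable
  have h2 := measurePreserving_sumPiEquivProdPi fun s => μ.map (Sum.elim χ ξ s)
  have h3 := (measurePreserving_arrowProdEquivProdArrow ℝ ℝ ι (fun e => μ.map (χ e))
    fun e => μ.map (ξ e)).symm
  rw [← Measure.pi_map_pi fun e => hmul.aemeasurable, ← h3.map_eq]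
  have h4 := h2.map_eq
  simp only [Sum.elim_inl, Sum.elim_inr] at h4
  rw [← h4, ← h1, Measure.map_map (by fun_prop) (by fun_prop),
    Measure.map_map (by fun_prop) (measurable_pi_iff.2 hm), Measure.map_map (by fun_prop) ?_]
  · rfl
  · exact (MeasurableEquiv.measurable _).comp (measurable_pi_iff.2 hm)

lemma map_curry_pi (ν : Measure ℝ) [IsProbabilityMeasure ν] (ι J : Type*) [Fintype ι] [Fintype J] :
    (Measure.pi fun _ : ι × J => ν).map Function.curry = matLaw ν ι J := by
  have h := Measure.infinitePi_map_curry (ι := ι) (κ := J) fun _ _ => ν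
  simp only [Measure.infinitePi_eq_pi] at h
  exact h

end Law

namespace IsSparseEnsemble

variable {q M : ℝ} {n : ℕ} {p : I} {Ω : Type u} [MeasurableSpace Ω] {μ : Measure Ω}
  {χ ξ : Fin n → Fin n → Ω → ℝ}

lemma transpose (h : IsSparseEnsemble q M p μ χ ξ) :
    IsSparseEnsemble q M p μ (fun i j => χ j i) (fun i j => ξ j i) where
  measurable_bernoulli i j := h.measurable_bernoulli j i
  measurable_entry i j := h.measurable_entry j i
  indep := by
    have h1 := h.indep.precomp (g := Sum.map Prod.swap Prod.swap)
      (Sum.map_injective.2 ⟨Prod.swap_injective, Prod.swap_injective⟩)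
    convert h1 using 1
    funext s
    rcases s with e | e <;> rfl
  law_bernoulli i j := h.law_bernoulli j i
  identDistrib i j k l := h.identDistrib j i l k
  integrable_moment i j := h.integrable_moment j i
  moment_le i j := h.moment_le j i
  centered i j := h.centered j i
  one_le_variance i j := h.one_le_variance j i

lemma map_eq_matLaw [IsProbabilityMeasure μ] (h : IsSparseEnsemble q M p μ χ ξ) (k l : Fin n) :
    μ.map (fun ω i j => χ i j ω * ξ i j ω) = matLaw (sparseLaw p (μ.map (ξ k l))) (Fin n) (Fin n) := by
  have hp : IsProbabilityMeasure (μ.map (ξ k l)) :=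
    Measure.isProbabilityMeasure_map (h.measurable_entry k l).aemeasurable
  have hps : IsProbabilityMeasure (sparseLaw p (μ.map (ξ k l))) := by
    rw [← map_mul_bernoulliMeasure_prod]
    exact Measure.isProbabilityMeasure_map (by fun_prop)
  have h1 := map_mul_eq_pi (fun e : Fin n × Fin n => h.measurable_bernoulli e.1 e.2)
    (fun e => h.measurable_entry e.1 e.2) h.indep
  have h2 : ∀ e : Fin n × Fin n, ((μ.map (χ e.1 e.2)).prod (μ.map (ξ e.1 e.2))).map
      (fun x => x.1 * x.2) = sparseLaw p (μ.map (ξ k l)) := fun e => by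
    rw [h.law_bernoulli, (h.identDistrib e.1 e.2 k l).map_eq, map_mul_bernoulliMeasure_prod]
  simp only [h2] at h1
  rw [← map_curry_pi, ← h1, Measure.map_map ?_ ?_]
  · rfl
  · exact (MeasurableEquiv.curry (Fin n) (Fin n) ℝ).measurable
  · exact measurable_pi_iff.2 fun e => (h.measurable_bernoulli _ _).mul (h.measurable_entry _ _)

lemma measurable_array (h : IsSparseEnsemble q M p μ χ ξ) :
    Measurable fun ω i j => χ i j ω * ξ i j ω :=
  measurable_pi_iff.2 fun i => measurable_pi_iff.2 fun j =>
    (h.measurable_bernoulli i j).mul (h.measurable_entry i j)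

/-- The arrays of rows and of columns both have the law of an array of independent entries. -/
lemma exists_entryLaw [IsProbabilityMeasure μ] (h : IsSparseEnsemble q M p μ χ ξ) (hn : 0 < n)
    (hq : 1 ≤ q) (hp : 0 < (p : ℝ)) :
    ∃ ν : Measure ℝ, EntryLaw q M p ν ∧
      (∀ S : Set (Fin n → Fin n → ℝ), μ.real {ω | (fun i j => χ i j ω * ξ i j ω) ∈ S} ≤
        (matLaw ν (Fin n) (Fin n)).real S) ∧
      ∀ S : Set (Fin n → Fin n → ℝ), μ.real {ω | (fun i j => χ j i ω * ξ j i ω) ∈ S} ≤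
        (matLaw ν (Fin n) (Fin n)).real S := by
  set k : Fin n := ⟨0, hn⟩
  have hm := h.measurable_entry k k
  have hpr : IsProbabilityMeasure (μ.map (ξ k k)) := Measure.isProbabilityMeasure_map hm.aemeasurable
  have hν : EntryLaw q M p (sparseLaw p (μ.map (ξ k k))) := by
    have hqm : Measurable fun x : ℝ => |x| ^ q := by fun_prop
    refine entryLaw_sparseLaw hp hq ?_ ?_ ?_ ?_
    · rw [integrable_map_measure hqm.aestronglyMeasurable hm.aemeasurable]
      exact h.integrable_moment k k
    · rw [integral_map hm.aemeasurable hqm.aestronglyMeasurable]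
      exact h.moment_le k k
    · rw [integral_map hm.aemeasurable (by fun_prop)]
      exact h.centered k k
    · rw [integral_map hm.aemeasurable (by fun_prop),
        ← variance_of_integral_eq_zero hm.aemeasurable (h.centered k k)]
      exact h.one_le_variance k k
  have := hν.isProb
  refine ⟨_, hν, fun S => ?_, fun S => ?_⟩
  · refine ENNReal.toReal_mono (measure_ne_top _ _) ?_
    rw [← h.map_eq_matLaw k k]
    -- This inequality needs no measurability of `S`, so it applies to `compEvent` and
    -- `incompEvent`.
    exact Measure.le_map_apply h.measurable_array.aemeasurable S
  · refine ENNReal.toReal_mono (measure_ne_top _ _) ?_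
    rw [← h.transpose.map_eq_matLaw k k]
    exact Measure.le_map_apply h.transpose.measurable_array.aemeasurable S

end IsSparseEnsemble

/-! ### Singular values of the sparse matrix -/

section SingularValues

variable {n : ℕ}

lemma norm_toEuclideanCLM_apply (A : Matrix (Fin n) (Fin n) ℝ) (x : EuclideanSpace ℝ (Fin n)) :
    ‖Matrix.toEuclideanCLM (n := Fin n) (𝕜 := ℝ) A x‖ = l2 (mv A x.ofLp) := by
  have h := Matrix.toEuclideanCLM_toLp (𝕜 := ℝ) A x.ofLp
  rw [WithLp.toLp_ofLp] at h
  rw [h]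
  rfl

lemma opBound_of_norm_le {A : Matrix (Fin n) (Fin n) ℝ} {K : ℝ}
    (h : ‖Matrix.toEuclideanCLM (n := Fin n) (𝕜 := ℝ) A‖ ≤ K) : OpBound A K := fun x => by
  have h1 := (Matrix.toEuclideanCLM (n := Fin n) (𝕜 := ℝ) A).le_opNorm (WithLp.toLp 2 x)
  rw [norm_toEuclideanCLM_apply] at h1
  exact h1.trans (mul_le_mul_of_nonneg_right h (norm_nonneg _))

lemma nonempty_sphere (hn : 0 < n) :
    Nonempty (Metric.sphere (0 : EuclideanSpace ℝ (Fin n)) 1) :=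
  ⟨⟨EuclideanSpace.single ⟨0, hn⟩ 1, by simp⟩⟩

lemma exists_l2_mv_le_of_sMin_lt (hn : 0 < n) {A : Matrix (Fin n) (Fin n) ℝ} {t : ℝ}
    (h : sMin A < t) : ∃ x, l2 x = 1 ∧ l2 (mv A x) ≤ t := by
  have := nonempty_sphere hn
  obtain ⟨x, hx⟩ := exists_lt_of_ciInf_lt h
  rw [norm_toEuclideanCLM_apply] at hx
  exact ⟨_, mem_sphere_zero_iff_norm.1 x.2, hx.le⟩

lemma le_sMin (hn : 0 < n) {A : Matrix (Fin n) (Fin n) ℝ} {t : ℝ}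
    (h : ∀ x, l2 x = 1 → t ≤ l2 (mv A x)) : t ≤ sMin A := by
  have := nonempty_sphere hn
  refine le_ciInf fun x => ?_
  rw [norm_toEuclideanCLM_apply]
  exact h _ (mem_sphere_zero_iff_norm.1 x.2)

lemma sMax_le (hn : 0 < n) {A : Matrix (Fin n) (Fin n) ℝ} {K : ℝ} (h : OpBound A K) :
    sMax A ≤ K := by
  have := nonempty_sphere hn
  refine ciSup_le fun x => ?_
  rw [norm_toEuclideanCLM_apply]
  refine (h _).trans_eq ?_
  have : l2 (x : EuclideanSpace ℝ (Fin n)).ofLp = 1 := mem_sphere_zero_iff_norm.1 x.2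
  rw [this, mul_one]

lemma condNumber_le {A : Matrix (Fin n) (Fin n) ℝ} {K t : ℝ} (hK : sMax A ≤ K) (ht : 0 < t)
    (hK0 : 0 ≤ K) (h : t ≤ sMin A) : condNumber A ≤ ENNReal.ofReal (K / t) := by
  rw [condNumber, if_neg (ht.trans_le h).ne']
  exact ENNReal.ofReal_le_ofReal (div_le_div₀ hK0 hK ht h)

end SingularValues

/-- With high probability the sparse matrix has operator norm `O(√(n p))` and its perturbation by a
deterministic matrix of norm `O(√(n p))` is bounded below by a multiple of `√(p / n)`. -/
theorem exists_measureReal_not_opBound_or_exists_le {α κ δ : ℝ} (M : ℝ) (hα₀ : 0 < α) (hα₁ : α < 1)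
    (hκ : 0 < κ) (hδ : 0 < δ) {R : ℝ} (hR : 0 ≤ R) :
    ∃ K : ℝ, 0 < K ∧ ∃ ε : ℝ, 0 < ε ∧ ∃ n₀ : ℕ, ∀ n : ℕ, n₀ ≤ n →
      0 < n ∧ ∀ p : I, κ * (n : ℝ) ^ (-α) ≤ (p : ℝ) →
      ∀ (Ω : Type u) [MeasurableSpace Ω] (μ : Measure Ω) [IsProbabilityMeasure μ]
        (χ ξ : Fin n → Fin n → Ω → ℝ), IsSparseEnsemble (momentExponent α) M p μ χ ξ →
      ∀ D : Matrix (Fin n) (Fin n) ℝ, OpBound D (R * √((n : ℝ) * p)) →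
        μ.real {ω | ¬ OpBound (sparseMatrix χ ξ ω) (K * √((n : ℝ) * p)) ∨
          ∃ x, l2 x = 1 ∧ l2 (mv (sparseMatrix χ ξ ω + D) x) ≤ ε * √((p : ℝ) / n)} ≤ δ := by
  -- The norm bound asks for a nonnegative moment bound, while `M` is arbitrary here.
  set M' := max M 0
  have hM' : 0 ≤ M' := le_max_right _ _
  have hq := four_lt_momentExponent hα₀ hα₁
  have hδ3 : 0 < δ / 3 := by positivity
  obtain ⟨K, hK, hnorm⟩ := exists_measureReal_not_opBound_le hα₀ hα₁ hκ hM' hδ3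
  have hs : 1 ≤ 1 + M' := by linarith
  obtain ⟨θ, hθ, -, ρ, hρ, -, c, hc, hcomp⟩ := exists_compBound_linear hα₀ hα₁ hκ hs
    (show 0 < K + R by linarith)
  obtain ⟨ε, hε, hincomp⟩ := exists_measureReal_incompEvent_le hα₁ hκ hs hθ hρ hc hcomp hδ3
  have hev := ((hnorm.and (hcomp _ hδ3)).and hincomp).and (Filter.eventually_gt_atTop 0)
  obtain ⟨n₀, hn₀⟩ := Filter.eventually_atTop.1 hev
  refine ⟨K, hK, min ε c, lt_min hε hc, n₀, fun n hn => ?_⟩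
  obtain ⟨⟨⟨h1, h2⟩, h3⟩, hn0⟩ := hn₀ n hn
  refine ⟨hn0, fun p hp Ω _ μ _ χ ξ h D hD => ?_⟩
  have hn1 : (1 : ℝ) ≤ n := by exact_mod_cast hn0
  have hp0 : 0 < (p : ℝ) := lt_of_lt_of_le (by positivity) hp
  obtain ⟨ν, hν, hrow, hcol⟩ := h.exists_entryLaw hn0 (by linarith) hp0
  replace hν := hν.mono (le_max_left M 0)
  have hc' := hν.centeredLaw (by linarith)
  have hD' : OpBound (fun i j => D j i) (R * √((n : ℝ) * p)) :=
    OpBound.transpose (by positivity) hD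
  specialize h1 p hp ν hν
  specialize h2 p hp ν hc' n (by omega) D
  specialize h3 p hp ν hc' fun i j => D j i
  set w := √((n : ℝ) * p)
  have hw0 : 0 ≤ w := Real.sqrt_nonneg _
  have hwle : √((p : ℝ) / n) ≤ w := by
    refine Real.sqrt_le_sqrt ?_
    rw [div_le_iff₀ (by positivity)]
    nlinarith [mul_le_mul hn1 hn1 zero_le_one (by positivity)]
  have hsub : {ω | ¬ OpBound (sparseMatrix χ ξ ω) (K * w) ∨
      ∃ x, l2 x = 1 ∧ l2 (mv (sparseMatrix χ ξ ω + D) x) ≤ min ε c * √((p : ℝ) / n)} ⊆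
      ({ω | (fun i j => χ i j ω * ξ i j ω) ∈ {X | ¬ OpBound X (K * w)}} ∪
       {ω | (fun i j => χ i j ω * ξ i j ω) ∈ compEvent D ((K + R) * w) (1 / √(θ * n)) ρ (c * w)}) ∪
       {ω | (fun i j => χ j i ω * ξ j i ω) ∈ incompEvent (fun i j => D j i) ((K + R) * w)
        (1 / √(θ * n)) ρ (ε * √((p : ℝ) / n))} := by
    intro ω hω
    by_cases hop : OpBound (sparseMatrix χ ξ ω) (K * w)
    · obtain ⟨x, hx, hxle⟩ := hω.resolve_left (not_not.2 hop)
      have hopD : OpBound (sparseMatrix χ ξ ω + D) ((K + R) * w) := by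
        rw [add_mul]
        exact hop.add hD
      by_cases hfl : flatMass (1 / √(θ * n)) x < ρ ^ 2
      · refine Or.inl (Or.inr ⟨hopD, x, hx, hfl, hxle.trans ?_⟩)
        exact mul_le_mul (min_le_right _ _) hwle (Real.sqrt_nonneg _) hc.le
      -- For spread vectors the image is read as a combination of columns, so the estimate is
      -- applied to the transposed array, which has the same law.
      · refine Or.inr ⟨OpBound.transpose (by positivity) hopD, x, hx, not_lt.1 hfl, ?_⟩
        refine le_trans (le_of_eq ?_) (hxle.trans (mul_le_mul_of_nonneg_right (min_le_left _ _)
          (Real.sqrt_nonneg _)))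
        congr 1
        funext i
        exact Finset.sum_congr rfl fun k _ => mul_comm _ _
    · exact Or.inl (Or.inl hop)
  calc _ ≤ _ := measureReal_mono hsub
    _ ≤ _ := measureReal_union_le _ _
    _ ≤ (_ + _) + _ := by gcongr; exact measureReal_union_le _ _
    _ ≤ (δ / 3 + δ / 3) + δ / 3 := by
        gcongr
        · exact (hrow _).trans h1
        · exact (hrow _).trans h2
        · exact (hcol _).trans h3
    _ = δ := by ring

theorem corollary1p5 (α κ M δ : ℝ) (hα₀ : 0 < α) (hα₁ : α < 1) (hκ : 0 < κ) (hδ : 0 < δ) :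
    (∀ R : ℝ, ∃ ε : ℝ, 0 < ε ∧ ∃ n₀ : ℕ, ∀ n : ℕ, n₀ ≤ n →
      ∀ p : I, κ * (n : ℝ) ^ (-α) ≤ (p : ℝ) →
      ∀ (Ω : Type u) [MeasurableSpace Ω] (μ : Measure Ω) [IsProbabilityMeasure μ]
        (χ ξ : Fin n → Fin n → Ω → ℝ), IsSparseEnsemble (momentExponent α) M p μ χ ξ →
      ∀ d : Fin n → ℝ,
        ‖Matrix.toEuclideanCLM (n := Fin n) (𝕜 := ℝ) (Matrix.diagonal d)‖
          ≤ R * √((n : ℝ) * (p : ℝ)) →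
        μ.real {ω | sMin (sparseMatrix χ ξ ω + Matrix.diagonal d) ≤ ε * √((p : ℝ) / (n : ℝ))}
          ≤ δ) ∧
    (∃ K₀ : ℝ, ∃ n₀ : ℕ, ∀ n : ℕ, n₀ ≤ n →
      ∀ p : I, κ * (n : ℝ) ^ (-α) ≤ (p : ℝ) →
      ∀ (Ω : Type u) [MeasurableSpace Ω] (μ : Measure Ω) [IsProbabilityMeasure μ]
        (χ ξ : Fin n → Fin n → Ω → ℝ), IsSparseEnsemble (momentExponent α) M p μ χ ξ →
        1 - δ ≤ μ.real {ω | condNumber (sparseMatrix χ ξ ω) ≤ ENNReal.ofReal (K₀ * (n : ℝ))}) := by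
  constructor
  · intro R
    obtain ⟨K, -, ε, hε, n₀, hn₀⟩ := exists_measureReal_not_opBound_or_exists_le M hα₀ hα₁ hκ hδ
      (le_max_right R 0)
    -- Halving `ε` turns the weak inequality on `sMin` into a strict one, so that a vector below the
    -- level exists without showing that the infimum is attained.
    refine ⟨ε / 2, by positivity, n₀, fun n hn p hp Ω _ μ _ χ ξ h d hd => ?_⟩
    obtain ⟨hn0, H⟩ := hn₀ n hn
    have hn1 : (0 : ℝ) < n := by exact_mod_cast hn0
    have hp0 : 0 < (p : ℝ) := lt_of_lt_of_le (by positivity) hp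
    refine le_trans (measureReal_mono fun ω hω => Or.inr ?_) (H p hp Ω μ χ ξ h (Matrix.diagonal d)
      ((opBound_of_norm_le hd).mono (mul_le_mul_of_nonneg_right (le_max_left _ _)
        (Real.sqrt_nonneg _))))
    refine exists_l2_mv_le_of_sMin_lt hn0 (lt_of_le_of_lt hω ?_)
    have : 0 < √((p : ℝ) / n) := by positivity
    gcongr
    linarith
  · obtain ⟨K, hK, ε, hε, n₀, hn₀⟩ := exists_measureReal_not_opBound_or_exists_le M hα₀ hα₁ hκ hδ
      le_rfl
    refine ⟨K / ε, n₀, fun n hn p hp Ω _ μ _ χ ξ h => ?_⟩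
    obtain ⟨hn0, H⟩ := hn₀ n hn
    have hn1 : (0 : ℝ) < n := by exact_mod_cast hn0
    have hp0 : 0 < (p : ℝ) := lt_of_lt_of_le (by positivity) hp
    have hbad := H p hp Ω μ χ ξ h 0 fun x => by
      have : mv (0 : Matrix (Fin n) (Fin n) ℝ) x = 0 := Matrix.zero_mulVec x
      rw [zero_mul, zero_mul]
      exact (congrArg l2 this).le.trans_eq l2_zero
    set S := {ω | condNumber (sparseMatrix χ ξ ω) ≤ ENNReal.ofReal (K / ε * (n : ℝ))}
    have hsub : Sᶜ ⊆ {ω | ¬ OpBound (sparseMatrix χ ξ ω) (K * √((n : ℝ) * p)) ∨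
          ∃ x, l2 x = 1 ∧ l2 (mv (sparseMatrix χ ξ ω + 0) x) ≤ ε * √((p : ℝ) / n)} := by
      intro ω hω
      by_contra hgood
      rw [Set.mem_ofPred_eq, not_or, not_not] at hgood
      obtain ⟨hop, hlow⟩ := hgood
      push Not at hlow
      refine hω ?_
      have hle := condNumber_le (sMax_le hn0 hop) (show 0 < ε * √((p : ℝ) / n) by positivity)
        (by positivity) (le_sMin hn0 fun x hx => by
          have h0 : sparseMatrix χ ξ ω + 0 = sparseMatrix χ ξ ω := add_zero _
          exact (hlow x hx).le.trans_eq (congrArg (fun B => l2 (mv B x)) h0))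
      have e : K * √((n : ℝ) * p) / (ε * √((p : ℝ) / n)) = K / ε * n := by
        have h1 : √((n : ℝ) * p) = n * √((p : ℝ) / n) := by
          rw [Real.sqrt_eq_iff_mul_self_eq (by positivity) (by positivity)]
          have := Real.mul_self_sqrt (show 0 ≤ (p : ℝ) / n by positivity)
          symm
          calc (n : ℝ) * √((p : ℝ) / n) * (n * √((p : ℝ) / n))
              = n * n * (√((p : ℝ) / n) * √((p : ℝ) / n)) := by ring
            _ = n * p := by rw [this]; field_simp
        have h2 : 0 < √((p : ℝ) / n) := by positivity
        rw [h1]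
        field_simp
      rw [e] at hle
      exact hle
    -- Subadditivity suffices here and avoids measurability of `S`.
    have h1 : (1 : ℝ) ≤ μ.real S + μ.real Sᶜ := by
      have := measureReal_union_le (μ := μ) S Sᶜ
      rwa [Set.union_compl_self, probReal_univ] at this
    have h2 := (measureReal_mono hsub).trans hbad
    linarith
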